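/- Let $n,k\in\{1,2,\dots\}$ and $p\in[1,\infty)$; functions $f$ on $\mathbb{R}^n$ are scalar-valued. A cube has edges parallel to the axes and edge length in $(0,\infty)$. For a nonnegative locally integrable $\omega$ on $\mathbb{R}^n$ put $$[\omega]_{A_t}:=\sup_Q\Big(\frac1{|Q|}\int_Q\omega\Big)\Big(\frac1{|Q|}\int_Q\omega^{-\frac1{t-1}}\Big)^{t-1}\ (1<t<\infty),\qquad [\omega]_{A_1}:=\sup_Q\Big(\frac1{|Q|}\int_Q\omega\Big)\|\omega^{-1}\|_{L^\infty(Q)},$$ the suprema being over all cubes $Q$; write $\omega\in A_t$ if $[\omega]_{A_t}<\infty$, and for $\omega\in A_p$ let $p_\omega:=\inf\{t\in[1,\infty):\omega\in A_t\}$. Let $\|g\|_{L^p_\omega}:=(\int_{\mathbb{R}^n}|g|^p\omega)^{1/p}$, and let $\dot W^{k,p}_\omega$ be the set of $f\in L^1_{\rm loc}(\mathbb{R}^n)$ whose weak derivatives $\partial^\alpha f$ exist and lie in $L^p_\omega$ for all multi-indices $\alpha$ with $|\alpha|=k$; put $|\nabla^kf|:=(\sum_{|\alpha|=k}|\partial^\alpha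 f|^2)^{1/2}$. Let $\Delta_h^kf(x):=\sum_{j=0}^k(-1)^{k-j}\binom kj f(x+jh)$, $B(\mathbf 0,r):=\{h\in\mathbb{R}^n:|h|<r\}$, and for $q\in[1,\infty)$, $s\in(0,1)$, $r\in(0,\infty)$, $$G_{s,r}(f):=\left\{\int_{\mathbb{R}^n}\left[\int_{B(\mathbf 0,r)}\frac{|\Delta_h^kf(x)|^q}{|h|^{n+skq}}\,dh\right]^{\frac pq}\omega(x)\,dx\right\}^{\frac1p}.$$ Let $\gamma_{p,q}:=1$ if $p=1$ and $\gamma_{p,q}:=\frac1q$ if $p\in(1,\infty)$. (i) Let $q\in[1,\infty)$ satisfy $n(\frac1p-\frac1q)<k$. There is a constant $C\in(0,\infty)$, depending only on $n,k,p,q$, such that for all $\omega\in A_1$, $s\in(0,1)$, $r\in(0,\infty)$ and $f\in\dot W^{k,p}_\omega$, $$(1-s)^{\gamma_{p,q}}\,G_{s,r}(f)\le C\,[\omega]_{A_1}^{\frac1p}\,r^{(1-s)k}\,\big\|\,|\nabla^kf|\,\big\|_{L^p_\omega}.$$ Moreover, the exponent $\frac1p$ on $[\omega]_{A_1}$ is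 sharp: if, for some $s\in(0,1)$ and $b\in\mathbb{R}$, there is $C\in(0,\infty)$ such that $(1-s)^{\gamma_{p,q}}G_{s,r}(f)\le C[\omega]_{A_1}^{b}r^{(1-s)k}\||\nabla^kf|\|_{L^p_\omega}$ for all $\omega\in A_1$, $r\in(0,\infty)$ and $f\in\dot W^{k,p}_\omega$, then $b\ge\frac1p$. (ii) Let $p\in(1,\infty)$ and $q\in[1,\infty)$. For each $\beta\in(1,p)$ there is a constant $C_{(n,k,p,q,\beta)}\in(0,\infty)$, depending only on the indicated parameters, with the following property. For every $\omega\in A_p$ with $n(\frac{p_\omega}p-\frac1q)<k$ there is $\beta\in(p_\omega,p)$ with $\omega\in A_\beta$ such that for all $s\in(0,1)$, $r\in(0,\infty)$ and $f\in\dot W^{k,p}_\omega$, $$(1-s)^{\frac1q}\,G_{s,r}(f)\le C_{(n,k,p,q,\beta)}\,[\omega]_{A_\beta}^{\frac\beta{p(\beta-1)}}\,r^{(1-s)k}\,\big\|\,|\nabla^kf|\,\big\|_{L^p_\omega}.$$ -/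

import Mathlib

open MeasureTheory Set
open scoped ENNReal

noncomputable section

/-- The closed cube with lower corner `a`, edge length `ℓ` and edges parallel to the axes. -/
def axisCube {n : ℕ} (a : EuclideanSpace ℝ (Fin n)) (ℓ : ℝ) : Set (EuclideanSpace ℝ (Fin n)) :=
  {x | ∀ i, x i ∈ Icc (a i) (a i + ℓ)}

/-- The average `(1/|Q|) ∫_Q u` of a `[0, ∞]`-valued function. -/
def meanOn {n : ℕ} (Q : Set (EuclideanSpace ℝ (Fin n)))
    (u : EuclideanSpace ℝ (Fin n) → ℝ≥0∞) : ℝ≥0∞ :=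
  (volume Q)⁻¹ * ∫⁻ x in Q, u x

/-- The Muckenhoupt constant `[ω]_{A_p}`, `1 ≤ p < ∞`, with values in `[0, ∞]`; the supremum is
over all cubes of finite positive edge length. A zero of `ω` has reciprocal `∞`. -/
def muckenhouptConst {n : ℕ} (p : ℝ) (ω : EuclideanSpace ℝ (Fin n) → ℝ) : ℝ≥0∞ :=
  if p = 1 then
    ⨆ (a : EuclideanSpace ℝ (Fin n)) (ℓ : ℝ) (_ : 0 < ℓ),
      meanOn (axisCube a ℓ) (fun x => ENNReal.ofReal (ω x)) *
        essSup (fun x => (ENNReal.ofReal (ω x))⁻¹) (volume.restrict (axisCube a ℓ))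
  else
    ⨆ (a : EuclideanSpace ℝ (Fin n)) (ℓ : ℝ) (_ : 0 < ℓ),
      meanOn (axisCube a ℓ) (fun x => ENNReal.ofReal (ω x)) *
        meanOn (axisCube a ℓ) (fun x => ENNReal.ofReal (ω x) ^ (-(1 / (p - 1)))) ^ (p - 1)

/-- `ω ∈ A_p`, for `1 ≤ p < ∞`. -/
structure IsMuckenhoupt {n : ℕ} (p : ℝ) (ω : EuclideanSpace ℝ (Fin n) → ℝ) : Prop where
  nonneg : ∀ x, 0 ≤ ω x
  locallyIntegrable : LocallyIntegrable ω volume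
  const_lt_top : muckenhouptConst p ω < ∞

/-- The critical index `p_ω = inf {r ∈ [1, ∞) : ω ∈ A_r}`. -/
def muckenhouptIndex {n : ℕ} (ω : EuclideanSpace ℝ (Fin n) → ℝ) : ℝ :=
  sInf {r : ℝ | 1 ≤ r ∧ IsMuckenhoupt r ω}

/-- The `L^p_ω` norm `(∫ |g|^p ω)^{1/p}`, with values in `[0, ∞]`. -/
def weightedLpNorm {n : ℕ} {F : Type*} [NormedAddCommGroup F] (p : ℝ)
    (ω : EuclideanSpace ℝ (Fin n) → ℝ) (g : EuclideanSpace ℝ (Fin n) → F) : ℝ≥0∞ :=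
  (∫⁻ x, ‖g x‖ₑ ^ p * ENNReal.ofReal (ω x)) ^ (1 / p)

/-- The classical first partial derivative in the `i`-th coordinate direction. -/
def classicalPartial {n : ℕ} (i : Fin n) (φ : EuclideanSpace ℝ (Fin n) → ℝ) :
    EuclideanSpace ℝ (Fin n) → ℝ :=
  fun x => fderiv ℝ φ x (EuclideanSpace.single i 1)

/-- The classical partial derivative `∂^α φ` for a multi-index `α`. (It is applied to smooth `φ`
only, where the order of differentiation is irrelevant.) -/
def classicalMultiPartial {n : ℕ} (α : Fin n → ℕ) (φ : EuclideanSpace ℝ (Fin n) → ℝ) :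
    EuclideanSpace ℝ (Fin n) → ℝ :=
  (List.finRange n).foldr (fun i ψ => (classicalPartial i)^[α i] ψ) φ

/-- The locally integrable function `g` is an `α`-th weak partial derivative of `f`. -/
def IsWeakPartial {n : ℕ} {𝕜 : Type*} [RCLike 𝕜] (α : Fin n → ℕ)
    (f g : EuclideanSpace ℝ (Fin n) → 𝕜) : Prop :=
  LocallyIntegrable g volume ∧
    ∀ φ : EuclideanSpace ℝ (Fin n) → ℝ, ContDiff ℝ ((⊤ : ℕ∞) : WithTop ℕ∞) φ → HasCompactSupport φ →
      ∫ x, classicalMultiPartial α φ x • f x = (-1 : ℝ) ^ (∑ i, α i) • ∫ x, φ x • g x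

open Classical in
/-- The weak partial derivative `∂^α f` (unique up to null sets), and `0` if there is none. -/
def weakPartial {n : ℕ} {𝕜 : Type*} [RCLike 𝕜] (α : Fin n → ℕ)
    (f : EuclideanSpace ℝ (Fin n) → 𝕜) : EuclideanSpace ℝ (Fin n) → 𝕜 :=
  if h : ∃ g, IsWeakPartial α f g then h.choose else 0

/-- The multi-indices `α` in `n` variables with `|α| = k`. -/
def multiIndices (n k : ℕ) : Finset (Fin n → ℕ) :=
  Finset.piAntidiag Finset.univ k

/-- `f` belongs to the homogeneous weighted Sobolev space of order `k` and exponent `p`. -/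
def MemHomSobolev {n : ℕ} {𝕜 : Type*} [RCLike 𝕜] (k : ℕ) (p : ℝ)
    (ω : EuclideanSpace ℝ (Fin n) → ℝ) (f : EuclideanSpace ℝ (Fin n) → 𝕜) : Prop :=
  LocallyIntegrable f volume ∧
    ∀ α ∈ multiIndices n k,
      (∃ g, IsWeakPartial α f g) ∧ weightedLpNorm p ω (weakPartial α f) < ∞

/-- The pointwise length `|∇^k f|` of the vector of all weak derivatives of order `k`. -/
def weakGradLength {n : ℕ} {𝕜 : Type*} [RCLike 𝕜] (k : ℕ)
    (f : EuclideanSpace ℝ (Fin n) → 𝕜) : EuclideanSpace ℝ (Fin n) → ℝ :=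
  fun x => √(∑ α ∈ multiIndices n k, ‖weakPartial α f x‖ ^ 2)

/-- The `k`-th order difference `Δ_h^k f`. -/
def orderDiff {n : ℕ} {𝕜 : Type*} [RCLike 𝕜] (k : ℕ) (h : EuclideanSpace ℝ (Fin n))
    (f : EuclideanSpace ℝ (Fin n) → 𝕜) : EuclideanSpace ℝ (Fin n) → 𝕜 :=
  fun x => ∑ j ∈ Finset.range (k + 1),
    (-1 : 𝕜) ^ (k - j) * (k.choose j : 𝕜) * f (x + (j : ℝ) • h)

/-- The localized Gagliardo quantity
`{∫ [∫_{B(0,r)} |Δ_h^k f(x)|^q / |h|^{n+skq} dh]^{p/q} ω(x) dx}^{1/p}`. -/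
def localGagliardo {n : ℕ} {𝕜 : Type*} [RCLike 𝕜] (k : ℕ) (p q s r : ℝ)
    (ω : EuclideanSpace ℝ (Fin n) → ℝ) (f : EuclideanSpace ℝ (Fin n) → 𝕜) : ℝ≥0∞ :=
  (∫⁻ x, (∫⁻ h in Metric.ball (0 : EuclideanSpace ℝ (Fin n)) r,
      ‖orderDiff k h f x‖ₑ ^ q / ENNReal.ofReal (‖h‖ ^ ((n : ℝ) + s * k * q))) ^ (p / q) *
    ENNReal.ofReal (ω x)) ^ (1 / p)

/-- The exponent `γ_{p,q}`. -/
def gammaExponent (p q : ℝ) : ℝ := if p = 1 then 1 else 1 / q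

end

/-!
# Gagliardo type estimates for higher order differences with Muckenhoupt weights

*Pointwise bound.* Taylor's formula writes the `k`-th difference `Δ_h^k f(y)` as an average of the
derivatives of order `k` along the segment from `y` to `y + k h`, against a kernel bounded by a
multiple of `t ^ (k - 1)` (`exists_diffKernel`). Testing against smooth functions extends this to
weak derivatives, so that for almost every `y` and almost every `h`, with `g = |∇^k f|`,
`|Δ_h^k f(y)| ≤ C |h| ^ k ∫_0^k t ^ (k - 1) g(y + t h) dt` (`exists_pointwise_bound`).

*One scale.* Integrated over `|h| < R`, this bounds the `L^1` mean of `|Δ_h^k f(y)|` by `R ^ k`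
times `radialMean`, an average of the means of `|∇^k f|` over the balls `B(y, t R)`. To pass from
`L^1` to `L^q` in `h`, an algebraic identity (`sum_orderDiff_swap`) exchanges the difference
`Δ_h^k f(x)` for differences `Δ_{l w}^k f(x + l h)` and `Δ_{h + l w}^k f(x)` with an auxiliary step
`w`. Averaging in `w` uses only `L^1` means, now at base points `x + l h` that vary with `h`, and
the averaging operator `g ↦ radialMean g` maps `L^u` of a ball to `L^q` of a smaller one because
`n (1 / u - 1 / q) < k`. The result is `exists_unitBallMean_orderDiff_rpow_le`.

*All scales.* Cutting the ball `B(0, r)` into dyadic annuli gives a geometric series with ratio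
`2 ^ (-(1 - s) k q)` (`exists_setLIntegral_orderDiff_le_tsum`), whose sum is of order `1 / (1 - s)`.
If `p > 1`, the means are dominated by the maximal function of `|∇^k f| ^ u` to the power `1 / u`,
which accounts for the factor `(1 - s) ^ (1 / q)`, and it remains to bound the maximal function on
`L^{p/u}(ω)` (`exists_lintegral_orderDiff_le_of_maximal`). If `p = 1`, the series is integrated
term by term against the weight, means over balls being symmetric operators that change an `A_1`
weight by at most a factor; taking the power `1 / q` inside the series costs the full factor
`1 - s` (`exists_lintegral_orderDiff_le_of_unitBallMean_le`).

*Weights.* For `A_1` weights and `p > 1` one takes `u < p` close to `p`; the integral of the power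
`t > 1` of the maximal function against `ω` is bounded with a constant linear in `[ω]_{A_1}`, and
the `p`-th root produces the exponent `1 / p`. For `A_β` weights one takes `u = p / β` and Buckley's
bound `[ω]_{A_β} ^ (1 / (β - 1))` for the norm of the maximal function on `L^β(ω)`, in Lerner's form
(`exists_lintegral_centredMaximal_rpow_mul_le`). That some `β < p` is admissible is the
open-endedness of the Muckenhoupt classes (`IsMuckenhoupt.exists_lt`), proved through the reverse
Hölder inequality for the dual weight: Besicovitch's covering theorem bounds the integral of the
dual weight over its superlevel sets, and Gehring's lemma turns this into higher integrability.

*Sharpness.* The weight equal to `N` on `B(0, 1 / 4)` and `1` elsewhere has `A_1` constant at most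
`N`. A bump at distance `1` from the origin does not see the peak through its gradient, but its
differences based near the origin do, so the left side grows like `N ^ (1 / p)` while the norm of
the gradient stays bounded (`one_div_le_of_localGagliardo_le`).
-/


/-! ### Taylor expansion of differences in one variable -/

/-- Taylor's formula. -/
lemma taylor_iteratedDeriv {Φ : ℝ → ℝ} (hΦ : ContDiff ℝ ((⊤ : ℕ∞) : WithTop ℕ∞) Φ) (m : ℕ)
    (a x : ℝ) :
    Φ x = ∑ i ∈ Finset.range (m + 1), ((i.factorial : ℝ)⁻¹ * iteratedDeriv i Φ a) * (x - a) ^ i +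
      ∫ t in a..x, (x - t) ^ m / m.factorial * iteratedDeriv (m + 1) Φ t := by
  rcases eq_or_ne a x with rfl | hne
  · simp [Finset.sum_range_succ']
  have hu : UniqueDiffOn ℝ (uIcc a x) := uniqueDiffOn_uIcc hne
  have hc : ∀ i : ℕ, ContDiff ℝ i Φ := fun i => hΦ.of_le (by exact_mod_cast le_top)
  have key := taylor_integral_remainder (f := Φ) (x := x) (x₀ := a) (n := m)
    ((hc (m + 1)).contDiffOn)
  have e : ∀ i : ℕ, ∀ t ∈ uIcc a x,
      iteratedDerivWithin i Φ (uIcc a x) t = iteratedDeriv i Φ t := fun i t ht =>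
    iteratedDerivWithin_eq_iteratedDeriv hu (hc i).contDiffAt ht
  rw [taylor_within_apply] at key
  rw [sub_eq_iff_eq_add'] at key
  rw [key]
  congr 1
  · refine Finset.sum_congr rfl fun i _ => ?_
    rw [e i a left_mem_uIcc, smul_eq_mul]; ring
  · refine intervalIntegral.integral_congr fun t ht => ?_
    simp only [smul_eq_mul]
    rw [e (m + 1) t ht]

/-- The Peano kernel of the `k`-th difference, `k = m + 1`. Expanding at the right end point `k`
instead of the left one makes the kernel vanish to order `t ^ m` at the base point `0`; this gain
of a power is what the local Sobolev inequality feeds on. -/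
lemma exists_diffKernel (m : ℕ) : ∃ M : ℝ → ℝ, Measurable M ∧
    (∀ t, 0 ≤ t → |M t| ≤ 2 ^ (m + 1) * t ^ m) ∧
    ∀ Φ : ℝ → ℝ, ContDiff ℝ ((⊤ : ℕ∞) : WithTop ℕ∞) Φ →
      ∑ j ∈ Finset.range (m + 1 + 1), (-1 : ℝ) ^ (m + 1 - j) * ((m + 1).choose j : ℝ) * Φ j =
        ∫ t in (0 : ℝ)..(m + 1 : ℕ), M t * iteratedDeriv (m + 1) Φ t := by
  set c : ℕ → ℝ := fun j => (-1 : ℝ) ^ (m + 1 - j) * ((m + 1).choose j : ℝ) with hc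
  set κ : ℕ → ℝ → ℝ := fun j => (Ici (j : ℝ)).indicator
    (fun t => -(((j : ℝ) - t) ^ m / m.factorial)) with hκ
  have hκm : ∀ j, Measurable (κ j) := fun j =>
    Measurable.indicator (by fun_prop) measurableSet_Ici
  refine ⟨fun t => ∑ j ∈ Finset.range (m + 1 + 1), c j * κ j t, ?_, ?_, ?_⟩
  · exact Finset.measurable_fun_sum _ fun j _ => (hκm j).const_mul _
  · intro t ht
    have h1 : ∀ j, |κ j t| ≤ t ^ m := by
      intro j
      simp only [hκ, indicator]
      split_ifs with h
      · have h' : (j : ℝ) ≤ t := h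
        rw [abs_neg, abs_div, abs_pow, Nat.abs_cast]
        calc |(j : ℝ) - t| ^ m / m.factorial ≤ |(j : ℝ) - t| ^ m / 1 := by
              gcongr
              exact_mod_cast Nat.one_le_iff_ne_zero.2 m.factorial_ne_zero
          _ ≤ t ^ m := by
              rw [div_one]
              gcongr
              rw [abs_sub_comm, abs_of_nonneg (by linarith)]
              have : (0 : ℝ) ≤ j := j.cast_nonneg
              linarith
      · simp; positivity
    calc |∑ j ∈ Finset.range (m + 1 + 1), c j * κ j t|
        ≤ ∑ j ∈ Finset.range (m + 1 + 1), |c j * κ j t| := Finset.abs_sum_le_sum_abs _ _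
      _ ≤ ∑ j ∈ Finset.range (m + 1 + 1), ((m + 1).choose j : ℝ) * t ^ m := by
          refine Finset.sum_le_sum fun j _ => ?_
          rw [abs_mul, hc]
          simp only [abs_mul, abs_pow, abs_neg, abs_one, one_pow, one_mul, Nat.abs_cast]
          gcongr
          exact h1 j
      _ = 2 ^ (m + 1) * t ^ m := by
          rw [← Finset.sum_mul]
          congr 1
          exact_mod_cast Nat.sum_range_choose (m + 1)
  · intro Φ hΦ
    have hcont : Continuous (iteratedDeriv (m + 1) Φ) :=
      hΦ.continuous_iteratedDeriv _ (by exact_mod_cast le_top)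
    set a : ℝ := ((m + 1 : ℕ) : ℝ) with ha
    have hint : ∀ j, ∀ u w : ℝ,
        IntervalIntegrable (fun t => κ j t * iteratedDeriv (m + 1) Φ t) volume u w := by
      intro j u w
      have : IntervalIntegrable (fun t => -(((j : ℝ) - t) ^ m / m.factorial) *
          iteratedDeriv (m + 1) Φ t) volume u w :=
        Continuous.intervalIntegrable (by fun_prop) _ _
      rw [intervalIntegrable_iff] at this ⊢
      refine (this.indicator (measurableSet_Ici (a := (j : ℝ)))).congr ?_
      filter_upwards with t
      simp only [hκ, indicator]
      split_ifs <;> simp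
    -- the remainder in Taylor's formula at `j`, expanded at `a`, is the integral of `κ j`
    have hrem : ∀ j ∈ Finset.range (m + 1 + 1),
        ∫ t in a..(j : ℝ), ((j : ℝ) - t) ^ m / m.factorial * iteratedDeriv (m + 1) Φ t =
          ∫ t in (0 : ℝ)..a, κ j t * iteratedDeriv (m + 1) Φ t := by
      intro j hj
      have hja : (j : ℝ) ≤ a := by
        rw [ha]; exact_mod_cast Nat.lt_succ_iff.1 (Finset.mem_range.1 hj)
      rw [← intervalIntegral.integral_add_adjacent_intervals (hint j 0 j) (hint j j a)]
      have z : ∫ t in (0 : ℝ)..j, κ j t * iteratedDeriv (m + 1) Φ t = 0 := by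
        rw [intervalIntegral.integral_of_le j.cast_nonneg, ← integral_Ico_eq_integral_Ioc]
        rw [setIntegral_congr_fun (g := fun _ => (0 : ℝ)) measurableSet_Ico]
        · simp
        · intro t ht
          have : ¬ (j : ℝ) ≤ t := not_le.2 ht.2
          simp [hκ, this]
      rw [z, zero_add, intervalIntegral.integral_symm, ← intervalIntegral.integral_neg]
      refine intervalIntegral.integral_congr fun t ht => ?_
      rw [uIcc_of_le hja] at ht
      have : (j : ℝ) ≤ t := ht.1
      simp [hκ, this]
    -- the difference of order `m + 1` annihilates the Taylor polynomial of degree `m`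
    have hpoly := congrFun (fwdDiff_iter_sum_mul_pow_eq_zero (R := ℝ) (n := m + 1)
      (fun i => (i.factorial : ℝ)⁻¹ * iteratedDeriv i Φ a)) (-a)
    rw [fwdDiff_iter_eq_sum_shift] at hpoly
    have hsum : ∀ j ∈ Finset.range (m + 1 + 1), c j * Φ j =
        ((-1 : ℤ) ^ (m + 1 - j) * ((m + 1).choose j : ℤ)) •
          (∑ i ∈ Finset.range (m + 1),
            ((i.factorial : ℝ)⁻¹ * iteratedDeriv i Φ a) * (-a + j • (1 : ℝ)) ^ i) +
        ∫ t in (0 : ℝ)..a, c j * (κ j t * iteratedDeriv (m + 1) Φ t) := by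
      intro j hj
      rw [intervalIntegral.integral_const_mul, ← hrem j hj]
      conv_lhs => rw [taylor_iteratedDeriv hΦ m a j]
      rw [mul_add, zsmul_eq_mul, hc]
      simp only [nsmul_eq_mul, mul_one, neg_add_eq_sub]
      push_cast
      rfl
    rw [Finset.sum_congr rfl hsum, Finset.sum_add_distrib, hpoly,
      ← intervalIntegral.integral_finsetSum (fun j _ => (hint j 0 a).const_mul _)]
    simp only [Pi.zero_apply, zero_add]
    refine intervalIntegral.integral_congr fun t _ => ?_
    simp only [Finset.sum_mul, mul_assoc]

/-! ### Classical partial derivatives -/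

section Partials

variable {n : ℕ}

lemma ContDiff.classicalPartial {φ : EuclideanSpace ℝ (Fin n) → ℝ}
    (hφ : ContDiff ℝ ((⊤ : ℕ∞) : WithTop ℕ∞) φ) (i : Fin n) :
    ContDiff ℝ ((⊤ : ℕ∞) : WithTop ℕ∞) (classicalPartial i φ) :=
  (hφ.fderiv_right (by exact_mod_cast le_top)).clm_apply contDiff_const

lemma ContDiff.classicalPartial_iterate {φ : EuclideanSpace ℝ (Fin n) → ℝ}
    (hφ : ContDiff ℝ ((⊤ : ℕ∞) : WithTop ℕ∞) φ) (i : Fin n) (a : ℕ) :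
    ContDiff ℝ ((⊤ : ℕ∞) : WithTop ℕ∞) ((_root_.classicalPartial i)^[a] φ) := by
  induction a with
  | zero => exact hφ
  | succ a ih => rw [Function.iterate_succ_apply']; exact ih.classicalPartial i

lemma classicalPartial_comm {φ : EuclideanSpace ℝ (Fin n) → ℝ}
    (hφ : ContDiff ℝ ((⊤ : ℕ∞) : WithTop ℕ∞) φ) (i j : Fin n) :
    classicalPartial i (classicalPartial j φ) = classicalPartial j (classicalPartial i φ) := by
  have hd : Differentiable ℝ (fderiv ℝ φ) :=
    (hφ.fderiv_right (m := ((⊤ : ℕ∞) : WithTop ℕ∞)) (by exact_mod_cast le_top)).differentiable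
      (by simp)
  have e : ∀ i j : Fin n, ∀ x, classicalPartial i (classicalPartial j φ) x =
      fderiv ℝ (fderiv ℝ φ) x (EuclideanSpace.single i 1) (EuclideanSpace.single j 1) := by
    intro i j x
    unfold classicalPartial
    rw [fderiv_clm_apply (hd x) (differentiableAt_const _)]
    simp
  ext x
  rw [e, e]
  have hs : IsSymmSndFDerivAt ℝ φ x := hφ.contDiffAt.isSymmSndFDerivAt
    (by
      rw [minSmoothness_of_isRCLikeNormedField]
      exact WithTop.coe_le_coe.2 (le_top : (2 : ℕ∞) ≤ ⊤))
  exact hs _ _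

lemma classicalPartial_iterate_comm {φ : EuclideanSpace ℝ (Fin n) → ℝ}
    (hφ : ContDiff ℝ ((⊤ : ℕ∞) : WithTop ℕ∞) φ) (i j : Fin n) (a : ℕ) :
    classicalPartial i ((classicalPartial j)^[a] φ) =
      (classicalPartial j)^[a] (classicalPartial i φ) := by
  induction a with
  | zero => rfl
  | succ a ih =>
    rw [Function.iterate_succ_apply', Function.iterate_succ_apply',
      classicalPartial_comm (hφ.classicalPartial_iterate j a), ih]

lemma contDiff_foldr_classicalPartial (α : Fin n → ℕ) {φ : EuclideanSpace ℝ (Fin n) → ℝ}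
    (hφ : ContDiff ℝ ((⊤ : ℕ∞) : WithTop ℕ∞) φ) (l : List (Fin n)) :
    ContDiff ℝ ((⊤ : ℕ∞) : WithTop ℕ∞)
      (l.foldr (fun i ψ => (classicalPartial i)^[α i] ψ) φ) := by
  induction l with
  | nil => exact hφ
  | cons j l ih => exact ih.classicalPartial_iterate j _

lemma ContDiff.classicalMultiPartial {φ : EuclideanSpace ℝ (Fin n) → ℝ}
    (hφ : ContDiff ℝ ((⊤ : ℕ∞) : WithTop ℕ∞) φ) (α : Fin n → ℕ) :
    ContDiff ℝ ((⊤ : ℕ∞) : WithTop ℕ∞) (classicalMultiPartial α φ) :=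
  contDiff_foldr_classicalPartial α hφ _

/-- Raising the exponent of one direction in the iterated derivative costs one further partial
derivative. The list `l` is the order in which the directions are processed. -/
lemma classicalPartial_foldr (α : Fin n → ℕ) {φ : EuclideanSpace ℝ (Fin n) → ℝ}
    (hφ : ContDiff ℝ ((⊤ : ℕ∞) : WithTop ℕ∞) φ) (i : Fin n) (l : List (Fin n)) (hl : l.Nodup)
    (hi : i ∈ l) :
    classicalPartial i (l.foldr (fun i ψ => (classicalPartial i)^[α i] ψ) φ) =
      l.foldr (fun j ψ => (classicalPartial j)^[(α + Pi.single i 1 : Fin n → ℕ) j] ψ) φ := by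
  induction l with
  | nil => simp at hi
  | cons j l ih =>
    rw [List.nodup_cons] at hl
    simp only [List.foldr_cons]
    by_cases hij : i = j
    · subst hij
      have hrest :
          l.foldr (fun j ψ => (classicalPartial j)^[(α + Pi.single i 1 : Fin n → ℕ) j] ψ) φ =
          l.foldr (fun j ψ => (classicalPartial j)^[α j] ψ) φ := by
        refine List.foldr_ext _ _ _ fun j hj ψ => ?_
        have : j ≠ i := fun h => hl.1 (h ▸ hj)
        simp [this]
      rw [hrest]
      simp only [Pi.add_apply, Pi.single_eq_same]
      rw [Function.iterate_succ_apply']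
    · have hil : i ∈ l := (List.mem_cons.1 hi).resolve_left hij
      rw [classicalPartial_iterate_comm (contDiff_foldr_classicalPartial α hφ l), ih hl.2 hil]
      have : j ≠ i := fun h => hij h.symm
      simp [this]

/-- Partial derivatives of smooth functions commute, so `∂_i ∂^α = ∂^(α + e_i)`. -/
lemma classicalPartial_classicalMultiPartial (α : Fin n → ℕ) {φ : EuclideanSpace ℝ (Fin n) → ℝ}
    (hφ : ContDiff ℝ ((⊤ : ℕ∞) : WithTop ℕ∞) φ) (i : Fin n) :
    classicalPartial i (classicalMultiPartial α φ) =
      classicalMultiPartial (α + Pi.single i 1) φ :=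
  classicalPartial_foldr α hφ i _ (List.nodup_finRange n) (List.mem_finRange i)

lemma classicalMultiPartial_zero (φ : EuclideanSpace ℝ (Fin n) → ℝ) :
    classicalMultiPartial 0 φ = φ := by
  unfold classicalMultiPartial
  induction List.finRange n with
  | nil => rfl
  | cons j l ih => exact ih

lemma classicalPartial_comp_add_right (i : Fin n) (φ : EuclideanSpace ℝ (Fin n) → ℝ)
    (c : EuclideanSpace ℝ (Fin n)) :
    classicalPartial i (fun x => φ (x + c)) = fun x => classicalPartial i φ (x + c) := by
  ext x
  unfold classicalPartial
  rw [fderiv_comp_add_right]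

lemma classicalMultiPartial_comp_add_right (α : Fin n → ℕ) (φ : EuclideanSpace ℝ (Fin n) → ℝ)
    (c : EuclideanSpace ℝ (Fin n)) :
    classicalMultiPartial α (fun x => φ (x + c)) = fun x => classicalMultiPartial α φ (x + c) := by
  unfold classicalMultiPartial
  have hit : ∀ (i : Fin n) (a : ℕ) (ψ : EuclideanSpace ℝ (Fin n) → ℝ),
      (classicalPartial i)^[a] (fun x => ψ (x + c)) =
        fun x => (classicalPartial i)^[a] ψ (x + c) := by
    intro i a ψ
    induction a with
    | zero => rfl
    | succ a ih =>
      rw [Function.iterate_succ_apply', ih, classicalPartial_comp_add_right,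
        Function.iterate_succ_apply']
  induction List.finRange n with
  | nil => rfl
  | cons j l ih => simp only [List.foldr_cons]; rw [ih, hit]

lemma tsupport_classicalPartial_subset (i : Fin n) (φ : EuclideanSpace ℝ (Fin n) → ℝ) :
    tsupport (classicalPartial i φ) ⊆ tsupport φ := by
  refine closure_minimal (fun x hx => ?_) isClosed_closure
  refine support_fderiv_subset ℝ (f := φ) fun h0 => hx ?_
  simp [classicalPartial, h0]

lemma tsupport_classicalMultiPartial_subset (α : Fin n → ℕ)
    (φ : EuclideanSpace ℝ (Fin n) → ℝ) :
    tsupport (classicalMultiPartial α φ) ⊆ tsupport φ := by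
  have hit : ∀ (i : Fin n) (a : ℕ) (ψ : EuclideanSpace ℝ (Fin n) → ℝ),
      tsupport ((classicalPartial i)^[a] ψ) ⊆ tsupport ψ := by
    intro i a ψ
    induction a with
    | zero => rfl
    | succ a ih =>
      rw [Function.iterate_succ_apply']
      exact (tsupport_classicalPartial_subset i _).trans ih
  unfold classicalMultiPartial
  induction List.finRange n with
  | nil => rfl
  | cons j l ih => exact (hit j _ _).trans ih

lemma HasCompactSupport.classicalMultiPartial {φ : EuclideanSpace ℝ (Fin n) → ℝ}
    (hφ : HasCompactSupport φ) (α : Fin n → ℕ) :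
    HasCompactSupport (classicalMultiPartial α φ) :=
  hφ.of_isClosed_subset isClosed_closure (tsupport_classicalMultiPartial_subset α φ)

/-- The multi-index of a sequence of directions: how often each direction occurs. -/
def directionCount {k : ℕ} (I : Fin k → Fin n) : Fin n → ℕ :=
  fun i => ∑ j, if I j = i then 1 else 0

lemma directionCount_mem {k : ℕ} (I : Fin k → Fin n) :
    directionCount I ∈ multiIndices n k := by
  rw [multiIndices, Finset.mem_piAntidiag]
  refine ⟨?_, fun i _ => Finset.mem_univ i⟩
  unfold directionCount
  rw [Finset.sum_comm]
  simp

lemma directionCount_cons {k : ℕ} (i : Fin n) (I : Fin k → Fin n) :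
    directionCount (Fin.cons i I : Fin (k + 1) → Fin n) = directionCount I + Pi.single i 1 := by
  ext j
  simp only [directionCount, Fin.sum_univ_succ, Fin.cons_zero, Fin.cons_succ, Pi.add_apply,
    Pi.single_apply]
  rw [add_comm]
  congr 1
  simp [eq_comm]

lemma hasDerivAt_comp_line {ψ : EuclideanSpace ℝ (Fin n) → ℝ}
    (hψ : ContDiff ℝ ((⊤ : ℕ∞) : WithTop ℕ∞) ψ) (y v : EuclideanSpace ℝ (Fin n)) (t : ℝ) :
    HasDerivAt (fun t : ℝ => ψ (y + t • v)) (∑ i, v i * classicalPartial i ψ (y + t • v)) t := by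
  have h1 : HasDerivAt (fun t : ℝ => y + t • v) v t := by
    simpa using ((hasDerivAt_id t).smul_const v).const_add y
  have h2 : HasFDerivAt ψ (fderiv ℝ ψ (y + t • v)) (y + t • v) :=
    (hψ.differentiable (by simp) _).hasFDerivAt
  have h3 := h2.comp_hasDerivAt t h1
  have h4 : ∀ L : EuclideanSpace ℝ (Fin n) →L[ℝ] ℝ,
      L v = ∑ i, v i * L (EuclideanSpace.single i 1) := by
    intro L
    conv_lhs => rw [← (EuclideanSpace.basisFun (Fin n) ℝ).sum_repr v]
    rw [map_sum]
    refine Finset.sum_congr rfl fun i _ => ?_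
    simp
  have h5 := h4 (fderiv ℝ ψ (y + t • v))
  unfold classicalPartial
  rw [← h5]
  exact h3

/-- The `k`-th derivative of a smooth function along a line. -/
lemma iteratedDeriv_comp_line {φ : EuclideanSpace ℝ (Fin n) → ℝ}
    (hφ : ContDiff ℝ ((⊤ : ℕ∞) : WithTop ℕ∞) φ) (y v : EuclideanSpace ℝ (Fin n)) (k : ℕ) :
    iteratedDeriv k (fun t : ℝ => φ (y + t • v)) = fun t =>
      ∑ I : Fin k → Fin n, (∏ j, v (I j)) *
        classicalMultiPartial (directionCount I) φ (y + t • v) := by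
  induction k with
  | zero =>
    ext t
    have : directionCount (default : Fin 0 → Fin n) = 0 := by ext i; simp [directionCount]
    simp [this, classicalMultiPartial_zero]
  | succ k ih =>
    rw [iteratedDeriv_succ, ih]
    ext t
    have hd := HasDerivAt.fun_sum (u := Finset.univ) (x := t)
      (A := fun (I : Fin k → Fin n) (t : ℝ) => (∏ j, v (I j)) *
        classicalMultiPartial (directionCount I) φ (y + t • v))
      (fun I _ => (hasDerivAt_comp_line (hφ.classicalMultiPartial (directionCount I)) y v
        t).const_mul (∏ j, v (I j)))
    rw [hd.deriv, ← (Fin.consEquiv (fun _ => Fin n)).sum_comp, Fintype.sum_prod_type_right]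
    refine Finset.sum_congr rfl fun I _ => ?_
    rw [Finset.mul_sum]
    refine Finset.sum_congr rfl fun i _ => ?_
    have e : (Fin.consEquiv (fun _ : Fin (k + 1) => Fin n)) (i, I) = Fin.cons i I := rfl
    rw [e, directionCount_cons, classicalPartial_classicalMultiPartial _ hφ, Fin.prod_univ_succ]
    simp only [Fin.cons_zero, Fin.cons_succ]
    ring

end Partials

/-! ### Differences of functions with weak derivatives -/

section WeakTaylor

variable {n : ℕ} {𝕜 : Type*} [RCLike 𝕜]

lemma orderDiff_eq_sum_smul (k : ℕ) (h : EuclideanSpace ℝ (Fin n))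
    (f : EuclideanSpace ℝ (Fin n) → 𝕜) (x : EuclideanSpace ℝ (Fin n)) :
    orderDiff k h f x = ∑ j ∈ Finset.range (k + 1),
      ((-1 : ℝ) ^ (k - j) * (k.choose j : ℝ)) • f (x + (j : ℝ) • h) := by
  unfold orderDiff
  refine Finset.sum_congr rfl fun j _ => ?_
  rw [Algebra.smul_def]
  simp

lemma integrable_prod_translate {g : EuclideanSpace ℝ (Fin n) → 𝕜}
    (hg : LocallyIntegrable g volume) {M : ℝ → ℝ} (hM : Measurable M) {k B : ℝ}
    (hMB : ∀ t ∈ Ioc 0 k, |M t| ≤ B) {ψ : EuclideanSpace ℝ (Fin n) → ℝ} (hψ : Measurable ψ)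
    {B' R : ℝ} (hψB : ∀ y, |ψ y| ≤ B') (hψR : ∀ y, R < ‖y‖ → ψ y = 0)
    (v : EuclideanSpace ℝ (Fin n)) :
    Integrable (fun z : ℝ × EuclideanSpace ℝ (Fin n) => (M z.1 * ψ (z.2 - z.1 • v)) • g z.2)
      ((volume.restrict (Ioc 0 k)).prod volume) := by
  have hK : IntegrableOn g (Metric.closedBall 0 (R + k * ‖v‖)) volume :=
    hg.integrableOn_isCompact (isCompact_closedBall _ _)
  have h1 : Integrable ((Metric.closedBall 0 (R + k * ‖v‖)).indicator g) volume :=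
    (integrable_indicator_iff measurableSet_closedBall).2 hK
  have h2 : Integrable (fun z : ℝ × EuclideanSpace ℝ (Fin n) =>
      (Metric.closedBall 0 (R + k * ‖v‖)).indicator g z.2)
      ((volume.restrict (Ioc 0 k)).prod volume) := h1.comp_snd _
  refine ((h2.norm.const_mul (B * B')).mono' ?_ ?_)
  · refine AEStronglyMeasurable.smul ?_ hg.aestronglyMeasurable.comp_snd
    exact (by fun_prop : Measurable fun z : ℝ × EuclideanSpace ℝ (Fin n) =>
      M z.1 * ψ (z.2 - z.1 • v)).aestronglyMeasurable
  · have hae : ∀ᵐ z : ℝ × EuclideanSpace ℝ (Fin n) ∂((volume.restrict (Ioc 0 k)).prod volume),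
        z.1 ∈ Ioc 0 k :=
      Measure.quasiMeasurePreserving_fst.ae (ae_restrict_mem measurableSet_Ioc)
    filter_upwards [hae] with z hz
    by_cases hzK : z.2 ∈ Metric.closedBall (0 : EuclideanSpace ℝ (Fin n)) (R + k * ‖v‖)
    · rw [indicator_of_mem hzK, norm_smul, Real.norm_eq_abs, abs_mul]
      have := hMB z.1 hz
      have := hψB (z.2 - z.1 • v)
      gcongr
      exact (abs_nonneg _).trans (hMB z.1 hz)
    · have : ψ (z.2 - z.1 • v) = 0 := by
        apply hψR
        rw [mem_closedBall_zero_iff, not_le] at hzK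
        have h3 := norm_sub_norm_le z.2 (z.1 • v)
        rw [norm_smul, Real.norm_eq_abs, abs_of_pos hz.1] at h3
        have : z.1 * ‖v‖ ≤ k * ‖v‖ := by gcongr; exact hz.2
        linarith
      simp [this, hzK]

lemma measurePreserving_shear (ν : Measure ℝ) [SFinite ν] (v : EuclideanSpace ℝ (Fin n)) :
    MeasurePreserving (fun z : ℝ × EuclideanSpace ℝ (Fin n) => (z.1, z.2 + z.1 • v))
      (ν.prod volume) (ν.prod volume) := by
  refine MeasurePreserving.skew_product (MeasurePreserving.id ν)
    (g := fun t y => y + t • v) (by fun_prop) ?_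
  filter_upwards with t
  exact map_add_right_eq_self volume (t • v)

lemma integrable_prod_translate' {g : EuclideanSpace ℝ (Fin n) → 𝕜}
    (hg : LocallyIntegrable g volume) {M : ℝ → ℝ} (hM : Measurable M) {k B : ℝ}
    (hMB : ∀ t ∈ Ioc 0 k, |M t| ≤ B) {ψ : EuclideanSpace ℝ (Fin n) → ℝ} (hψ : Measurable ψ)
    {B' R : ℝ} (hψB : ∀ y, |ψ y| ≤ B') (hψR : ∀ y, R < ‖y‖ → ψ y = 0)
    (v : EuclideanSpace ℝ (Fin n)) :
    Integrable (fun z : ℝ × EuclideanSpace ℝ (Fin n) => (M z.1 * ψ z.2) • g (z.2 + z.1 • v))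
      ((volume.restrict (Ioc 0 k)).prod volume) := by
  have h := integrable_prod_translate hg hM hMB hψ hψB hψR v
  have h2 := (measurePreserving_shear (volume.restrict (Ioc 0 k)) v).integrable_comp_of_integrable h
  refine h2.congr (Filter.Eventually.of_forall fun z => ?_)
  simp

/-- Averages along a segment with a bounded kernel preserve local integrability. -/
lemma locallyIntegrable_integral_line {g : EuclideanSpace ℝ (Fin n) → 𝕜}
    (hg : LocallyIntegrable g volume) {M : ℝ → ℝ} (hM : Measurable M) {k B : ℝ}
    (hMB : ∀ t ∈ Ioc 0 k, |M t| ≤ B) (v : EuclideanSpace ℝ (Fin n)) :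
    LocallyIntegrable (fun y => ∫ t in Ioc 0 k, M t • g (y + t • v)) volume := by
  rw [locallyIntegrable_iff]
  intro K hK
  obtain ⟨R, hR⟩ := hK.isBounded.subset_closedBall 0
  have h := integrable_prod_translate' hg hM hMB
    (ψ := (Metric.closedBall (0 : EuclideanSpace ℝ (Fin n)) R).indicator 1)
    (measurable_one.indicator measurableSet_closedBall) (B' := 1) (R := R)
    (fun y => by
      by_cases hy : y ∈ Metric.closedBall (0 : EuclideanSpace ℝ (Fin n)) R <;>
        simp [indicator, hy])
    (fun y hy => by simp [indicator, hy]) v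
  have h2 := h.integral_prod_right
  refine IntegrableOn.mono_set ?_ hR
  rw [← integrable_indicator_iff measurableSet_closedBall]
  refine h2.congr (Filter.Eventually.of_forall fun y => ?_)
  by_cases hy : y ∈ Metric.closedBall (0 : EuclideanSpace ℝ (Fin n)) R <;>
    simp [indicator, hy]

/-- The `k`-th difference of a function with weak derivatives of order `k` is a weighted average
of these derivatives along the segment. -/
lemma ae_orderDiff_eq_integral {m : ℕ} {M : ℝ → ℝ} (hMm : Measurable M)
    (hMB : ∀ t, 0 ≤ t → |M t| ≤ 2 ^ (m + 1) * t ^ m)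
    (hM : ∀ Φ : ℝ → ℝ, ContDiff ℝ ((⊤ : ℕ∞) : WithTop ℕ∞) Φ →
      ∑ j ∈ Finset.range (m + 1 + 1), (-1 : ℝ) ^ (m + 1 - j) * ((m + 1).choose j : ℝ) * Φ j =
        ∫ t in (0 : ℝ)..(m + 1 : ℕ), M t * iteratedDeriv (m + 1) Φ t)
    {f : EuclideanSpace ℝ (Fin n) → 𝕜} (hf : LocallyIntegrable f volume)
    {G : (Fin n → ℕ) → EuclideanSpace ℝ (Fin n) → 𝕜}
    (hG : ∀ α ∈ multiIndices n (m + 1), IsWeakPartial α f (G α))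
    (v : EuclideanSpace ℝ (Fin n)) :
    ∀ᵐ y, orderDiff (m + 1) v f y = ∑ I : Fin (m + 1) → Fin n, (∏ j, v (I j)) •
      ∫ t in Ioc (0 : ℝ) (m + 1 : ℕ), M t • G (directionCount I) (y + t • v) := by
  set a : ℝ := ((m + 1 : ℕ) : ℝ) with ha
  have ha0 : 0 ≤ a := Nat.cast_nonneg _
  have hMB' : ∀ t ∈ Ioc 0 a, |M t| ≤ 2 ^ (m + 1) * a ^ m := fun t ht =>
    (hMB t ht.1.le).trans (by have := ht.2; have := ht.1.le; gcongr)
  have htr : ∀ c : EuclideanSpace ℝ (Fin n), LocallyIntegrable (fun y => f (y + c)) volume := by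
    intro c
    rw [locallyIntegrable_iff]
    intro K hK
    have h1 : IntegrableOn f ((fun y => y + c) '' K) volume :=
      hf.integrableOn_isCompact (hK.image (by fun_prop))
    have h2 := (measurePreserving_add_right volume c).integrableOn_comp_preimage
      (MeasurableEquiv.addRight c).measurableEmbedding (f := f) (s := (fun y => y + c) '' K)
    rw [preimage_image_eq _ (add_left_injective c)] at h2
    exact h2.2 h1
  have hGl : ∀ I : Fin (m + 1) → Fin n, LocallyIntegrable (G (directionCount I)) volume :=
    fun I => (hG _ (directionCount_mem I)).1
  refine ae_eq_of_integral_contDiff_smul_eq ?_ ?_ ?_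
  · have : orderDiff (m + 1) v f = fun y => ∑ j ∈ Finset.range (m + 1 + 1),
      ((-1 : ℝ) ^ (m + 1 - j) * ((m + 1).choose j : ℝ)) • f (y + (j : ℝ) • v) :=
      funext fun y => orderDiff_eq_sum_smul _ _ _ _
    rw [this]
    exact locallyIntegrable_finsetSum _ fun j _ =>
      (htr _).smul ((-1 : ℝ) ^ (m + 1 - j) * ((m + 1).choose j : ℝ))
  · exact locallyIntegrable_finsetSum _ fun I _ =>
      (locallyIntegrable_integral_line (hGl I) hMm hMB' v).smul (∏ j, v (I j))
  · intro φ hφ hφc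
    obtain ⟨R, hR⟩ := hφc.isCompact.isBounded.subset_closedBall 0
    have hφR : ∀ y, R < ‖y‖ → φ y = 0 := fun y hy => by
      refine image_eq_zero_of_notMem_tsupport fun h => ?_
      have := hR h
      rw [mem_closedBall_zero_iff] at this
      linarith
    have hDR : ∀ I : Fin (m + 1) → Fin n, ∀ y, R < ‖y‖ →
        classicalMultiPartial (directionCount I) φ y = 0 := fun I y hy => by
      refine image_eq_zero_of_notMem_tsupport fun h => ?_
      have := hR (tsupport_classicalMultiPartial_subset _ _ h)
      rw [mem_closedBall_zero_iff] at this
      linarith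
    obtain ⟨B₀, hB₀⟩ := hφ.continuous.bounded_above_of_compact_support hφc
    have hDB : ∀ I : Fin (m + 1) → Fin n, ∃ B, ∀ y,
        ‖classicalMultiPartial (directionCount I) φ y‖ ≤ B := fun I =>
      (hφ.classicalMultiPartial _).continuous.bounded_above_of_compact_support
        (hφc.classicalMultiPartial _)
    choose B hB using hDB
    have hsm : ∀ {g : EuclideanSpace ℝ (Fin n) → 𝕜}, LocallyIntegrable g volume →
        ∀ {ψ : EuclideanSpace ℝ (Fin n) → ℝ}, Continuous ψ → HasCompactSupport ψ →
        Integrable (fun y => ψ y • g y) volume := fun hg _ h1 h2 =>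
      hg.integrable_smul_left_of_hasCompactSupport h1 h2
    -- the difference is moved to the test function
    have e1 : ∫ y, φ y • orderDiff (m + 1) v f y =
        ∫ y, (∑ j ∈ Finset.range (m + 1 + 1),
          (-1 : ℝ) ^ (m + 1 - j) * ((m + 1).choose j : ℝ) * φ (y + (j : ℝ) • (-v))) • f y := by
      simp_rw [orderDiff_eq_sum_smul, Finset.smul_sum, Finset.sum_smul]
      rw [integral_finsetSum, integral_finsetSum]
      · refine Finset.sum_congr rfl fun j _ => ?_
        rw [← integral_add_right_eq_self _ ((j : ℝ) • (-v))]
        refine integral_congr_ae (Filter.Eventually.of_forall fun y => ?_)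
        simp only [smul_smul]
        rw [smul_neg, neg_add_cancel_right, mul_comm]
      · intro j _
        simp_rw [mul_smul]
        refine (((hsm hf (ψ := fun y => φ (y + (j : ℝ) • (-v))) (by fun_prop) ?_).smul
          ((m + 1).choose j : ℝ)).smul ((-1 : ℝ) ^ (m + 1 - j)))
        exact hφc.comp_homeomorph (Homeomorph.addRight ((j : ℝ) • (-v)))
      · intro j _
        simp_rw [smul_comm (φ _)]
        exact (hsm (htr _) hφ.continuous hφc).smul
          ((-1 : ℝ) ^ (m + 1 - j) * ((m + 1).choose j : ℝ))
    have e2 : ∀ y, (∑ j ∈ Finset.range (m + 1 + 1),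
          (-1 : ℝ) ^ (m + 1 - j) * ((m + 1).choose j : ℝ) * φ (y + (j : ℝ) • (-v))) • f y =
        ∑ I : Fin (m + 1) → Fin n, (∏ j, (-v) (I j)) • ∫ t in Ioc 0 a,
          (M t * classicalMultiPartial (directionCount I) φ (y - t • v)) • f y := by
      intro y
      rw [hM (fun t => φ (y + t • (-v))) (by fun_prop), iteratedDeriv_comp_line hφ,
        intervalIntegral.integral_of_le (by positivity)]
      simp_rw [Finset.mul_sum]
      rw [integral_finsetSum, Finset.sum_smul]
      · refine Finset.sum_congr rfl fun I _ => ?_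
        rw [integral_smul_const, ← smul_assoc]
        congr 1
        rw [smul_eq_mul, ← integral_const_mul]
        refine integral_congr_ae (Filter.Eventually.of_forall fun t => ?_)
        simp only [smul_neg, sub_eq_add_neg]
        ring
      · intro I _
        have : Measure.restrict volume (Ioc 0 a) univ < ∞ := by simp
        refine Integrable.mono' (g := fun _ => 2 ^ (m + 1) * a ^ m * (|∏ j, (-v) (I j)| * B I))
          (integrable_const _) ?_ ?_
        · have := (hφ.classicalMultiPartial (directionCount I)).continuous.measurable
          exact (by fun_prop : Measurable fun t => M t * ((∏ j, (-v) (I j)) *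
            classicalMultiPartial (directionCount I) φ (y + t • (-v)))).aestronglyMeasurable
        · filter_upwards [ae_restrict_mem measurableSet_Ioc] with t ht
          rw [norm_mul, norm_mul]
          have := hMB' t ht
          have := hB I (y + t • (-v))
          simp only [Real.norm_eq_abs] at this ⊢
          gcongr
    have hI1 := fun I => integrable_prod_translate hf hMm hMB'
      (hφ.classicalMultiPartial (directionCount I)).continuous.measurable (hB I) (hDR I) v
    have hI2 := fun I => integrable_prod_translate' (hGl I) hMm hMB'
      hφ.continuous.measurable hB₀ hφR v
    have e3 : ∀ I : Fin (m + 1) → Fin n, ∀ y,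
        φ y • (∏ j, v (I j)) • ∫ t in Ioc 0 a, M t • G (directionCount I) (y + t • v) =
          (∏ j, v (I j)) • ∫ t in Ioc 0 a, (M t * φ y) • G (directionCount I) (y + t • v) := by
      intro I y
      rw [smul_comm, ← integral_smul]
      simp_rw [smul_smul, mul_comm]
    rw [e1, integral_congr_ae (Filter.Eventually.of_forall e2), integral_finsetSum]
    · simp_rw [Finset.smul_sum, e3]
      rw [integral_finsetSum]
      · refine Finset.sum_congr rfl fun I _ => ?_
        rw [integral_smul, integral_smul, integral_integral_swap (f := fun y t => (M t *
            classicalMultiPartial (directionCount I) φ (y - t • v)) • f y) (hI1 I).swap,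
          integral_integral_swap (f := fun y t => (M t * φ y) • G (directionCount I) (y + t • v))
            (hI2 I).swap, ← integral_smul, ← integral_smul]
        refine integral_congr_ae (Filter.Eventually.of_forall fun t => ?_)
        simp only [mul_smul]
        rw [integral_smul, integral_smul]
        have hφt := (hG _ (directionCount_mem I)).2 (fun y => φ (y + (-(t • v)))) (by fun_prop)
          (hφc.comp_homeomorph (Homeomorph.addRight (-(t • v))))
        rw [classicalMultiPartial_comp_add_right] at hφt
        simp only [← sub_eq_add_neg] at hφt
        rw [hφt, ← integral_add_right_eq_self
          (fun y => φ (y - t • v) • G (directionCount I) y) (t • v)]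
        have hI : ∑ i, directionCount I i = m + 1 :=
          (Finset.mem_piAntidiag.1 (directionCount_mem I)).1
        simp only [add_sub_cancel_right, hI, PiLp.neg_apply, Finset.prod_neg, Finset.card_univ,
          Fintype.card_fin]
        rw [smul_comm (M t), smul_smul, mul_right_comm, ← mul_pow]
        simp
      · intro I _
        exact (hI2 I).integral_prod_right.smul (∏ j, v (I j))
    · intro I _
      exact (hI1 I).integral_prod_right.smul (∏ j, (-v) (I j))

end WeakTaylor

/-! ### The almost everywhere bound of a difference by the gradient -/

section PointwiseBound

variable {n : ℕ} {𝕜 : Type*} [RCLike 𝕜]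

lemma isWeakPartial_weakPartial {α : Fin n → ℕ} {f : EuclideanSpace ℝ (Fin n) → 𝕜}
    (h : ∃ g, IsWeakPartial α f g) : IsWeakPartial α f (weakPartial α f) := by
  unfold weakPartial
  rw [dif_pos h]
  exact h.choose_spec

lemma norm_weakPartial_le (k : ℕ) {α : Fin n → ℕ} (hα : α ∈ multiIndices n k)
    (f : EuclideanSpace ℝ (Fin n) → 𝕜) (x : EuclideanSpace ℝ (Fin n)) :
    ‖weakPartial α f x‖ ≤ weakGradLength k f x := by
  refine Real.le_sqrt_of_sq_le ?_
  exact Finset.single_le_sum (f := fun α => ‖weakPartial α f x‖ ^ 2)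
    (fun _ _ => sq_nonneg _) hα

lemma aemeasurable_weakGradLength {k : ℕ} {f : EuclideanSpace ℝ (Fin n) → 𝕜}
    (hf : ∀ α ∈ multiIndices n k, ∃ g, IsWeakPartial α f g) :
    AEMeasurable (weakGradLength k f) volume := by
  unfold weakGradLength
  refine (Finset.aemeasurable_fun_sum _ fun α hα => ?_).sqrt
  exact (isWeakPartial_weakPartial (hf α hα)).1.aestronglyMeasurable.norm.aemeasurable.pow_const 2

lemma orderDiff_ae_congr {k : ℕ} {f f' : EuclideanSpace ℝ (Fin n) → 𝕜}
    (h : f =ᵐ[volume] f') (v : EuclideanSpace ℝ (Fin n)) :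
    orderDiff k v f =ᵐ[volume] orderDiff k v f' := by
  have h1 : ∀ j : ℕ, ∀ᵐ y, f (y + (j : ℝ) • v) = f' (y + (j : ℝ) • v) := fun j =>
    (measurePreserving_add_right volume ((j : ℝ) • v)).quasiMeasurePreserving.ae h
  filter_upwards [ae_all_iff.2 h1] with y hy
  simp only [orderDiff, hy]

lemma measurable_orderDiff_uncurry {k : ℕ} {f : EuclideanSpace ℝ (Fin n) → 𝕜} (hf : Measurable f) :
    Measurable fun z : EuclideanSpace ℝ (Fin n) × EuclideanSpace ℝ (Fin n) =>
      orderDiff k z.1 f z.2 := by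
  unfold orderDiff
  fun_prop

lemma abs_prod_coord_le {k : ℕ} (v : EuclideanSpace ℝ (Fin n)) (I : Fin k → Fin n) :
    |∏ j, v (I j)| ≤ ‖v‖ ^ k := by
  rw [Finset.abs_prod]
  calc ∏ j, |v (I j)| ≤ ∏ _j : Fin k, ‖v‖ :=
        Finset.prod_le_prod (fun _ _ => abs_nonneg _) fun j _ => by
          simpa using PiLp.norm_apply_le v (I j)
    _ = ‖v‖ ^ k := by simp

/-- For almost every point, the `k`-th differences are controlled by the length of the weak
gradient along almost every segment; the weight `t ^ (k - 1)` vanishes at the base point. -/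
lemma exists_pointwise_bound {m : ℕ} {f : EuclideanSpace ℝ (Fin n) → 𝕜}
    (hf : LocallyIntegrable f volume)
    (hfα : ∀ α ∈ multiIndices n (m + 1), ∃ g, IsWeakPartial α f g) :
    ∃ f' : EuclideanSpace ℝ (Fin n) → 𝕜, Measurable f' ∧ f =ᵐ[volume] f' ∧
    ∃ g : EuclideanSpace ℝ (Fin n) → ℝ≥0∞, Measurable g ∧
      (fun x => ‖weakGradLength (m + 1) f x‖ₑ) =ᵐ[volume] g ∧
      ∀ᵐ y, ∀ᵐ v, ‖orderDiff (m + 1) v f' y‖ₑ ≤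
        ((n : ℝ≥0∞) ^ (m + 1) * 2 ^ (m + 1)) * (‖v‖ₑ ^ (m + 1) *
          ∫⁻ t in Ioc (0 : ℝ) (m + 1 : ℕ), ENNReal.ofReal (t ^ m) * g (y + t • v)) := by
  obtain ⟨M, hMm, hMB, hM⟩ := exists_diffKernel m
  have hwm : AEMeasurable (fun x => ‖weakGradLength (m + 1) f x‖ₑ) volume :=
    (aemeasurable_weakGradLength hfα).enorm
  have hfm := hf.aestronglyMeasurable
  refine ⟨hfm.mk f, hfm.stronglyMeasurable_mk.measurable, hfm.ae_eq_mk, hwm.mk _,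
    hwm.measurable_mk, hwm.ae_eq_mk, ?_⟩
  set f' := hfm.mk f
  set g := hwm.mk _ with hg
  have hf'm : Measurable f' := hfm.stronglyMeasurable_mk.measurable
  have hgm : Measurable g := hwm.measurable_mk
  refine (Measure.ae_ae_comm (μ := volume) (ν := volume) ?_).1 ?_
  · refine measurableSet_le ?_ ?_
    · exact (measurable_orderDiff_uncurry hf'm).enorm
    · refine Measurable.const_mul (Measurable.mul (by fun_prop) ?_) _
      refine Measurable.lintegral_prod_right' (f := fun z : (EuclideanSpace ℝ (Fin n) ×
        EuclideanSpace ℝ (Fin n)) × ℝ => ENNReal.ofReal (z.2 ^ m) * g (z.1.2 + z.2 • z.1.1)) ?_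
      fun_prop
  · refine Filter.Eventually.of_forall fun v => ?_
    have hsh : ∀ᵐ y : EuclideanSpace ℝ (Fin n), ∀ᵐ t ∂(volume.restrict (Ioc (0 : ℝ) (m + 1 : ℕ))),
        ‖weakGradLength (m + 1) f (y + t • v)‖ₑ = g (y + t • v) := by
      have h1 : ∀ᵐ z : ℝ × EuclideanSpace ℝ (Fin n)
          ∂((volume.restrict (Ioc (0 : ℝ) (m + 1 : ℕ))).prod volume),
          ‖weakGradLength (m + 1) f (z.2 + z.1 • v)‖ₑ = g (z.2 + z.1 • v) :=
        (Measure.quasiMeasurePreserving_snd.comp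
          (measurePreserving_shear _ v).quasiMeasurePreserving).ae hwm.ae_eq_mk
      have h2 := (Measure.measurePreserving_swap
        (μ := (volume : Measure (EuclideanSpace ℝ (Fin n))))
        (ν := volume.restrict (Ioc (0 : ℝ) (m + 1 : ℕ)))).quasiMeasurePreserving.ae h1
      exact Measure.ae_ae_of_ae_prod h2
    filter_upwards [ae_orderDiff_eq_integral hMm hMB hM hf
      (fun α hα => isWeakPartial_weakPartial (hfα α hα)) v, orderDiff_ae_congr hfm.ae_eq_mk v,
      hsh] with y h1 h2 h3
    rw [← h2, h1]
    have hone : ∀ I : Fin (m + 1) → Fin n, ‖(∏ j, v (I j)) • ∫ t in Ioc (0 : ℝ) (m + 1 : ℕ),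
        M t • weakPartial (directionCount I) f (y + t • v)‖ₑ ≤ 2 ^ (m + 1) * (‖v‖ₑ ^ (m + 1) *
          ∫⁻ t in Ioc (0 : ℝ) (m + 1 : ℕ), ENNReal.ofReal (t ^ m) * g (y + t • v)) := by
      intro I
      rw [enorm_smul]
      have hv : ‖∏ j, v (I j)‖ₑ ≤ ‖v‖ₑ ^ (m + 1) := by
        have := abs_prod_coord_le v I
        rw [← enorm_norm v, ← enorm_pow, enorm_le_iff_norm_le, Real.norm_eq_abs]
        simpa only [norm_pow, norm_norm] using this
      have hi : ‖∫ t in Ioc (0 : ℝ) (m + 1 : ℕ),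
          M t • weakPartial (directionCount I) f (y + t • v)‖ₑ ≤
          2 ^ (m + 1) * ∫⁻ t in Ioc (0 : ℝ) (m + 1 : ℕ), ENNReal.ofReal (t ^ m) * g (y + t • v) :=
              by
        refine (enorm_integral_le_lintegral_enorm _).trans ?_
        rw [← lintegral_const_mul' _ _ (by finiteness)]
        refine lintegral_mono_ae ?_
        filter_upwards [h3, ae_restrict_mem measurableSet_Ioc] with t ht htI
        rw [enorm_smul, ← ht, ← mul_assoc]
        gcongr
        · rw [← ofReal_norm]
          calc ENNReal.ofReal ‖M t‖ ≤ ENNReal.ofReal (2 ^ (m + 1) * t ^ m) :=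
                ENNReal.ofReal_le_ofReal (hMB t htI.1.le)
            _ = 2 ^ (m + 1) * ENNReal.ofReal (t ^ m) := by
                rw [ENNReal.ofReal_mul (by positivity), ENNReal.ofReal_pow (by norm_num)]
                norm_num
        · rw [enorm_le_iff_norm_le]
          exact (norm_weakPartial_le _ (directionCount_mem I) f _).trans (le_abs_self _)
      calc _ ≤ ‖v‖ₑ ^ (m + 1) * (2 ^ (m + 1) * ∫⁻ t in Ioc (0 : ℝ) (m + 1 : ℕ),
            ENNReal.ofReal (t ^ m) * g (y + t • v)) := by gcongr
        _ = _ := by ring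
    refine (enorm_sum_le _ _).trans ((Finset.sum_le_sum fun I _ => hone I).trans_eq ?_)
    simp [mul_assoc]

lemma quasiMeasurePreserving_smul {R : ℝ} (hR : R ≠ 0) :
    Measure.QuasiMeasurePreserving (fun v : EuclideanSpace ℝ (Fin n) => R • v) volume volume :=
  ⟨by fun_prop, by rw [Measure.map_addHaar_smul _ hR]; exact Measure.smul_absolutelyContinuous⟩

/-- The integral of `g` over the ball `B(x, τ)`, rescaled to the unit ball. It is the mean of `g` up
to the factor `|B(0, 1)|`, which is not divided out. -/
noncomputable def unitBallMean (g : EuclideanSpace ℝ (Fin n) → ℝ≥0∞)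
    (x : EuclideanSpace ℝ (Fin n)) (τ : ℝ) : ℝ≥0∞ :=
  ∫⁻ v in Metric.ball (0 : EuclideanSpace ℝ (Fin n)) 1, g (x + τ • v)

/-- Integrating the pointwise bound over the steps `|v| < R` turns averages along segments into
averages over balls; the power `|v| ^ k` is estimated by `R ^ k`. -/
lemma lintegral_orderDiff_le {m : ℕ} {f : EuclideanSpace ℝ (Fin n) → 𝕜}
    {g : EuclideanSpace ℝ (Fin n) → ℝ≥0∞} (hg : Measurable g) {C : ℝ≥0∞}
    (hC : C ≠ ∞) {y : EuclideanSpace ℝ (Fin n)}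
    (h : ∀ᵐ v, ‖orderDiff (m + 1) v f y‖ₑ ≤ C * (‖v‖ₑ ^ (m + 1) *
          ∫⁻ t in Ioc (0 : ℝ) (m + 1 : ℕ), ENNReal.ofReal (t ^ m) * g (y + t • v)))
    {R : ℝ} (hR : 0 < R) :
    unitBallMean (fun v => ‖orderDiff (m + 1) v f y‖ₑ) 0 R ≤
      C * ENNReal.ofReal (R ^ (m + 1)) *
        ∫⁻ t in Ioc (0 : ℝ) (m + 1 : ℕ), ENNReal.ofReal (t ^ m) * unitBallMean g y (t * R) := by
  have h' := (quasiMeasurePreserving_smul hR.ne').ae h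
  unfold unitBallMean
  calc _ ≤ ∫⁻ v in Metric.ball (0 : EuclideanSpace ℝ (Fin n)) 1,
        C * ENNReal.ofReal (R ^ (m + 1)) * ∫⁻ t in Ioc (0 : ℝ) (m + 1 : ℕ),
          ENNReal.ofReal (t ^ m) * g (y + (t * R) • v) := by
        refine lintegral_mono_ae ?_
        filter_upwards [ae_restrict_of_ae h', ae_restrict_mem measurableSet_ball] with v hv hv1
        rw [zero_add]
        refine hv.trans ?_
        rw [mul_assoc]
        simp_rw [← smul_smul]
        gcongr
        rw [← enorm_norm, ← enorm_pow, ← ofReal_norm]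
        refine ENNReal.ofReal_le_ofReal ?_
        rw [mem_ball_zero_iff] at hv1
        rw [Real.norm_of_nonneg (by positivity), norm_smul, Real.norm_of_nonneg hR.le]
        gcongr
        nlinarith
    _ = _ := by
        rw [lintegral_const_mul' _ _ (by finiteness), lintegral_lintegral_swap (by fun_prop)]
        congr 1
        refine lintegral_congr fun t => ?_
        rw [lintegral_const_mul _ (by fun_prop)]

end PointwiseBound

/-! ### Inequalities of Jensen and Hölder -/

section Jensen

variable {α : Type*} [MeasurableSpace α] {μ : Measure α}

/-- Jensen's inequality for powers. -/
lemma lintegral_rpow_le_mul_lintegral_rpow {F : α → ℝ≥0∞} (hF : AEMeasurable F μ) {q : ℝ}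
    (hq : 1 ≤ q) : (∫⁻ x, F x ∂μ) ^ q ≤ μ univ ^ (q - 1) * ∫⁻ x, F x ^ q ∂μ := by
  rcases hq.eq_or_lt with rfl | hq1
  · simp
  have hc := (Real.HolderConjugate.conjExponent hq1)
  have h := ENNReal.lintegral_mul_le_Lp_mul_Lq μ hc hF (aemeasurable_const (b := (1 : ℝ≥0∞)))
  simp only [Pi.mul_apply, mul_one, ENNReal.one_rpow, lintegral_const, one_mul] at h
  calc (∫⁻ x, F x ∂μ) ^ q ≤ ((∫⁻ x, F x ^ q ∂μ) ^ (1 / q) * μ univ ^ (1 / q.conjExponent)) ^ q := by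
        gcongr
    _ = _ := by
        have h0 : 0 ≤ q := by linarith
        rw [ENNReal.mul_rpow_of_nonneg _ _ h0, ← ENNReal.rpow_mul, ← ENNReal.rpow_mul, mul_comm]
        have h1 : q ≠ 0 := by linarith
        have h2 : q - 1 ≠ 0 := by linarith
        congr 2
        · simp only [Real.conjExponent]; field_simp
        · field_simp; simp

/-- Jensen's inequality for powers, for the measure with density `w`. -/
lemma lintegral_mul_rpow_le_mul_lintegral {w F : α → ℝ≥0∞} (hw : Measurable w)
    (hF : Measurable F) {q : ℝ} (hq : 1 ≤ q) :
    (∫⁻ x, w x * F x ∂μ) ^ q ≤ (∫⁻ x, w x ∂μ) ^ (q - 1) * ∫⁻ x, w x * F x ^ q ∂μ := by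
  have h := lintegral_rpow_le_mul_lintegral_rpow (μ := μ.withDensity w) hF.aemeasurable hq
  rw [lintegral_withDensity_eq_lintegral_mul _ hw hF,
    lintegral_withDensity_eq_lintegral_mul _ hw (hF.pow_const q),
    withDensity_apply _ MeasurableSet.univ, Measure.restrict_univ] at h
  exact h

end Jensen

/-! ### Means over balls -/

section Averages

variable {n : ℕ}

lemma lintegral_comp_add_smul (F : EuclideanSpace ℝ (Fin n) → ℝ≥0∞)
    (x : EuclideanSpace ℝ (Fin n)) {τ : ℝ} (hτ : 0 < τ) :
    ENNReal.ofReal (τ ^ n) * ∫⁻ v, F (x + τ • v) = ∫⁻ z, F z := by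
  let e : EuclideanSpace ℝ (Fin n) ≃ᵐ EuclideanSpace ℝ (Fin n) :=
    (Homeomorph.smulOfNeZero τ hτ.ne').toMeasurableEquiv
  have h1 : Measure.map e volume = ENNReal.ofReal ((τ ^ n)⁻¹) • volume := by
    have := Measure.map_addHaar_smul (volume : Measure (EuclideanSpace ℝ (Fin n))) hτ.ne'
    rw [finrank_euclideanSpace_fin, abs_of_pos (by positivity)] at this
    exact this
  have h2 : ∫⁻ v, F (x + τ • v) = ENNReal.ofReal ((τ ^ n)⁻¹) * ∫⁻ z, F (x + z) := by
    have := lintegral_map_equiv (μ := volume) (fun z => F (x + z)) e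
    rw [h1, lintegral_smul_measure] at this
    exact this.symm
  rw [h2, lintegral_add_left_eq_self F x, ← mul_assoc, ← ENNReal.ofReal_mul (by positivity),
    mul_inv_cancel₀ (by positivity), ENNReal.ofReal_one, one_mul]

lemma setLIntegral_ball_eq_unitBallMean (F : EuclideanSpace ℝ (Fin n) → ℝ≥0∞)
    (x : EuclideanSpace ℝ (Fin n)) {τ : ℝ} (hτ : 0 < τ) :
    ENNReal.ofReal (τ ^ n) * unitBallMean F x τ = ∫⁻ z in Metric.ball x τ, F z := by
  unfold unitBallMean
  rw [← lintegral_indicator measurableSet_ball, ← lintegral_indicator measurableSet_ball,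
    ← lintegral_comp_add_smul ((Metric.ball x τ).indicator F) x hτ]
  congr 1
  refine lintegral_congr fun v => ?_
  have : x + τ • v ∈ Metric.ball x τ ↔ v ∈ Metric.ball (0 : EuclideanSpace ℝ (Fin n)) 1 := by
    rw [mem_ball_iff_norm, add_sub_cancel_left, norm_smul, Real.norm_of_nonneg hτ.le,
      mem_ball_zero_iff]
    constructor
    · intro h; nlinarith
    · intro h; nlinarith
  by_cases hv : v ∈ Metric.ball (0 : EuclideanSpace ℝ (Fin n)) 1
  · rw [indicator_of_mem hv, indicator_of_mem (this.2 hv)]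
  · rw [indicator_of_notMem hv, indicator_of_notMem (fun h => hv (this.1 h))]

lemma unitBallMean_eq (F : EuclideanSpace ℝ (Fin n) → ℝ≥0∞)
    (x : EuclideanSpace ℝ (Fin n)) {τ : ℝ} (hτ : 0 < τ) :
    unitBallMean F x τ = ENNReal.ofReal ((τ ^ n)⁻¹) * ∫⁻ z in Metric.ball x τ, F z := by
  rw [← setLIntegral_ball_eq_unitBallMean F x hτ, ← mul_assoc,
    ← ENNReal.ofReal_mul (by positivity), inv_mul_cancel₀ (by positivity), ENNReal.ofReal_one,
    one_mul]

lemma Measurable.unitBallMean {F : EuclideanSpace ℝ (Fin n) → ℝ≥0∞} (hF : Measurable F) :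
    Measurable fun z : EuclideanSpace ℝ (Fin n) × ℝ => unitBallMean F z.1 z.2 := by
  unfold _root_.unitBallMean
  refine Measurable.lintegral_prod_right' (f := fun z : (EuclideanSpace ℝ (Fin n) × ℝ) ×
    EuclideanSpace ℝ (Fin n) => F (z.1.1 + z.1.2 • z.2)) ?_
  fun_prop

lemma unitBallMean_rpow_le {F : EuclideanSpace ℝ (Fin n) → ℝ≥0∞} (hF : Measurable F)
    (x : EuclideanSpace ℝ (Fin n)) (τ : ℝ) {u : ℝ} (hu : 1 ≤ u) :
    unitBallMean F x τ ^ u ≤ volume (Metric.ball (0 : EuclideanSpace ℝ (Fin n)) 1) ^ (u - 1) *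
      unitBallMean (fun z => F z ^ u) x τ := by
  have := lintegral_rpow_le_mul_lintegral_rpow
    (μ := volume.restrict (Metric.ball (0 : EuclideanSpace ℝ (Fin n)) 1))
    (F := fun v => F (x + τ • v)) (by fun_prop) hu
  rwa [Measure.restrict_apply_univ] at this

end Averages

/-! ### A local Sobolev inequality for radial averages -/

section LocalSobolev

variable {n : ℕ}

lemma lintegral_Ioc_rpow_lt_top {δ : ℝ} (hδ : 0 < δ) (a : ℝ) :
    ∫⁻ t in Ioc 0 a, ENNReal.ofReal (t ^ (δ - 1)) < ∞ := by
  have h := (intervalIntegral.intervalIntegrable_rpow' (a := 0) (b := a)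
    (r := δ - 1) (by linarith)).1
  exact h.lintegral_lt_top

/-- Averages over balls gain integrability: the exponent rises from `u` to `q`, at the price of a
negative power of the radius. -/
lemma lintegral_unitBallMean_rpow_le {G : EuclideanSpace ℝ (Fin n) → ℝ≥0∞} (hG : Measurable G)
    {u q a : ℝ} (hu : 1 ≤ u) (huq : u ≤ q) {t : ℝ} (ht : t ∈ Ioc 0 a) :
    ∫⁻ h in Metric.ball (0 : EuclideanSpace ℝ (Fin n)) 1, unitBallMean G h t ^ q ≤
      (volume (Metric.ball (0 : EuclideanSpace ℝ (Fin n)) 1) ^ ((u - 1) * (q / u)) *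
        volume (Metric.ball (0 : EuclideanSpace ℝ (Fin n)) 1)) *
      ENNReal.ofReal (t ^ (-(n : ℝ) * (q / u - 1))) *
        (∫⁻ z in Metric.ball (0 : EuclideanSpace ℝ (Fin n)) (a + 1), G z ^ u) ^ (q / u) := by
  set κ := volume (Metric.ball (0 : EuclideanSpace ℝ (Fin n)) 1)
  set X := ∫⁻ z in Metric.ball (0 : EuclideanSpace ℝ (Fin n)) (a + 1), G z ^ u
  have hu0 : 0 < u := by linarith
  have hq0 : 0 < q := by linarith
  have hqu : 0 ≤ q / u - 1 := by rw [sub_nonneg, le_div_iff₀ hu0]; linarith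
  have hmeas : Measurable fun h => unitBallMean (fun z => G z ^ u) h t :=
    (hG.pow_const u).unitBallMean.comp (measurable_id.prodMk measurable_const)
  have hsub : ∀ h ∈ Metric.ball (0 : EuclideanSpace ℝ (Fin n)) 1,
      Metric.ball h t ⊆ Metric.ball 0 (a + 1) := by
    intro h hh
    refine Metric.ball_subset_ball' ?_
    have := ht.2
    rw [Metric.mem_ball] at hh
    linarith
  have ha : ∀ h ∈ Metric.ball (0 : EuclideanSpace ℝ (Fin n)) 1,
      unitBallMean (fun z => G z ^ u) h t ≤ ENNReal.ofReal ((t ^ n)⁻¹) * X := by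
    intro h hh
    rw [unitBallMean_eq _ _ ht.1]
    gcongr
    exact lintegral_mono_set (hsub h hh)
  have hint : ∫⁻ h in Metric.ball (0 : EuclideanSpace ℝ (Fin n)) 1,
      unitBallMean (fun z => G z ^ u) h t ≤ κ * X := by
    unfold unitBallMean
    rw [lintegral_lintegral_swap (by fun_prop)]
    calc _ ≤ ∫⁻ v in Metric.ball (0 : EuclideanSpace ℝ (Fin n)) 1, X := by
          refine setLIntegral_mono measurable_const fun v hv => ?_
          rw [← lintegral_indicator measurableSet_ball]
          have e : X = ∫⁻ z, (Metric.ball (0 : EuclideanSpace ℝ (Fin n)) (a + 1)).indicator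
              (fun z => G z ^ u) (z + t • v) := by
            rw [lintegral_add_right_eq_self, lintegral_indicator measurableSet_ball]
          rw [e]
          refine lintegral_mono fun h => ?_
          by_cases hh : h ∈ Metric.ball (0 : EuclideanSpace ℝ (Fin n)) 1
          · rw [indicator_of_mem hh, indicator_of_mem]
            rw [mem_ball_zero_iff] at hh hv ⊢
            have h1 := norm_add_le h (t • v)
            rw [norm_smul, Real.norm_of_nonneg ht.1.le] at h1
            have : t * ‖v‖ ≤ t * 1 := by have := ht.1; gcongr
            linarith [ht.2]
          · rw [indicator_of_notMem hh]; exact zero_le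
      _ = κ * X := by rw [setLIntegral_const, mul_comm]
  calc _ ≤ ∫⁻ h in Metric.ball (0 : EuclideanSpace ℝ (Fin n)) 1,
        (κ ^ ((u - 1) * (q / u)) * (ENNReal.ofReal ((t ^ n)⁻¹) * X) ^ (q / u - 1)) *
          unitBallMean (fun z => G z ^ u) h t := by
        refine setLIntegral_mono ?_ fun h hh => ?_
        · exact hmeas.const_mul _
        · calc unitBallMean G h t ^ q = (unitBallMean G h t ^ u) ^ (q / u) := by
                rw [← ENNReal.rpow_mul, mul_div_cancel₀ _ hu0.ne']
            _ ≤ (κ ^ (u - 1) * unitBallMean (fun z => G z ^ u) h t) ^ (q / u) := by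
                gcongr
                exact unitBallMean_rpow_le hG h t hu
            _ = κ ^ ((u - 1) * (q / u)) * (unitBallMean (fun z => G z ^ u) h t ^ (q / u - 1) *
                  unitBallMean (fun z => G z ^ u) h t) := by
                rw [ENNReal.mul_rpow_of_nonneg _ _ (by positivity), ← ENNReal.rpow_mul]
                congr 1
                conv_lhs => rw [← sub_add_cancel (q / u) 1,
                  ENNReal.rpow_add_of_nonneg _ _ hqu zero_le_one, ENNReal.rpow_one]
            _ ≤ _ := by
                rw [← mul_assoc]
                gcongr
                exact ha h hh
    _ = (κ ^ ((u - 1) * (q / u)) * (ENNReal.ofReal ((t ^ n)⁻¹) * X) ^ (q / u - 1)) *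
          ∫⁻ h in Metric.ball (0 : EuclideanSpace ℝ (Fin n)) 1,
            unitBallMean (fun z => G z ^ u) h t := by
        rw [lintegral_const_mul _ hmeas]
    _ ≤ (κ ^ ((u - 1) * (q / u)) * (ENNReal.ofReal ((t ^ n)⁻¹) * X) ^ (q / u - 1)) * (κ * X) := by
        gcongr
    _ = _ := by
        rw [ENNReal.mul_rpow_of_nonneg _ _ hqu, ENNReal.ofReal_rpow_of_pos
          (by have := ht.1; positivity)]
        have e : ((t ^ n)⁻¹ : ℝ) ^ (q / u - 1) = t ^ (-(n : ℝ) * (q / u - 1)) := by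
          rw [← Real.rpow_natCast, ← Real.rpow_neg ht.1.le, ← Real.rpow_mul ht.1.le]
        have e2 : X ^ (q / u) = X ^ (q / u - 1) * X := by
          conv_lhs => rw [← sub_add_cancel (q / u) 1,
                  ENNReal.rpow_add_of_nonneg _ _ hqu zero_le_one, ENNReal.rpow_one]
        rw [e, e2]
        ring

/-- A Sobolev inequality on the unit ball for the averaging operator that controls the
differences. -/
lemma exists_lintegral_average_rpow_le_of_le (n m : ℕ) {u q : ℝ} (hu : 1 ≤ u) (huq : u ≤ q)
    (hlt : (n : ℝ) * (1 / u - 1 / q) < (m + 1 : ℕ)) :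
    ∃ C : ℝ≥0∞, C ≠ ∞ ∧ ∀ G : EuclideanSpace ℝ (Fin n) → ℝ≥0∞, Measurable G →
      ∫⁻ h in Metric.ball (0 : EuclideanSpace ℝ (Fin n)) 1,
        (∫⁻ t in Ioc (0 : ℝ) (m + 1 : ℕ), ENNReal.ofReal (t ^ m) * unitBallMean G h t) ^ q ≤
      C * (∫⁻ z in Metric.ball (0 : EuclideanSpace ℝ (Fin n)) ((m + 1 : ℕ) + 1), G z ^ u) ^
        (q / u) := by
  set a : ℝ := ((m + 1 : ℕ) : ℝ) with ha
  -- Jensen's inequality with respect to `t ^ (δ - 1) dt`, which has finite mass since `δ > 0`; the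
  -- rest of the weight `t ^ m` cancels the negative power of `t` lost by the means over balls
  set δ : ℝ := a - n * (1 / u - 1 / q) with hδ
  have hδ0 : 0 < δ := by rw [hδ]; linarith
  have hu0 : 0 < u := by linarith
  have hq0 : 0 < q := by linarith
  have hq1 : 1 ≤ q := by linarith
  set κ := volume (Metric.ball (0 : EuclideanSpace ℝ (Fin n)) 1) with hκ
  have hκt : κ ≠ ∞ := measure_ball_lt_top.ne
  set W := ∫⁻ t in Ioc 0 a, ENNReal.ofReal (t ^ (δ - 1)) with hW
  have hWt : W ≠ ∞ := (lintegral_Ioc_rpow_lt_top hδ0 a).ne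
  set K := κ ^ ((u - 1) * (q / u)) * κ with hK
  have hKt : K ≠ ∞ := ENNReal.mul_ne_top
    (ENNReal.rpow_ne_top_of_nonneg (mul_nonneg (by linarith) (by positivity)) hκt) hκt
  refine ⟨W ^ (q - 1) * (K * W), ENNReal.mul_ne_top
    (ENNReal.rpow_ne_top_of_nonneg (by linarith) hWt) (ENNReal.mul_ne_top hKt hWt), ?_⟩
  intro G hG
  set X := ∫⁻ z in Metric.ball (0 : EuclideanSpace ℝ (Fin n)) (a + 1), G z ^ u
  have hGm := hG.unitBallMean
  have hGm1 : ∀ h, Measurable fun t => unitBallMean G h t := fun h =>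
    hGm.comp (measurable_const.prodMk measurable_id)
  calc _ ≤ ∫⁻ h in Metric.ball (0 : EuclideanSpace ℝ (Fin n)) 1, W ^ (q - 1) *
        ∫⁻ t in Ioc 0 a, ENNReal.ofReal (t ^ (δ - 1)) *
          (ENNReal.ofReal (t ^ (a - δ)) * unitBallMean G h t) ^ q := by
        refine lintegral_mono fun h => ?_
        have e : ∫⁻ t in Ioc 0 a, ENNReal.ofReal (t ^ m) * unitBallMean G h t =
            ∫⁻ t in Ioc 0 a, ENNReal.ofReal (t ^ (δ - 1)) *
              (ENNReal.ofReal (t ^ (a - δ)) * unitBallMean G h t) := by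
          refine setLIntegral_congr_fun measurableSet_Ioc fun t ht => ?_
          rw [← mul_assoc, ← ENNReal.ofReal_mul (Real.rpow_nonneg ht.1.le _),
            ← Real.rpow_add ht.1, ← Real.rpow_natCast]
          congr 3
          rw [ha]; push_cast; ring
        rw [e]
        refine lintegral_mul_rpow_le_mul_lintegral (by fun_prop) ?_ hq1
        exact Measurable.mul (by fun_prop) (hGm1 h)
    _ = W ^ (q - 1) * ∫⁻ t in Ioc 0 a, ∫⁻ h in Metric.ball (0 : EuclideanSpace ℝ (Fin n)) 1,
          ENNReal.ofReal (t ^ (δ - 1)) *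
          (ENNReal.ofReal (t ^ (a - δ)) * unitBallMean G h t) ^ q := by
        rw [lintegral_const_mul' _ _ (ENNReal.rpow_ne_top_of_nonneg (by linarith) hWt),
          lintegral_lintegral_swap]
        refine Measurable.aemeasurable ?_
        exact Measurable.mul (by fun_prop) ((Measurable.mul (by fun_prop) hGm).pow_const q)
    _ ≤ W ^ (q - 1) * ∫⁻ t in Ioc 0 a, K * X ^ (q / u) * ENNReal.ofReal (t ^ (δ - 1)) := by
        refine mul_le_mul_right (setLIntegral_mono (by fun_prop) fun t ht => ?_) _
        simp_rw [ENNReal.mul_rpow_of_nonneg _ _ hq0.le, ← mul_assoc]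
        rw [lintegral_const_mul' _ _ (by finiteness)]
        calc _ ≤ ENNReal.ofReal (t ^ (δ - 1)) * ENNReal.ofReal (t ^ (a - δ)) ^ q *
              (K * ENNReal.ofReal (t ^ (-(n : ℝ) * (q / u - 1))) * X ^ (q / u)) := by
              gcongr
              exact lintegral_unitBallMean_rpow_le hG hu huq ht
          _ = ENNReal.ofReal (t ^ (δ - 1)) * (ENNReal.ofReal (t ^ (a - δ)) ^ q *
              ENNReal.ofReal (t ^ (-(n : ℝ) * (q / u - 1)))) * (K * X ^ (q / u)) := by ring
          _ = _ := by
              have ht0 := ht.1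
              rw [ENNReal.ofReal_rpow_of_pos (by positivity), ← Real.rpow_mul ht0.le,
                ← ENNReal.ofReal_mul (by positivity), ← Real.rpow_add ht0]
              have : (a - δ) * q + -(n : ℝ) * (q / u - 1) = 0 := by
                rw [hδ]; field_simp; ring
              rw [this, Real.rpow_zero, ENNReal.ofReal_one, mul_one, mul_comm]
    _ = _ := by
        rw [lintegral_const_mul _ (by fun_prop)]
        ring

/-- The case `q < u` follows from the case `q = u` by Hölder's inequality on the unit ball. -/
lemma exists_lintegral_average_rpow_le (n m : ℕ) {u q : ℝ} (hu : 1 ≤ u) (hq : 1 ≤ q)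
    (hlt : (n : ℝ) * (1 / u - 1 / q) < (m + 1 : ℕ)) :
    ∃ C : ℝ≥0∞, C ≠ ∞ ∧ ∀ G : EuclideanSpace ℝ (Fin n) → ℝ≥0∞, Measurable G →
      ∫⁻ h in Metric.ball (0 : EuclideanSpace ℝ (Fin n)) 1,
        (∫⁻ t in Ioc (0 : ℝ) (m + 1 : ℕ), ENNReal.ofReal (t ^ m) * unitBallMean G h t) ^ q ≤
      C * (∫⁻ z in Metric.ball (0 : EuclideanSpace ℝ (Fin n)) ((m + 1 : ℕ) + 1), G z ^ u) ^
        (q / u) := by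
  rcases le_total u q with h | h
  · exact exists_lintegral_average_rpow_le_of_le n m hu h hlt
  obtain ⟨C, hC, hb⟩ := exists_lintegral_average_rpow_le_of_le n m hu le_rfl
    (by rw [sub_self, mul_zero]; positivity)
  have hu0 : 0 < u := by linarith
  have hq0 : 0 < q := by linarith
  have huq : 1 ≤ u / q := by rw [le_div_iff₀ hq0]; linarith
  set κ := volume (Metric.ball (0 : EuclideanSpace ℝ (Fin n)) 1) with hκ
  have hκt : κ ≠ ∞ := measure_ball_lt_top.ne
  refine ⟨(κ ^ (u / q - 1) * C) ^ (q / u), ENNReal.rpow_ne_top_of_nonneg (by positivity)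
    (ENNReal.mul_ne_top (ENNReal.rpow_ne_top_of_nonneg (by linarith) hκt) hC), ?_⟩
  intro G hG
  have hGm := hG.unitBallMean
  set F : EuclideanSpace ℝ (Fin n) → ℝ≥0∞ := fun h =>
    ∫⁻ t in Ioc (0 : ℝ) (m + 1 : ℕ), ENNReal.ofReal (t ^ m) * unitBallMean G h t with hF
  have hFm : Measurable F := by
    refine Measurable.lintegral_prod_right' (f := fun z : EuclideanSpace ℝ (Fin n) × ℝ =>
      ENNReal.ofReal (z.2 ^ m) * unitBallMean G z.1 z.2) ?_
    exact Measurable.mul (by fun_prop) hGm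
  have h1 := lintegral_rpow_le_mul_lintegral_rpow
    (μ := volume.restrict (Metric.ball (0 : EuclideanSpace ℝ (Fin n)) 1))
    (F := fun h => F h ^ q) (hFm.pow_const q).aemeasurable huq
  have h2 := hb G hG
  rw [div_self hu0.ne', ENNReal.rpow_one] at h2
  simp_rw [← ENNReal.rpow_mul, mul_div_cancel₀ _ hq0.ne'] at h1
  rw [Measure.restrict_apply_univ] at h1
  rw [← ENNReal.mul_rpow_of_nonneg _ _ (by positivity)]
  calc _ = ((∫⁻ h in Metric.ball (0 : EuclideanSpace ℝ (Fin n)) 1,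
        F h ^ q) ^ (u / q)) ^ (q / u) := by
        rw [← ENNReal.rpow_mul]
        have : u / q * (q / u) = 1 := by field_simp
        rw [this, ENNReal.rpow_one]
    _ ≤ _ := by
        gcongr
        refine h1.trans ?_
        rw [mul_assoc]
        gcongr

end LocalSobolev

/-! ### An identity between differences with different steps -/

section DifferenceIdentity

variable {n : ℕ} {𝕜 : Type*} [RCLike 𝕜]

/-- Both sides expand to the same double sum, because the points `x + l h + i l w` and
`x + i h + i l w` are exchanged by `i ↔ l`. -/
lemma sum_orderDiff_swap (k : ℕ) (f : EuclideanSpace ℝ (Fin n) → 𝕜)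
    (x h w : EuclideanSpace ℝ (Fin n)) :
    ∑ l ∈ Finset.range (k + 1), (-1 : 𝕜) ^ (k - l) * (k.choose l : 𝕜) *
        orderDiff k ((l : ℝ) • w) f (x + (l : ℝ) • h) =
      ∑ l ∈ Finset.range (k + 1), (-1 : 𝕜) ^ (k - l) * (k.choose l : 𝕜) *
        orderDiff k (h + (l : ℝ) • w) f x := by
  unfold orderDiff
  simp_rw [Finset.mul_sum]
  rw [Finset.sum_comm]
  refine Finset.sum_congr rfl fun i _ => Finset.sum_congr rfl fun l _ => ?_
  have : x + (l : ℝ) • h + (i : ℝ) • (l : ℝ) • w = x + (l : ℝ) • (h + (i : ℝ) • w) := by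
    module
  rw [this]
  ring

lemma orderDiff_zero_step {k : ℕ} (hk : k ≠ 0) (f : EuclideanSpace ℝ (Fin n) → 𝕜)
    (x : EuclideanSpace ℝ (Fin n)) : orderDiff k 0 f x = 0 := by
  unfold orderDiff
  simp only [smul_zero, add_zero]
  rw [← Finset.sum_mul]
  have := add_pow (1 : 𝕜) (-1) k
  simp only [add_neg_cancel, one_pow, one_mul, zero_pow hk] at this
  rw [← this, zero_mul]

/-- The term `l = 0` of the exchange identity isolates the difference with step `h`. -/
lemma enorm_orderDiff_le {k : ℕ} (hk : k ≠ 0) (f : EuclideanSpace ℝ (Fin n) → 𝕜)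
    (x h w : EuclideanSpace ℝ (Fin n)) :
    ‖orderDiff k h f x‖ₑ ≤ ∑ l ∈ Finset.range k, (2 : ℝ≥0∞) ^ k *
      (‖orderDiff k (((l + 1 : ℕ) : ℝ) • w) f (x + ((l + 1 : ℕ) : ℝ) • h)‖ₑ +
        ‖orderDiff k (h + ((l + 1 : ℕ) : ℝ) • w) f x‖ₑ) := by
  have hs := sum_orderDiff_swap k f x h w
  rw [Finset.sum_range_succ', Finset.sum_range_succ'] at hs
  simp only [Nat.cast_zero, zero_smul, add_zero, orderDiff_zero_step hk, mul_zero,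
    Nat.sub_zero, Nat.choose_zero_right, Nat.cast_one, mul_one] at hs
  have h1 : (-1 : 𝕜) ^ k * orderDiff k h f x = ∑ l ∈ Finset.range k,
      (-1 : 𝕜) ^ (k - (l + 1)) * (k.choose (l + 1) : 𝕜) *
        (orderDiff k (((l + 1 : ℕ) : ℝ) • w) f (x + ((l + 1 : ℕ) : ℝ) • h) -
          orderDiff k (h + ((l + 1 : ℕ) : ℝ) • w) f x) := by
    simp_rw [mul_sub, Finset.sum_sub_distrib]
    rw [hs]; ring
  have h2 : ‖orderDiff k h f x‖ₑ = ‖(-1 : 𝕜) ^ k * orderDiff k h f x‖ₑ := by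
    simp
  rw [h2, h1]
  refine (enorm_sum_le _ _).trans (Finset.sum_le_sum fun l _ => ?_)
  rw [enorm_mul]
  gcongr
  · rw [enorm_mul, enorm_pow]
    simp only [enorm_neg, enorm_one, one_pow, one_mul]
    rw [← ofReal_norm, RCLike.norm_natCast, ENNReal.ofReal_natCast]
    exact_mod_cast Nat.choose_le_two_pow k (l + 1)
  · exact enorm_sub_le

end DifferenceIdentity

/-! ### Differences at one scale -/

section AveragedDifference

variable {n : ℕ} {𝕜 : Type*} [RCLike 𝕜]

lemma lintegral_ball_add_smul_le (F : EuclideanSpace ℝ (Fin n) → ℝ≥0∞)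
    {η : EuclideanSpace ℝ (Fin n)} (hη : η ∈ Metric.ball (0 : EuclideanSpace ℝ (Fin n)) 1)
    {l k ρ : ℝ} (hl : 1 ≤ l) (hlk : l ≤ k) (hρ : 0 < ρ) :
    ∫⁻ w in Metric.ball (0 : EuclideanSpace ℝ (Fin n)) 1, F (ρ • η + l • ρ • w) ≤
      ENNReal.ofReal ((k + 1) ^ n) * unitBallMean F 0 ((k + 1) * ρ) := by
  have e : ∫⁻ w in Metric.ball (0 : EuclideanSpace ℝ (Fin n)) 1, F (ρ • η + l • ρ • w) =
      unitBallMean F (ρ • η) (l * ρ) := by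
    unfold unitBallMean
    simp_rw [smul_smul]
  have hl0 : 0 < l := by linarith
  have hk0 : 0 < k + 1 := by linarith
  rw [e, unitBallMean_eq _ _ (by positivity), unitBallMean_eq _ _ (by positivity), ← mul_assoc,
    ← ENNReal.ofReal_mul (by positivity)]
  refine mul_le_mul' (ENNReal.ofReal_le_ofReal ?_) (lintegral_mono_set ?_)
  · rw [mul_pow (k + 1), mul_inv, ← mul_assoc, mul_inv_cancel₀ (by positivity), one_mul]
    gcongr
    nlinarith
  · refine Metric.ball_subset_ball' ?_
    rw [dist_zero_right, norm_smul, Real.norm_of_nonneg hρ.le]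
    rw [mem_ball_zero_iff] at hη
    nlinarith

/-- The exchange identity, averaged over the auxiliary step `ρ w` with `|w| < 1`. On the right only
`L^1` means of differences are left. -/
lemma measure_mul_enorm_orderDiff_le {k : ℕ} (hk : k ≠ 0) {f : EuclideanSpace ℝ (Fin n) → 𝕜}
    (hf : Measurable f) (x : EuclideanSpace ℝ (Fin n)) {η : EuclideanSpace ℝ (Fin n)}
    (hη : η ∈ Metric.ball (0 : EuclideanSpace ℝ (Fin n)) 1) {ρ : ℝ} (hρ : 0 < ρ) :
    volume (Metric.ball (0 : EuclideanSpace ℝ (Fin n)) 1) * ‖orderDiff k (ρ • η) f x‖ₑ ≤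
      ∑ l ∈ Finset.range k, (2 : ℝ≥0∞) ^ k *
        (unitBallMean (fun v => ‖orderDiff k v f (x + (((l + 1 : ℕ) : ℝ) * ρ) • η)‖ₑ) 0
            (((l + 1 : ℕ) : ℝ) * ρ) +
          ENNReal.ofReal (((k : ℝ) + 1) ^ n) *
            unitBallMean (fun v => ‖orderDiff k v f x‖ₑ) 0 (((k : ℝ) + 1) * ρ)) := by
  have hm := measurable_orderDiff_uncurry (k := k) hf
  have hm1 : ∀ y, Measurable fun v => orderDiff k v f y := fun y =>
    hm.comp (measurable_id.prodMk measurable_const)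
  rw [mul_comm, ← setLIntegral_const]
  calc _ ≤ ∫⁻ w in Metric.ball (0 : EuclideanSpace ℝ (Fin n)) 1, ∑ l ∈ Finset.range k,
      (2 : ℝ≥0∞) ^ k *
      (‖orderDiff k (((l + 1 : ℕ) : ℝ) • ρ • w) f (x + ((l + 1 : ℕ) : ℝ) • ρ • η)‖ₑ +
        ‖orderDiff k (ρ • η + ((l + 1 : ℕ) : ℝ) • ρ • w) f x‖ₑ) :=
        lintegral_mono fun w => enorm_orderDiff_le hk f x (ρ • η) (ρ • w)
    _ = ∑ l ∈ Finset.range k, (2 : ℝ≥0∞) ^ k *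
      ((∫⁻ w in Metric.ball (0 : EuclideanSpace ℝ (Fin n)) 1,
        ‖orderDiff k (((l + 1 : ℕ) : ℝ) • ρ • w) f (x + ((l + 1 : ℕ) : ℝ) • ρ • η)‖ₑ) +
      ∫⁻ w in Metric.ball (0 : EuclideanSpace ℝ (Fin n)) 1,
        ‖orderDiff k (ρ • η + ((l + 1 : ℕ) : ℝ) • ρ • w) f x‖ₑ) := by
        have h1 : ∀ l : ℕ, Measurable fun w : EuclideanSpace ℝ (Fin n) =>
            ‖orderDiff k (((l + 1 : ℕ) : ℝ) • ρ • w) f (x + ((l + 1 : ℕ) : ℝ) • ρ • η)‖ₑ :=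
          fun l => ((hm1 _).comp (by fun_prop)).enorm
        have h2 : ∀ l : ℕ, Measurable fun w : EuclideanSpace ℝ (Fin n) =>
            ‖orderDiff k (ρ • η + ((l + 1 : ℕ) : ℝ) • ρ • w) f x‖ₑ :=
          fun l => ((hm1 _).comp (by fun_prop)).enorm
        rw [lintegral_finsetSum _ fun l _ => ((h1 l).fun_add (h2 l)).const_mul _]
        refine Finset.sum_congr rfl fun l _ => ?_
        rw [lintegral_const_mul _ ((h1 l).fun_add (h2 l)), lintegral_add_left (h1 l)]
    _ ≤ _ := by
        refine Finset.sum_le_sum fun l hl => ?_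
        have hl' : l + 1 ≤ k := Finset.mem_range.1 hl
        gcongr
        · refine le_of_eq ?_
          unfold unitBallMean
          simp only [zero_add, smul_smul]
        · refine lintegral_ball_add_smul_le (fun v => ‖orderDiff k v f x‖ₑ) hη ?_ ?_ hρ
          · exact_mod_cast Nat.le_add_left 1 l
          · exact_mod_cast hl'

/-- The average over `t ∈ (0, m + 1]`, with weight `t ^ m`, of the means of `g` over the balls
`B(x, t R)`. -/
noncomputable def radialMean (m : ℕ) (g : EuclideanSpace ℝ (Fin n) → ℝ≥0∞)
    (x : EuclideanSpace ℝ (Fin n)) (R : ℝ) : ℝ≥0∞ :=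
  ∫⁻ t in Ioc (0 : ℝ) (m + 1 : ℕ), ENNReal.ofReal (t ^ m) * unitBallMean g x (t * R)

lemma measurable_radialMean (m : ℕ) {g : EuclideanSpace ℝ (Fin n) → ℝ≥0∞} (hg : Measurable g)
    (R : ℝ) : Measurable fun x => radialMean m g x R := by
  unfold radialMean
  refine Measurable.lintegral_prod_right' (f := fun z : EuclideanSpace ℝ (Fin n) × ℝ =>
      ENNReal.ofReal (z.2 ^ m) * unitBallMean g z.1 (z.2 * R)) ?_
  refine Measurable.mul (by fun_prop) ?_
  exact hg.unitBallMean.comp (measurable_fst.prodMk (measurable_snd.mul_const R))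

lemma unitBallMean_comp (g : EuclideanSpace ℝ (Fin n) → ℝ≥0∞) (x η : EuclideanSpace ℝ (Fin n))
    (R t : ℝ) :
    unitBallMean g (x + R • η) (t * R) = unitBallMean (fun z => g (x + R • z)) η t := by
  unfold unitBallMean
  refine lintegral_congr fun v => ?_
  congr 1
  module

lemma setLIntegral_ball_comp (g : EuclideanSpace ℝ (Fin n) → ℝ≥0∞)
    (x : EuclideanSpace ℝ (Fin n)) (R : ℝ) {a : ℝ} (ha : 0 < a) :
    ∫⁻ z in Metric.ball (0 : EuclideanSpace ℝ (Fin n)) a, g (x + R • z) =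
      ENNReal.ofReal (a ^ n) * unitBallMean g x (a * R) := by
  rw [← setLIntegral_ball_eq_unitBallMean _ _ ha]
  unfold unitBallMean
  simp only [zero_add, smul_smul, mul_comm R]

/-- The local estimate behind the theorem: the `L^q` mean of the `k`-th differences at scale `ρ`
is controlled by means of the gradient over balls of comparable radii. -/
lemma exists_unitBallMean_orderDiff_rpow_le (n m : ℕ) {u q : ℝ} (hu : 1 ≤ u) (hq : 1 ≤ q)
    (hlt : (n : ℝ) * (1 / u - 1 / q) < (m + 1 : ℕ)) {C₀ : ℝ≥0∞} (hC₀ : C₀ ≠ ∞) :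
    ∃ C : ℝ≥0∞, C ≠ ∞ ∧ ∀ {f : EuclideanSpace ℝ (Fin n) → 𝕜}
      {g : EuclideanSpace ℝ (Fin n) → ℝ≥0∞}, Measurable f → Measurable g →
      (∀ᵐ y, ∀ᵐ v, ‖orderDiff (m + 1) v f y‖ₑ ≤ C₀ * (‖v‖ₑ ^ (m + 1) *
          ∫⁻ t in Ioc (0 : ℝ) (m + 1 : ℕ), ENNReal.ofReal (t ^ m) * g (y + t • v))) →
      ∀ᵐ x, ∀ ρ : ℝ, 0 < ρ →
        unitBallMean (fun v => ‖orderDiff (m + 1) v f x‖ₑ ^ q) 0 ρ ≤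
          C * ENNReal.ofReal (ρ ^ (m + 1)) ^ q *
            (radialMean m g x (((m + 1 : ℕ) + 1) * ρ) ^ q +
              ∑ l ∈ Finset.range (m + 1), unitBallMean (fun z => g z ^ u) x
                ((((m + 1 : ℕ) : ℝ) + 1) * (((l + 1 : ℕ) : ℝ) * ρ)) ^ (q / u)) := by
  obtain ⟨C₁, hC₁, hS⟩ := exists_lintegral_average_rpow_le n m hu hq hlt
  set k : ℕ := m + 1 with hk
  set a : ℝ := (k : ℝ) + 1 with ha
  have ha0 : 0 < a := by positivity
  have hu0 : 0 < u := by linarith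
  have hq0 : 0 < q := by linarith
  set κ := volume (Metric.ball (0 : EuclideanSpace ℝ (Fin n)) 1) with hκ
  have hκt : κ ≠ ∞ := measure_ball_lt_top.ne
  have hκ0 : κ ≠ 0 := (Metric.measure_ball_pos volume _ one_pos).ne'
  set C₂ : ℝ≥0∞ := 2 ^ k * ENNReal.ofReal (a ^ n) * C₀ * ENNReal.ofReal (a ^ k) * (k + 1) with hC₂
  set C₃ : ℝ≥0∞ := C₁ * ENNReal.ofReal (a ^ n) ^ (q / u) with hC₃
  refine ⟨(κ⁻¹ * C₂) ^ q * ((k + 1 : ℕ) : ℝ≥0∞) ^ (q - 1) * (κ + C₃), ?_, ?_⟩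
  · have : κ⁻¹ ≠ ∞ := ENNReal.inv_ne_top.2 hκ0
    have h0 : 0 ≤ q - 1 := by linarith
    have h1 : 0 ≤ q / u := by positivity
    finiteness
  intro f g hf hg hfg
  have hgood : ∀ᵐ y, ∀ R : ℝ, 0 < R →
      unitBallMean (fun v => ‖orderDiff k v f y‖ₑ) 0 R ≤
        C₀ * ENNReal.ofReal (R ^ k) * radialMean m g y R := by
    filter_upwards [hfg] with y hy R hR
    exact lintegral_orderDiff_le hg hC₀ hy hR
  filter_upwards [hgood] with x hx ρ hρ
  -- the pointwise bound, for almost every direction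
  have hpt : ∀ᵐ η ∂(volume.restrict (Metric.ball (0 : EuclideanSpace ℝ (Fin n)) 1)),
      ‖orderDiff k (ρ • η) f x‖ₑ ≤ κ⁻¹ * C₂ * ENNReal.ofReal (ρ ^ k) *
        (radialMean m g x (a * ρ) + ∑ l ∈ Finset.range k,
          radialMean m g (x + (((l + 1 : ℕ) : ℝ) * ρ) • η) (((l + 1 : ℕ) : ℝ) * ρ)) := by
    have hη : ∀ l : ℕ, ∀ᵐ η, ∀ R : ℝ, 0 < R →
      unitBallMean (fun v => ‖orderDiff k v f (x + (((l + 1 : ℕ) : ℝ) * ρ) • η)‖ₑ) 0 R ≤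
        C₀ * ENNReal.ofReal (R ^ k) * radialMean m g (x + (((l + 1 : ℕ) : ℝ) * ρ) • η) R :=
      fun l => ((measurePreserving_add_left volume x).quasiMeasurePreserving.comp
        (quasiMeasurePreserving_smul (by positivity))).ae hgood
    filter_upwards [ae_restrict_of_ae (ae_all_iff.2 hη), ae_restrict_mem measurableSet_ball]
      with η hη' hη1
    have h1 := measure_mul_enorm_orderDiff_le (k := k) (by simp [hk]) hf x hη1 hρ
    have hpow : ∀ b : ℝ, 0 ≤ b → b ≤ a →
        ENNReal.ofReal ((b * ρ) ^ k) ≤ ENNReal.ofReal (a ^ k) * ENNReal.ofReal (ρ ^ k) := by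
      intro b hb hba
      rw [← ENNReal.ofReal_mul (by positivity), ← mul_pow]
      exact ENNReal.ofReal_le_ofReal (by gcongr)
    have hone : (1 : ℝ≥0∞) ≤ ENNReal.ofReal (a ^ n) := by
      rw [ENNReal.one_le_ofReal]
      exact one_le_pow₀ (by rw [ha]; have : (0 : ℝ) ≤ k := k.cast_nonneg; linarith)
    set D := ENNReal.ofReal (a ^ n) * C₀ * ENNReal.ofReal (a ^ k) * ENNReal.ofReal (ρ ^ k) with hD
    have h2 : κ * ‖orderDiff k (ρ • η) f x‖ₑ ≤ C₂ * ENNReal.ofReal (ρ ^ k) *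
        (radialMean m g x (a * ρ) + ∑ l ∈ Finset.range k,
          radialMean m g (x + (((l + 1 : ℕ) : ℝ) * ρ) • η) (((l + 1 : ℕ) : ℝ) * ρ)) := by
      refine h1.trans ?_
      calc _ ≤ ∑ l ∈ Finset.range k, (2 : ℝ≥0∞) ^ k * (D * radialMean m g
            (x + (((l + 1 : ℕ) : ℝ) * ρ) • η) (((l + 1 : ℕ) : ℝ) * ρ) +
              D * radialMean m g x (a * ρ)) := by
            refine Finset.sum_le_sum fun l hl => ?_
            have hl' : l + 1 ≤ k := Finset.mem_range.1 hl
            refine mul_le_mul_right (add_le_add ?_ ?_) _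
            · refine (hη' l _ (by positivity)).trans ?_
              gcongr
              rw [hD]
              calc C₀ * ENNReal.ofReal ((((l + 1 : ℕ) : ℝ) * ρ) ^ k)
                  ≤ C₀ * (ENNReal.ofReal (a ^ k) * ENNReal.ofReal (ρ ^ k)) := by
                    gcongr
                    refine hpow _ (by positivity) ?_
                    rw [ha]
                    have : ((l + 1 : ℕ) : ℝ) ≤ k := by exact_mod_cast hl'
                    linarith
                _ ≤ ENNReal.ofReal (a ^ n) *
                    (C₀ * (ENNReal.ofReal (a ^ k) * ENNReal.ofReal (ρ ^ k))) :=
                    le_mul_of_one_le_left' hone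
                _ = _ := by ring
            · calc _ ≤ ENNReal.ofReal (a ^ n) *
                    (C₀ * ENNReal.ofReal ((a * ρ) ^ k) * radialMean m g x (a * ρ)) := by
                    gcongr
                    exact hx _ (by positivity)
                _ ≤ ENNReal.ofReal (a ^ n) *
                    (C₀ * (ENNReal.ofReal (a ^ k) * ENNReal.ofReal (ρ ^ k)) *
                      radialMean m g x (a * ρ)) := by
                    gcongr
                    exact hpow a ha0.le le_rfl
                _ = _ := by rw [hD]; ring
        _ = 2 ^ k * D * (k * radialMean m g x (a * ρ) + ∑ l ∈ Finset.range k,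
            radialMean m g (x + (((l + 1 : ℕ) : ℝ) * ρ) • η) (((l + 1 : ℕ) : ℝ) * ρ)) := by
            rw [← Finset.mul_sum, Finset.sum_add_distrib, ← Finset.mul_sum, Finset.sum_const,
              Finset.card_range, nsmul_eq_mul]
            ring
        _ ≤ 2 ^ k * D * ((k + 1) * radialMean m g x (a * ρ) + (k + 1) * ∑ l ∈ Finset.range k,
            radialMean m g (x + (((l + 1 : ℕ) : ℝ) * ρ) • η) (((l + 1 : ℕ) : ℝ) * ρ)) := by
            gcongr
            · exact le_self_add
            · exact le_mul_of_one_le_left' le_add_self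
        _ = _ := by rw [hD, hC₂]; ring
    calc ‖orderDiff k (ρ • η) f x‖ₑ = κ⁻¹ * (κ * ‖orderDiff k (ρ • η) f x‖ₑ) := by
          rw [← mul_assoc, ENNReal.inv_mul_cancel hκ0 hκt, one_mul]
      _ ≤ _ := by
          rw [mul_assoc κ⁻¹, mul_assoc κ⁻¹]
          gcongr
  -- the powers of the sum are integrated term by term
  have hTm : ∀ l : ℕ, Measurable fun η : EuclideanSpace ℝ (Fin n) =>
      radialMean m g (x + (((l + 1 : ℕ) : ℝ) * ρ) • η) (((l + 1 : ℕ) : ℝ) * ρ) := fun l =>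
    (measurable_radialMean m hg _).comp (by fun_prop)
  have hterm : ∀ l ∈ Finset.range k, ∫⁻ η in Metric.ball (0 : EuclideanSpace ℝ (Fin n)) 1,
      radialMean m g (x + (((l + 1 : ℕ) : ℝ) * ρ) • η) (((l + 1 : ℕ) : ℝ) * ρ) ^ q ≤
      C₃ * unitBallMean (fun z => g z ^ u) x (a * (((l + 1 : ℕ) : ℝ) * ρ)) ^ (q / u) := by
    intro l _
    set R := ((l + 1 : ℕ) : ℝ) * ρ
    have h1 := hS (fun z => g (x + R • z)) (by fun_prop)
    unfold radialMean
    simp_rw [unitBallMean_comp]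
    refine h1.trans_eq ?_
    rw [setLIntegral_ball_comp (fun z => g z ^ u) x R ha0,
      ENNReal.mul_rpow_of_nonneg _ _ (by positivity), hC₃, mul_assoc]
  have hpow_sum : ∀ (A : ℝ≥0∞) (B : ℕ → ℝ≥0∞), (A + ∑ l ∈ Finset.range k, B l) ^ q ≤
      ((k + 1 : ℕ) : ℝ≥0∞) ^ (q - 1) * (A ^ q + ∑ l ∈ Finset.range k, B l ^ q) := by
    intro A B
    have := ENNReal.rpow_sum_le_const_mul_sum_rpow (Finset.range (k + 1))
      (fun i => Nat.casesOn i A B) hq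
    rw [Finset.sum_range_succ' _ k, Finset.sum_range_succ' _ k, Finset.card_range] at this
    rw [add_comm A, add_comm (A ^ q)]
    exact this
  calc unitBallMean (fun v => ‖orderDiff k v f x‖ₑ ^ q) 0 ρ
      = ∫⁻ η in Metric.ball (0 : EuclideanSpace ℝ (Fin n)) 1, ‖orderDiff k (ρ • η) f x‖ₑ ^ q := by
        unfold unitBallMean; simp only [zero_add]
    _ ≤ ∫⁻ η in Metric.ball (0 : EuclideanSpace ℝ (Fin n)) 1,
        (κ⁻¹ * C₂ * ENNReal.ofReal (ρ ^ k)) ^ q * (((k + 1 : ℕ) : ℝ≥0∞) ^ (q - 1) *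
        (radialMean m g x (a * ρ) ^ q + ∑ l ∈ Finset.range k,
          radialMean m g (x + (((l + 1 : ℕ) : ℝ) * ρ) • η) (((l + 1 : ℕ) : ℝ) * ρ) ^ q)) := by
        refine lintegral_mono_ae ?_
        filter_upwards [hpt] with η hη
        refine (ENNReal.rpow_le_rpow hη hq0.le).trans ?_
        rw [ENNReal.mul_rpow_of_nonneg _ _ hq0.le]
        gcongr
        exact hpow_sum _ _
    _ = (κ⁻¹ * C₂ * ENNReal.ofReal (ρ ^ k)) ^ q * (((k + 1 : ℕ) : ℝ≥0∞) ^ (q - 1) *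
        (radialMean m g x (a * ρ) ^ q * κ + ∑ l ∈ Finset.range k,
          ∫⁻ η in Metric.ball (0 : EuclideanSpace ℝ (Fin n)) 1,
          radialMean m g (x + (((l + 1 : ℕ) : ℝ) * ρ) • η) (((l + 1 : ℕ) : ℝ) * ρ) ^ q)) := by
        have hms : Measurable fun η : EuclideanSpace ℝ (Fin n) => ∑ l ∈ Finset.range k,
            radialMean m g (x + (((l + 1 : ℕ) : ℝ) * ρ) • η) (((l + 1 : ℕ) : ℝ) * ρ) ^ q :=
          Finset.measurable_fun_sum _ fun l _ => (hTm l).pow_const q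
        rw [lintegral_const_mul _ ((measurable_const.fun_add hms).const_mul _),
          lintegral_const_mul _ (measurable_const.fun_add hms), lintegral_add_left measurable_const,
          setLIntegral_const, lintegral_finsetSum _ fun l _ => (hTm l).pow_const q]
    _ ≤ (κ⁻¹ * C₂ * ENNReal.ofReal (ρ ^ k)) ^ q * (((k + 1 : ℕ) : ℝ≥0∞) ^ (q - 1) *
        (radialMean m g x (a * ρ) ^ q * (κ + C₃) + (κ + C₃) * ∑ l ∈ Finset.range k,
          unitBallMean (fun z => g z ^ u) x (a * (((l + 1 : ℕ) : ℝ) * ρ)) ^ (q / u))) := by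
        gcongr
        · exact le_self_add
        · rw [Finset.mul_sum]
          refine (Finset.sum_le_sum hterm).trans ?_
          gcongr
          exact le_add_self
    _ = _ := by
        rw [ENNReal.mul_rpow_of_nonneg _ _ hq0.le]
        ring

end AveragedDifference

/-! ### A consequence of the Besicovitch covering theorem -/

section Besicovitch

variable {α : Type*} [MetricSpace α] [SecondCountableTopology α] [MeasurableSpace α] [BorelSpace α]

/-- A consequence of the Besicovitch covering theorem: if every point of `S` is the centre of a
ball on which `μ` is dominated by `ρ`, then `μ S` is bounded by the total mass of `ρ`. -/
lemma exists_measure_le_mul_of_closedBall (α : Type*) [MetricSpace α] [SecondCountableTopology α]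
    [MeasurableSpace α] [BorelSpace α] [HasBesicovitchCovering α] :
    ∃ N : ℕ, ∀ (μ ρ : Measure α) (S : Set α) (r : α → ℝ) (R : ℝ),
      (∀ x ∈ S, 0 < r x ∧ r x ≤ R ∧
        μ (Metric.closedBall x (r x)) ≤ ρ (Metric.closedBall x (r x))) →
      μ S ≤ N * ρ univ := by
  obtain ⟨N, τ, hτ, hN⟩ := HasBesicovitchCovering.no_satelliteConfig (α := α)
  refine ⟨N, fun μ ρ S r R h => ?_⟩
  let q : Besicovitch.BallPackage S α :=
    { c := fun x => x
      r := fun x => r x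
      rpos := fun x => (h x x.2).1
      r_bound := R
      r_le := fun x => (h x x.2).2.1 }
  obtain ⟨s, hs, hcov⟩ := Besicovitch.exist_disjoint_covering_families hτ hN q
  have hc : ∀ i, (s i).Countable := fun i => by
    refine (hs i).countable_of_nonempty_interior fun x _ => ⟨(x : α), ?_⟩
    exact Metric.ball_subset_interior_closedBall (Metric.mem_ball_self (h x x.2).1)
  have hSub : S ⊆ ⋃ i : Fin N, ⋃ j ∈ s i, Metric.closedBall (q.c j) (q.r j) := by
    intro x hx
    have h1 : x ∈ range q.c := ⟨⟨x, hx⟩, rfl⟩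
    have h2 := hcov h1
    simp only [mem_iUnion] at h2 ⊢
    obtain ⟨i, j, hj, hb⟩ := h2
    exact ⟨i, j, hj, Metric.ball_subset_closedBall hb⟩
  calc μ S ≤ ∑ i : Fin N, μ (⋃ j ∈ s i, Metric.closedBall (q.c j) (q.r j)) :=
        (measure_mono hSub).trans (measure_iUnion_fintype_le _ _)
    _ ≤ ∑ _i : Fin N, ρ univ := by
        refine Finset.sum_le_sum fun i _ => ?_
        calc _ = ∑' j : s i, μ (Metric.closedBall (q.c j) (q.r j)) :=
              measure_biUnion (hc i) (hs i) fun j _ => Metric.isClosed_closedBall.measurableSet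
          _ ≤ ∑' j : s i, ρ (Metric.closedBall (q.c j) (q.r j)) :=
              ENNReal.tsum_le_tsum fun j => (h (j : S) (j : S).2).2.2
          _ = ρ (⋃ j ∈ s i, Metric.closedBall (q.c j) (q.r j)) :=
              (measure_biUnion (hc i) (hs i)
                fun j _ => Metric.isClosed_closedBall.measurableSet).symm
          _ ≤ ρ univ := measure_mono (subset_univ _)
    _ = N * ρ univ := by simp

end Besicovitch

/-! ### The dyadic centred maximal function -/

section Maximal

variable {α : Type*} [MetricSpace α] [MeasurableSpace α]

/-- The centred maximal function with respect to `ν`. Only the radii `2 ^ j` are used, which makes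
the supremum countable. -/
noncomputable def centredMaximal (ν : Measure α) (F : α → ℝ≥0∞) (x : α) : ℝ≥0∞ :=
  ⨆ j : ℤ, (ν (Metric.closedBall x ((2 : ℝ) ^ j)))⁻¹ *
    ∫⁻ y in Metric.closedBall x ((2 : ℝ) ^ j), F y ∂ν

lemma le_centredMaximal (ν : Measure α) (F : α → ℝ≥0∞) (x : α) (j : ℤ) :
    (ν (Metric.closedBall x ((2 : ℝ) ^ j)))⁻¹ *
      ∫⁻ y in Metric.closedBall x ((2 : ℝ) ^ j), F y ∂ν ≤ centredMaximal ν F x :=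
  le_iSup (fun j : ℤ => (ν (Metric.closedBall x ((2 : ℝ) ^ j)))⁻¹ *
    ∫⁻ y in Metric.closedBall x ((2 : ℝ) ^ j), F y ∂ν) j

variable [SecondCountableTopology α] [BorelSpace α]

lemma measurable_setLIntegral_closedBall {ν : Measure α} [SFinite ν] {F : α → ℝ≥0∞}
    (hF : Measurable F) (r : ℝ) :
    Measurable fun x => ∫⁻ y in Metric.closedBall x r, F y ∂ν := by
  have hS : MeasurableSet {p : α × α | dist p.2 p.1 ≤ r} :=
    measurableSet_le (by fun_prop) measurable_const
  have : (fun x => ∫⁻ y in Metric.closedBall x r, F y ∂ν) = fun x =>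
      ∫⁻ y, {p : α × α | dist p.2 p.1 ≤ r}.indicator (fun p => F p.2) (x, y) ∂ν := by
    ext x
    rw [← lintegral_indicator Metric.isClosed_closedBall.measurableSet]
    rfl
  rw [this]
  exact Measurable.lintegral_prod_right' (Measurable.indicator (by fun_prop) hS)

lemma measurable_centredMaximal {ν : Measure α} [SFinite ν] {F : α → ℝ≥0∞}
    (hF : Measurable F) : Measurable (centredMaximal ν F) := by
  refine Measurable.iSup fun j => Measurable.mul ?_ (measurable_setLIntegral_closedBall hF _)
  refine Measurable.inv ?_
  have := measurable_setLIntegral_closedBall (ν := ν) (F := fun _ => 1) measurable_const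
    ((2 : ℝ) ^ j)
  simpa using this

/-- The weak type `(1, 1)` inequality. The hypothesis compares averages with respect to `ν` with
averages with respect to `μ`. -/
lemma exists_measure_lt_centredMaximal_le (α : Type*) [MetricSpace α] [SecondCountableTopology α]
    [MeasurableSpace α] [BorelSpace α] [HasBesicovitchCovering α] :
    ∃ N : ℕ, ∀ (μ ν : Measure α) (K : ℝ≥0∞),
      (∀ (x : α) (r : ℝ) (F : α → ℝ≥0∞), 0 < r → Measurable F →
        μ (Metric.closedBall x r) * ∫⁻ y in Metric.closedBall x r, F y ∂ν ≤
          K * ν (Metric.closedBall x r) * ∫⁻ y in Metric.closedBall x r, F y ∂μ) →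
      ∀ F : α → ℝ≥0∞, Measurable F → ∀ s : ℝ≥0∞,
        s * μ {x | s < centredMaximal ν F x} ≤ N * K * ∫⁻ x, F x ∂μ := by
  obtain ⟨N, hN⟩ := exists_measure_le_mul_of_closedBall α
  refine ⟨N, fun μ ν K H F hF s => ?_⟩
  set A : ℕ → Set α := fun J => {x | ∃ j : ℤ, j ≤ J ∧
    s < (ν (Metric.closedBall x ((2 : ℝ) ^ j)))⁻¹ *
      ∫⁻ y in Metric.closedBall x ((2 : ℝ) ^ j), F y ∂ν} with hA
  have hU : {x | s < centredMaximal ν F x} = ⋃ J, A J := by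
    ext x
    simp only [mem_ofPred_eq, centredMaximal, lt_iSup_iff, mem_iUnion, hA]
    constructor
    · rintro ⟨j, hj⟩
      exact ⟨j.toNat, j, Int.self_le_toNat j, hj⟩
    · rintro ⟨J, j, _, hj⟩
      exact ⟨j, hj⟩
  have hmono : Monotone A := by
    intro J J' hJ x hx
    obtain ⟨j, hj, h⟩ := hx
    exact ⟨j, hj.trans (by exact_mod_cast hJ), h⟩
  rw [hU, hmono.measure_iUnion, ENNReal.mul_iSup]
  refine iSup_le fun J => ?_
  have hch : ∀ x, ∃ r : ℝ, x ∈ A J → 0 < r ∧ r ≤ 2 ^ (J : ℤ) ∧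
      (s • μ) (Metric.closedBall x r) ≤ (K • μ.withDensity F) (Metric.closedBall x r) := by
    intro x
    by_cases hx : x ∈ A J
    · obtain ⟨j, hj, h⟩ := hx
      refine ⟨2 ^ j, fun _ => ⟨by positivity, zpow_le_zpow_right₀ (by norm_num) hj, ?_⟩⟩
      set B := Metric.closedBall x ((2 : ℝ) ^ j)
      have hB : MeasurableSet B := Metric.isClosed_closedBall.measurableSet
      simp only [Measure.smul_apply, smul_eq_mul]
      rw [withDensity_apply _ hB]
      calc s * μ B ≤ ((ν B)⁻¹ * ∫⁻ y in B, F y ∂ν) * μ B := by gcongr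
        _ = (ν B)⁻¹ * (μ B * ∫⁻ y in B, F y ∂ν) := by ring
        _ ≤ (ν B)⁻¹ * (K * ν B * ∫⁻ y in B, F y ∂μ) :=
            mul_le_mul_right (H x _ F (by positivity) hF) _
        _ = ((ν B)⁻¹ * ν B) * (K * ∫⁻ y in B, F y ∂μ) := by ring
        _ ≤ 1 * (K * ∫⁻ y in B, F y ∂μ) := by
            gcongr
            exact ENNReal.inv_mul_le_one _
        _ = _ := one_mul _
    · exact ⟨0, fun h => absurd h hx⟩
  choose r hr using hch
  have := hN (s • μ) (K • μ.withDensity F) (A J) r (2 ^ (J : ℤ)) fun x hx => hr x hx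
  simpa [mul_assoc] using this

/-- The integral `∫ s ^ (t - 1) ds` over `0 < s < a`, for an extended number `a`. -/
lemma lintegral_Ioi_indicator_rpow {t : ℝ} (ht : 0 < t) (a : ℝ≥0∞) :
    ∫⁻ s in Ioi (0 : ℝ), {s : ℝ | ENNReal.ofReal s < a}.indicator
      (fun s => ENNReal.ofReal (s ^ (t - 1))) s = ENNReal.ofReal t⁻¹ * a ^ t := by
  have hfin : ∀ b : ℝ, 0 ≤ b → ∫⁻ s in Ioi (0 : ℝ), {s : ℝ | s < b}.indicator
      (fun s => ENNReal.ofReal (s ^ (t - 1))) s = ENNReal.ofReal (t⁻¹ * b ^ t) := by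
    intro b hb
    have hms : MeasurableSet {s : ℝ | s < b} := measurableSet_Iio
    rw [lintegral_indicator hms, Measure.restrict_restrict hms]
    have : {s : ℝ | s < b} ∩ Ioi 0 = Ioo 0 b := by ext; simp [and_comm]
    rw [this, restrict_Ioo_eq_restrict_Ioc]
    have hi := (intervalIntegral.intervalIntegrable_rpow' (a := 0) (b := b)
      (r := t - 1) (by linarith)).1
    rw [← ofReal_integral_eq_lintegral_ofReal hi, ← intervalIntegral.integral_of_le hb,
      integral_rpow (Or.inl (by linarith))]
    · congr 1
      rw [sub_add_cancel, Real.zero_rpow ht.ne']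
      field_simp
      ring
    · filter_upwards [ae_restrict_mem measurableSet_Ioc] with s hs
      exact Real.rpow_nonneg hs.1.le _
  rcases eq_or_ne a ∞ with rfl | ha
  · rw [ENNReal.top_rpow_of_pos ht, ENNReal.mul_top (by simpa using ht)]
    refine ENNReal.eq_top_of_forall_nnreal_le fun c => ?_
    set b : ℝ := (t * c) ^ t⁻¹
    have hb : 0 ≤ b := by positivity
    calc (c : ℝ≥0∞) = ENNReal.ofReal (t⁻¹ * b ^ t) := by
          rw [← Real.rpow_mul (by positivity), inv_mul_cancel₀ ht.ne', Real.rpow_one,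
            inv_mul_cancel_left₀ ht.ne', ENNReal.ofReal_coe_nnreal]
      _ ≤ _ := by
          rw [← hfin b hb]
          refine lintegral_mono fun s => ?_
          refine indicator_le_indicator_of_subset (fun _ _ => ?_) (fun _ => zero_le) s
          simp
  · have h := hfin a.toReal ENNReal.toReal_nonneg
    rw [ENNReal.ofReal_mul (by positivity),
      ← ENNReal.ofReal_rpow_of_nonneg ENNReal.toReal_nonneg ht.le, ENNReal.ofReal_toReal ha] at h
    rw [← h]
    refine setLIntegral_congr_fun measurableSet_Ioi fun s hs => ?_
    have hs0 : 0 < s := hs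
    have : ENNReal.ofReal s < a ↔ s < a.toReal := ENNReal.ofReal_lt_iff_lt_toReal hs0.le ha
    simp only [indicator, mem_ofPred_eq, this]

/-- The strong type inequality, by Marcinkiewicz interpolation with the trivial bound on
`L^∞`. -/
lemma exists_lintegral_centredMaximal_rpow_le (α : Type*) [MetricSpace α]
    [SecondCountableTopology α] [MeasurableSpace α] [BorelSpace α] [HasBesicovitchCovering α]
    {t : ℝ} (ht : 1 < t) :
    ∃ C : ℝ≥0∞, C ≠ ∞ ∧ ∀ (μ ν : Measure α) [SFinite μ] [SFinite ν] (K : ℝ≥0∞),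
      (∀ (x : α) (r : ℝ) (F : α → ℝ≥0∞), 0 < r → Measurable F →
        μ (Metric.closedBall x r) * ∫⁻ y in Metric.closedBall x r, F y ∂ν ≤
          K * ν (Metric.closedBall x r) * ∫⁻ y in Metric.closedBall x r, F y ∂μ) →
      ∀ F : α → ℝ≥0∞, Measurable F →
        ∫⁻ x, centredMaximal ν F x ^ t ∂μ ≤ C * K * ∫⁻ x, F x ^ t ∂μ := by
  obtain ⟨N, hN⟩ := exists_measure_lt_centredMaximal_le α
  have ht0 : 0 < t := by linarith
  have ht1 : 0 < t - 1 := by linarith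
  refine ⟨ENNReal.ofReal t * (2 * N * (ENNReal.ofReal (t - 1)⁻¹ * 2 ^ (t - 1))),
    by finiteness, ?_⟩
  intro μ ν _ _ K H F hF
  have hM := measurable_centredMaximal (ν := ν) hF
  -- the part of `F` below half the height does not contribute to the level set
  have hlevel : ∀ s : ℝ, 0 < s → ENNReal.ofReal s *
      μ {x | ENNReal.ofReal s < centredMaximal ν F x} ≤
      2 * N * K * ∫⁻ x, {x | ENNReal.ofReal s < 2 * F x}.indicator F x ∂μ := by
    intro s hs
    set c := ENNReal.ofReal (s / 2) with hc
    have hcs : ENNReal.ofReal s = c + c := by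
      rw [hc, ← ENNReal.ofReal_add (by positivity) (by positivity)]; ring_nf
    set E := {x | ENNReal.ofReal s < 2 * F x} with hE
    have hEm : MeasurableSet E := measurableSet_lt measurable_const (hF.const_mul 2)
    have hsub : {x | ENNReal.ofReal s < centredMaximal ν F x} ⊆
        {x | c < centredMaximal ν (E.indicator F) x} := by
      intro x hx
      simp only [mem_ofPred_eq, centredMaximal, lt_iSup_iff] at hx ⊢
      obtain ⟨j, hj⟩ := hx
      refine ⟨j, ?_⟩
      set B := Metric.closedBall x ((2 : ℝ) ^ j)
      by_contra! hcon
      refine absurd hj (not_lt.2 ?_)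
      calc (ν B)⁻¹ * ∫⁻ y in B, F y ∂ν
          ≤ (ν B)⁻¹ * ∫⁻ y in B, (E.indicator F y + c) ∂ν := by
            gcongr with y
            by_cases hy : y ∈ E
            · rw [indicator_of_mem hy]; exact le_self_add
            · rw [indicator_of_notMem hy, zero_add]
              rw [hE, mem_ofPred_eq, not_lt, hcs, ← two_mul] at hy
              exact (ENNReal.mul_le_mul_iff_right (by simp) (by simp)).1 hy
        _ = (ν B)⁻¹ * ∫⁻ y in B, E.indicator F y ∂ν + ((ν B)⁻¹ * ν B) * c := by
            rw [lintegral_add_left (hF.indicator hEm), setLIntegral_const]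
            ring
        _ ≤ c + 1 * c := by
            gcongr
            exact ENNReal.inv_mul_le_one _
        _ = ENNReal.ofReal s := by rw [hcs, one_mul]
    calc _ ≤ (c + c) * μ {x | c < centredMaximal ν (E.indicator F) x} := by
          rw [← hcs]
          exact mul_le_mul_right (measure_mono hsub) _
      _ = 2 * (c * μ {x | c < centredMaximal ν (E.indicator F) x}) := by ring
      _ ≤ 2 * (N * K * ∫⁻ x, E.indicator F x ∂μ) := by
          exact mul_le_mul_right (hN μ ν K H _ (hF.indicator hEm) c) _
      _ = _ := by ring
  have hcake : ∀ (h : α → ℝ≥0∞), Measurable h → Measurable fun z : α × ℝ =>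
      {s : ℝ | ENNReal.ofReal s < h z.1}.indicator
      (fun s => ENNReal.ofReal (s ^ (t - 1))) z.2 := by
    intro h hh
    have : MeasurableSet {z : α × ℝ | ENNReal.ofReal z.2 < h z.1} :=
      measurableSet_lt (by fun_prop) (by fun_prop)
    exact Measurable.indicator (f := fun z : α × ℝ => ENNReal.ofReal (z.2 ^ (t - 1)))
      (by fun_prop) this
  have hpow : ∀ a : ℝ≥0∞, a ^ t = ENNReal.ofReal t * ∫⁻ s in Ioi (0 : ℝ),
      {s : ℝ | ENNReal.ofReal s < a}.indicator (fun s => ENNReal.ofReal (s ^ (t - 1))) s := by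
    intro a
    rw [lintegral_Ioi_indicator_rpow ht0, ← mul_assoc, ← ENNReal.ofReal_mul ht0.le,
      mul_inv_cancel₀ ht0.ne', ENNReal.ofReal_one, one_mul]
  calc ∫⁻ x, centredMaximal ν F x ^ t ∂μ
      = ENNReal.ofReal t * ∫⁻ x, (∫⁻ s in Ioi (0 : ℝ),
          {s : ℝ | ENNReal.ofReal s < centredMaximal ν F x}.indicator
            (fun s => ENNReal.ofReal (s ^ (t - 1))) s) ∂μ := by
        rw [← lintegral_const_mul' _ _ (by finiteness)]
        exact lintegral_congr fun x => hpow _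
    _ = ENNReal.ofReal t * ∫⁻ s in Ioi (0 : ℝ), ENNReal.ofReal (s ^ (t - 1)) *
          μ {x | ENNReal.ofReal s < centredMaximal ν F x} := by
        rw [lintegral_lintegral_swap (hcake _ hM).aemeasurable]
        congr 1
        refine lintegral_congr fun s => ?_
        have hm : MeasurableSet {x | ENNReal.ofReal s < centredMaximal ν F x} :=
          measurableSet_lt measurable_const hM
        rw [← setLIntegral_const, ← lintegral_indicator hm]
        rfl
    _ ≤ ENNReal.ofReal t * ∫⁻ s in Ioi (0 : ℝ), 2 * N * K * ∫⁻ x,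
          {s : ℝ | ENNReal.ofReal s < 2 * F x}.indicator
            (fun s => ENNReal.ofReal (s ^ ((t - 1) - 1))) s * F x ∂μ := by
        refine mul_le_mul_right (setLIntegral_mono' measurableSet_Ioi fun s hs => ?_) _
        have hs0 : 0 < s := hs
        have e : s ^ (t - 1) = s ^ (t - 1 - 1) * s := by
          rw [Real.rpow_sub_one hs0.ne' (t - 1), div_mul_cancel₀ _ hs0.ne']
        rw [e, ENNReal.ofReal_mul (by positivity), mul_assoc]
        calc _ ≤ ENNReal.ofReal (s ^ (t - 1 - 1)) *
              (2 * N * K * ∫⁻ x, {x | ENNReal.ofReal s < 2 * F x}.indicator F x ∂μ) := by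
              exact mul_le_mul_right (hlevel s hs0) _
          _ = 2 * N * K * ∫⁻ x, ENNReal.ofReal (s ^ (t - 1 - 1)) *
                {x | ENNReal.ofReal s < 2 * F x}.indicator F x ∂μ := by
              rw [lintegral_const_mul' _ _ (by finiteness)]
              ring
          _ = _ := by
              congr 1
              refine lintegral_congr fun x => ?_
              by_cases hx : ENNReal.ofReal s < 2 * F x <;> simp [indicator, hx]
    _ = ENNReal.ofReal t * (2 * N * K * ∫⁻ x, (∫⁻ s in Ioi (0 : ℝ),
          {s : ℝ | ENNReal.ofReal s < 2 * F x}.indicator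
            (fun s => ENNReal.ofReal (s ^ ((t - 1) - 1))) s * F x) ∂μ) := by
        have hm : Measurable fun z : ℝ × α => {s : ℝ | ENNReal.ofReal s < 2 * F z.2}.indicator
            (fun s => ENNReal.ofReal (s ^ ((t - 1) - 1))) z.1 * F z.2 := by
          refine Measurable.mul ?_ (by fun_prop)
          have : MeasurableSet {z : ℝ × α | ENNReal.ofReal z.1 < 2 * F z.2} :=
            measurableSet_lt (by fun_prop) (by fun_prop)
          exact Measurable.indicator (f := fun z : ℝ × α => ENNReal.ofReal (z.1 ^ (t - 1 - 1)))
            (by fun_prop) this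
        rw [lintegral_const_mul _ hm.lintegral_prod_right',
            lintegral_lintegral_swap hm.aemeasurable]
    _ = ENNReal.ofReal t * (2 * N * K * ∫⁻ x, ENNReal.ofReal (t - 1)⁻¹ * 2 ^ (t - 1) *
          F x ^ t ∂μ) := by
        congr 2
        refine lintegral_congr fun x => ?_
        rw [lintegral_mul_const, lintegral_Ioi_indicator_rpow ht1,
          ENNReal.mul_rpow_of_nonneg _ _ ht1.le]
        · conv_rhs => rw [← sub_add_cancel t 1,
            ENNReal.rpow_add_of_nonneg _ _ ht1.le zero_le_one, ENNReal.rpow_one]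
          simp only [sub_add_cancel]
          ring
        · exact Measurable.indicator (by fun_prop) (measurableSet_lt (by fun_prop) measurable_const)
    _ = _ := by
        rw [lintegral_const_mul' _ _ (by finiteness)]
        ring

end Maximal

/-! ### Weighted maximal inequalities -/

section WeightedMaximal

variable {n : ℕ}

lemma volume_closedBall_eq (x : EuclideanSpace ℝ (Fin n)) {r : ℝ} (hr : 0 ≤ r) :
    volume (Metric.closedBall x r) =
      ENNReal.ofReal (r ^ n) * volume (Metric.ball (0 : EuclideanSpace ℝ (Fin n)) 1) := by
  rw [Measure.addHaar_closedBall _ _ hr, finrank_euclideanSpace_fin]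

lemma setLIntegral_withDensity {α : Type*} [MeasurableSpace α] {μ : Measure α} {w F : α → ℝ≥0∞}
    (hw : Measurable w) (hF : Measurable F) {s : Set α} (hs : MeasurableSet s) :
    ∫⁻ x in s, F x ∂(μ.withDensity w) = ∫⁻ x in s, w x * F x ∂μ := by
  rw [restrict_withDensity hs, lintegral_withDensity_eq_lintegral_mul _ hw hF]
  rfl

/-- Buckley's bound for the maximal function on `L^t(w)`, with the sharp power of the constant in
the Muckenhoupt condition. Following Lerner, the maximal function is dominated pointwise by the
composition of the maximal functions with respect to `w` and `w ^ (-1 / (t - 1))`. -/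
lemma exists_lintegral_centredMaximal_rpow_mul_le (n : ℕ) {t : ℝ} (ht : 1 < t) :
    ∃ C : ℝ≥0∞, C ≠ ∞ ∧ ∀ (w : EuclideanSpace ℝ (Fin n) → ℝ≥0∞) (K : ℝ≥0∞), Measurable w →
      (∀ x, w x ≠ 0) → (∀ x, w x ≠ ∞) →
      (∀ (x : EuclideanSpace ℝ (Fin n)) (r : ℝ), 0 < r →
        ∫⁻ y in Metric.closedBall x r, w y ≠ ∞ ∧
        ∫⁻ y in Metric.closedBall x r, w y ^ (-(1 / (t - 1))) ≠ ∞ ∧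
        (∫⁻ y in Metric.closedBall x r, w y) *
          (∫⁻ y in Metric.closedBall x r, w y ^ (-(1 / (t - 1)))) ^ (t - 1) ≤
            K * volume (Metric.closedBall x r) ^ t) →
      ∀ G : EuclideanSpace ℝ (Fin n) → ℝ≥0∞, Measurable G →
        ∫⁻ x, centredMaximal volume G x ^ t * w x ≤
          C * K ^ (t / (t - 1)) * ∫⁻ x, G x ^ t * w x := by
  have ht0 : 0 < t := by linarith
  have ht1 : 0 < t - 1 := by linarith
  have htt : 1 < t / (t - 1) := by rw [lt_div_iff₀ ht1]; linarith
  obtain ⟨C₁, hC₁, h₁⟩ := exists_lintegral_centredMaximal_rpow_le (EuclideanSpace ℝ (Fin n)) ht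
  obtain ⟨C₂, hC₂, h₂⟩ := exists_lintegral_centredMaximal_rpow_le (EuclideanSpace ℝ (Fin n)) htt
  refine ⟨((4 : ℝ≥0∞) ^ ((n : ℝ) * t)) ^ (t / (t - 1)) * C₂ * C₁, by finiteness, ?_⟩
  intro w K hw hw0 hwt hA G hG
  set σ : EuclideanSpace ℝ (Fin n) → ℝ≥0∞ := fun y => w y ^ (-(1 / (t - 1))) with hσ
  have hσm : Measurable σ := hw.pow_const _
  have hσ0 : ∀ y, σ y ≠ 0 := fun y => by
    rw [hσ]; simp only [ne_eq, ENNReal.rpow_eq_zero_iff, hw0 y, hwt y, false_and, or_self,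
      not_false_eq_true]
  have hσt : ∀ y, σ y ≠ ∞ := fun y => by
    rw [hσ]; simp only [ne_eq, ENNReal.rpow_eq_top_iff, hw0 y, hwt y, false_and, or_self,
      not_false_eq_true]
  set μw := (volume : Measure (EuclideanSpace ℝ (Fin n))).withDensity w
  set μσ := (volume : Measure (EuclideanSpace ℝ (Fin n))).withDensity σ
  have hμw : ∀ x r, μw (Metric.closedBall x r) = ∫⁻ y in Metric.closedBall x r, w y := fun x r =>
    withDensity_apply _ Metric.isClosed_closedBall.measurableSet
  have hμσ : ∀ x r, μσ (Metric.closedBall x r) = ∫⁻ y in Metric.closedBall x r, σ y := fun x r =>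
    withDensity_apply _ Metric.isClosed_closedBall.measurableSet
  have hpos : ∀ (v : EuclideanSpace ℝ (Fin n) → ℝ≥0∞), Measurable v → (∀ x, v x ≠ 0) →
      ∀ x r, 0 < r → ∫⁻ y in Metric.closedBall x r, v y ≠ 0 := by
    intro v hv hv0 x r hr
    refine (setLIntegral_pos_iff hv).2 ?_ |>.ne'
    have : Function.support v = univ := by ext y; simp [hv0 y]
    rw [this, univ_inter]
    exact Metric.measure_closedBall_pos _ _ hr
  set φ := centredMaximal μσ (fun y => G y * (σ y)⁻¹) with hφ
  have hφm : Measurable φ := measurable_centredMaximal (by fun_prop)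
  set ψ := centredMaximal μw (fun y => φ y ^ (t - 1) * (w y)⁻¹) with hψ
  have hψm : Measurable ψ := measurable_centredMaximal (by fun_prop)
  -- the pointwise domination
  have hdom : ∀ x, centredMaximal volume G x ≤
      ((4 : ℝ≥0∞) ^ ((n : ℝ) * t) * K * ψ x) ^ (1 / (t - 1)) := by
    intro x
    refine iSup_le fun j => ?_
    set r : ℝ := 2 ^ j with hr
    have hr0 : 0 < r := by positivity
    set B := Metric.closedBall x r
    have hBm : MeasurableSet B := Metric.isClosed_closedBall.measurableSet
    set W := ∫⁻ y in Metric.closedBall x (4 * r), w y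
    set S := ∫⁻ y in Metric.closedBall x (4 * r), σ y
    obtain ⟨hWt, hSt, hWS⟩ := hA x (4 * r) (by positivity)
    have hS0 : S ≠ 0 := hpos σ hσm hσ0 x (4 * r) (by positivity)
    set V := volume B with hV
    have hV0 : V ≠ 0 := (Metric.measure_closedBall_pos _ _ hr0).ne'
    have hVt : V ≠ ∞ := measure_closedBall_lt_top.ne
    have hV4 : volume (Metric.closedBall x (4 * r)) = 4 ^ n * V := by
      rw [hV, volume_closedBall_eq _ (by positivity), volume_closedBall_eq _ hr0.le, mul_pow,
        ENNReal.ofReal_mul (by positivity), ENNReal.ofReal_pow (by norm_num)]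
      norm_num [mul_assoc]
    set I := ∫⁻ y in B, G y
    -- enlarge `B` to a dyadic ball about `y`, on which `φ y` controls the mean of `G / σ`
    have hI : ∀ y ∈ B, I ≤ S * φ y := by
      intro y hy
      rw [Metric.mem_closedBall] at hy
      have hsub1 : B ⊆ Metric.closedBall y ((2 : ℝ) ^ (j + 1)) := by
        refine Metric.closedBall_subset_closedBall' ?_
        rw [zpow_add_one₀ (by norm_num), dist_comm]
        linarith
      have hsub2 : Metric.closedBall y ((2 : ℝ) ^ (j + 1)) ⊆ Metric.closedBall x (4 * r) := by
        refine Metric.closedBall_subset_closedBall' ?_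
        rw [zpow_add_one₀ (by norm_num)]
        linarith
      set D := Metric.closedBall y ((2 : ℝ) ^ (j + 1))
      have hD0 : μσ D ≠ 0 := by
        rw [hμσ]; exact hpos σ hσm hσ0 _ _ (by positivity)
      have hDS : μσ D ≤ S := by rw [hμσ]; exact lintegral_mono_set hsub2
      calc I ≤ ∫⁻ z in D, G z := lintegral_mono_set hsub1
        _ = ∫⁻ z in D, G z * (σ z)⁻¹ ∂μσ := by
            rw [setLIntegral_withDensity hσm (by fun_prop) Metric.isClosed_closedBall.measurableSet]
            refine lintegral_congr fun z => ?_
            rw [mul_left_comm, ENNReal.mul_inv_cancel (hσ0 z) (hσt z), mul_one]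
        _ = μσ D * ((μσ D)⁻¹ * ∫⁻ z in D, G z * (σ z)⁻¹ ∂μσ) := by
            rw [← mul_assoc, ENNReal.mul_inv_cancel hD0 (ne_top_of_le_ne_top hSt hDS), one_mul]
        _ ≤ S * φ y := by
            gcongr
            exact le_centredMaximal μσ _ y (j + 1)
    -- average the previous bound over `B`
    have hI2 : V * I ^ (t - 1) ≤ S ^ (t - 1) * (W * ψ x) := by
      have hμB : μw B ≤ W := by
        rw [hμw]
        exact lintegral_mono_set (Metric.closedBall_subset_closedBall (by linarith))
      have hμB0 : μw B ≠ 0 := by rw [hμw]; exact hpos w hw hw0 _ _ hr0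
      calc V * I ^ (t - 1) = ∫⁻ _y in B, I ^ (t - 1) := by rw [setLIntegral_const, mul_comm]
        _ ≤ ∫⁻ y in B, S ^ (t - 1) * φ y ^ (t - 1) := by
            refine setLIntegral_mono' hBm fun y hy => ?_
            rw [← ENNReal.mul_rpow_of_nonneg _ _ ht1.le]
            gcongr
            exact hI y hy
        _ = S ^ (t - 1) * ∫⁻ y in B, φ y ^ (t - 1) * (w y)⁻¹ ∂μw := by
            rw [lintegral_const_mul _ (by fun_prop),
              setLIntegral_withDensity hw (by fun_prop) hBm]
            congr 1
            refine lintegral_congr fun z => ?_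
            rw [mul_left_comm, ENNReal.mul_inv_cancel (hw0 z) (hwt z), mul_one]
        _ = S ^ (t - 1) * (μw B * ((μw B)⁻¹ * ∫⁻ y in B, φ y ^ (t - 1) * (w y)⁻¹ ∂μw)) := by
            rw [← mul_assoc (μw B),
              ENNReal.mul_inv_cancel hμB0 (ne_top_of_le_ne_top hWt hμB), one_mul]
        _ ≤ _ := by
            gcongr
            exact le_centredMaximal μw _ x j
    have hfin : (V⁻¹ * I) ^ (t - 1) ≤ (4 : ℝ≥0∞) ^ ((n : ℝ) * t) * K * ψ x := by
      have e1 : (V⁻¹ * I) ^ (t - 1) = V⁻¹ ^ t * (V * I ^ (t - 1)) := by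
        rw [ENNReal.mul_rpow_of_nonneg _ _ ht1.le, ← mul_assoc]
        congr 1
        conv_rhs => rw [← sub_add_cancel t 1,
            ENNReal.rpow_add_of_nonneg _ _ ht1.le zero_le_one, ENNReal.rpow_one, mul_assoc,
            ENNReal.inv_mul_cancel hV0 hVt, mul_one]
      have e2 : V⁻¹ ^ t * (4 ^ n * V) ^ t = (4 : ℝ≥0∞) ^ ((n : ℝ) * t) := by
        rw [← ENNReal.mul_rpow_of_nonneg _ _ ht0.le, mul_left_comm,
          ENNReal.inv_mul_cancel hV0 hVt, mul_one, ENNReal.rpow_mul, ENNReal.rpow_natCast]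
      calc _ = V⁻¹ ^ t * (V * I ^ (t - 1)) := e1
        _ ≤ V⁻¹ ^ t * (S ^ (t - 1) * (W * ψ x)) := by gcongr
        _ = V⁻¹ ^ t * ((W * S ^ (t - 1)) * ψ x) := by ring
        _ ≤ V⁻¹ ^ t * ((K * (4 ^ n * V) ^ t) * ψ x) := by
            rw [← hV4]
            exact mul_le_mul_right (mul_le_mul_left hWS _) _
        _ = (V⁻¹ ^ t * (4 ^ n * V) ^ t) * K * ψ x := by ring
        _ = _ := by rw [e2]
    calc V⁻¹ * I = ((V⁻¹ * I) ^ (t - 1)) ^ (1 / (t - 1)) := by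
          rw [← ENNReal.rpow_mul, mul_one_div_cancel ht1.ne', ENNReal.rpow_one]
      _ ≤ _ := by gcongr
  have hrefl : ∀ (μ : Measure (EuclideanSpace ℝ (Fin n))) (x : EuclideanSpace ℝ (Fin n)) (r : ℝ)
      (F : EuclideanSpace ℝ (Fin n) → ℝ≥0∞), 0 < r → Measurable F →
        μ (Metric.closedBall x r) * ∫⁻ y in Metric.closedBall x r, F y ∂μ ≤
          1 * μ (Metric.closedBall x r) * ∫⁻ y in Metric.closedBall x r, F y ∂μ :=
    fun μ x r F _ _ => by rw [one_mul]
  have hstep1 := h₁ μσ μσ 1 (hrefl μσ) (fun y => G y * (σ y)⁻¹) (by fun_prop)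
  have hstep2 := h₂ μw μw 1 (hrefl μw) (fun y => φ y ^ (t - 1) * (w y)⁻¹) (by fun_prop)
  have hwσ : ∀ x, w x * ((w x)⁻¹) ^ (t / (t - 1)) = σ x := by
    intro x
    rw [hσ]
    simp only
    rw [← ENNReal.rpow_neg_one, ← ENNReal.rpow_mul]
    nth_rewrite 1 [← ENNReal.rpow_one (w x)]
    rw [← ENNReal.rpow_add _ _ (hw0 x) (hwt x)]
    congr 1
    field_simp
    ring
  have hσw : ∀ x, σ x * ((σ x)⁻¹) ^ t = w x := by
    intro x
    rw [← ENNReal.rpow_neg_one, ← ENNReal.rpow_mul]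
    nth_rewrite 1 [← ENNReal.rpow_one (σ x)]
    rw [← ENNReal.rpow_add _ _ (hσ0 x) (hσt x), hσ]
    simp only
    rw [← ENNReal.rpow_mul]
    conv_rhs => rw [← ENNReal.rpow_one (w x)]
    congr 1
    field_simp
    ring
  calc ∫⁻ x, centredMaximal volume G x ^ t * w x
      ≤ ∫⁻ x, ((4 : ℝ≥0∞) ^ ((n : ℝ) * t) * K) ^ (t / (t - 1)) *
          (w x * ψ x ^ (t / (t - 1))) := by
        refine lintegral_mono fun x => ?_
        calc _ ≤ (((4 : ℝ≥0∞) ^ ((n : ℝ) * t) * K * ψ x) ^ (1 / (t - 1))) ^ t * w x := by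
              gcongr
              exact hdom x
          _ = _ := by
              rw [← ENNReal.rpow_mul, ENNReal.mul_rpow_of_nonneg _ _ (by positivity),
                one_div_mul_eq_div]
              ring
    _ = ((4 : ℝ≥0∞) ^ ((n : ℝ) * t) * K) ^ (t / (t - 1)) * ∫⁻ x, ψ x ^ (t / (t - 1)) ∂μw := by
        rw [lintegral_const_mul _ (by fun_prop),
          lintegral_withDensity_eq_lintegral_mul _ hw (by fun_prop)]
        rfl
    _ ≤ ((4 : ℝ≥0∞) ^ ((n : ℝ) * t) * K) ^ (t / (t - 1)) *
          (C₂ * 1 * ∫⁻ x, (φ x ^ (t - 1) * (w x)⁻¹) ^ (t / (t - 1)) ∂μw) :=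
        mul_le_mul_right hstep2 _
    _ = ((4 : ℝ≥0∞) ^ ((n : ℝ) * t) * K) ^ (t / (t - 1)) *
          (C₂ * ∫⁻ x, φ x ^ t ∂μσ) := by
        rw [mul_one, lintegral_withDensity_eq_lintegral_mul _ hw (by fun_prop),
          lintegral_withDensity_eq_lintegral_mul _ hσm (by fun_prop)]
        congr 2
        refine lintegral_congr fun x => ?_
        simp only [Pi.mul_apply]
        rw [ENNReal.mul_rpow_of_nonneg _ _ (by positivity), ← ENNReal.rpow_mul,
          mul_div_cancel₀ _ ht1.ne', mul_left_comm, hwσ, mul_comm]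
    _ ≤ ((4 : ℝ≥0∞) ^ ((n : ℝ) * t) * K) ^ (t / (t - 1)) *
          (C₂ * (C₁ * 1 * ∫⁻ x, (G x * (σ x)⁻¹) ^ t ∂μσ)) := by
        gcongr
    _ = ((4 : ℝ≥0∞) ^ ((n : ℝ) * t) * K) ^ (t / (t - 1)) *
          (C₂ * (C₁ * ∫⁻ x, G x ^ t * w x)) := by
        rw [mul_one, lintegral_withDensity_eq_lintegral_mul _ hσm (by fun_prop)]
        congr 3
        refine lintegral_congr fun x => ?_
        simp only [Pi.mul_apply]
        rw [ENNReal.mul_rpow_of_nonneg _ _ ht0.le, mul_left_comm, hσw]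
    _ = _ := by
        rw [ENNReal.mul_rpow_of_nonneg _ _ (by positivity)]
        ring

/-- For `A_1` weights the maximal function on `L^t(w)` is bounded with constant linear in the
constant of the weight (a special case of the Fefferman-Stein inequality). -/
lemma exists_lintegral_centredMaximal_rpow_mul_le_of_A1 (n : ℕ) {t : ℝ} (ht : 1 < t) :
    ∃ C : ℝ≥0∞, C ≠ ∞ ∧ ∀ (w : EuclideanSpace ℝ (Fin n) → ℝ≥0∞) (K : ℝ≥0∞), Measurable w →
      (∀ (x : EuclideanSpace ℝ (Fin n)) (r : ℝ), 0 < r →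
        ∀ᵐ z ∂(volume.restrict (Metric.closedBall x r)),
          ∫⁻ y in Metric.closedBall x r, w y ≤ K * volume (Metric.closedBall x r) * w z) →
      ∀ G : EuclideanSpace ℝ (Fin n) → ℝ≥0∞, Measurable G →
        ∫⁻ x, centredMaximal volume G x ^ t * w x ≤ C * K * ∫⁻ x, G x ^ t * w x := by
  have ht0 : 0 < t := by linarith
  obtain ⟨C, hC, h⟩ := exists_lintegral_centredMaximal_rpow_le (EuclideanSpace ℝ (Fin n)) ht
  refine ⟨C, hC, fun w K hw hA G hG => ?_⟩
  have h1 := h (volume.withDensity w) volume K ?_ G hG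
  · rw [lintegral_withDensity_eq_lintegral_mul _ hw
      ((measurable_centredMaximal hG).pow_const t),
      lintegral_withDensity_eq_lintegral_mul _ hw (hG.pow_const t)] at h1
    simpa only [Pi.mul_apply, mul_comm (w _)] using h1
  · intro x r F hr hF
    have hm : MeasurableSet (Metric.closedBall x r) := Metric.isClosed_closedBall.measurableSet
    rw [withDensity_apply _ hm, setLIntegral_withDensity hw hF hm,
      ← lintegral_const_mul _ hF, ← lintegral_const_mul _ (by fun_prop)]
    refine lintegral_mono_ae ?_
    filter_upwards [hA x r hr] with z hz
    rw [← mul_assoc]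
    gcongr

end WeightedMaximal

/-! ### Cubes and balls -/

section Cubes

variable {n : ℕ}

lemma axisCube_eq_preimage (a : EuclideanSpace ℝ (Fin n)) (ℓ : ℝ) :
    axisCube a ℓ = (WithLp.ofLp : EuclideanSpace ℝ (Fin n) → Fin n → ℝ) ⁻¹'
      (univ.pi fun i => Icc (a i) (a i + ℓ)) := by
  ext x
  simp only [axisCube, mem_preimage, mem_univ_pi]
  rfl

lemma measurableSet_axisCube (a : EuclideanSpace ℝ (Fin n)) (ℓ : ℝ) :
    MeasurableSet (axisCube a ℓ) := by
  rw [axisCube_eq_preimage]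
  exact (PiLp.volume_preserving_ofLp (Fin n)).measurable
    (MeasurableSet.univ_pi fun i => measurableSet_Icc)

lemma volume_axisCube (a : EuclideanSpace ℝ (Fin n)) {ℓ : ℝ} (hℓ : 0 ≤ ℓ) :
    volume (axisCube a ℓ) = ENNReal.ofReal (ℓ ^ n) := by
  rw [axisCube_eq_preimage, (PiLp.volume_preserving_ofLp (Fin n)).measure_preimage
    (MeasurableSet.univ_pi fun i => measurableSet_Icc).nullMeasurableSet, volume_pi_pi]
  simp [ENNReal.ofReal_pow hℓ]

lemma volume_axisCube_ne_zero (a : EuclideanSpace ℝ (Fin n)) {ℓ : ℝ} (hℓ : 0 < ℓ) :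
    volume (axisCube a ℓ) ≠ 0 := by
  rw [volume_axisCube a hℓ.le]; simp; positivity

lemma volume_axisCube_ne_top (a : EuclideanSpace ℝ (Fin n)) {ℓ : ℝ} (hℓ : 0 < ℓ) :
    volume (axisCube a ℓ) ≠ ∞ := by
  rw [volume_axisCube a hℓ.le]; exact ENNReal.ofReal_ne_top

/-- The lower corner of the cube with centre `x` and edge length `2 r`. -/
noncomputable def cubeCorner (x : EuclideanSpace ℝ (Fin n)) (r : ℝ) : EuclideanSpace ℝ (Fin n) :=
  WithLp.toLp 2 fun i => x i - r

lemma closedBall_subset_axisCube (x : EuclideanSpace ℝ (Fin n)) (r : ℝ) :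
    Metric.closedBall x r ⊆ axisCube (cubeCorner x r) (2 * r) := by
  intro y hy i
  rw [mem_closedBall_iff_norm] at hy
  have h1 := (PiLp.norm_apply_le (y - x) i).trans hy
  rw [PiLp.sub_apply, Real.norm_eq_abs, abs_le] at h1
  simp only [cubeCorner]
  constructor <;> linarith

lemma axisCube_subset_closedBall (hn : 1 ≤ n) {a x : EuclideanSpace ℝ (Fin n)} {ℓ : ℝ}
    (hx : x ∈ axisCube a ℓ) : axisCube a ℓ ⊆ Metric.closedBall x (n * ℓ) := by
  intro y hy
  have hb : ∀ i, ‖(y - x) i‖ ≤ ℓ := fun i => by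
    have h1 := hx i; have h2 := hy i
    rw [PiLp.sub_apply, Real.norm_eq_abs, abs_le]
    constructor <;> linarith [h1.1, h1.2, h2.1, h2.2]
  rw [mem_closedBall_iff_norm]
  have hsq : ‖y - x‖ ^ 2 ≤ (n * ℓ) ^ 2 := by
    rw [EuclideanSpace.norm_sq_eq]
    calc ∑ i, ‖(y - x) i‖ ^ 2 ≤ ∑ _i : Fin n, ℓ ^ 2 :=
          Finset.sum_le_sum fun i _ => pow_le_pow_left₀ (norm_nonneg _) (hb i) 2
      _ = n * ℓ ^ 2 := by simp
      _ ≤ (n * ℓ) ^ 2 := by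
          rw [mul_pow]
          have : (n : ℝ) ≤ n ^ 2 := by
            have : (1 : ℝ) ≤ n := by exact_mod_cast hn
            nlinarith
          gcongr
  have hℓ : 0 ≤ ℓ := (norm_nonneg _).trans (hb ⟨0, hn⟩)
  exact (pow_le_pow_iff_left₀ (norm_nonneg _) (by positivity) two_ne_zero).1 hsq

end Cubes

/-! ### Muckenhoupt weights -/

section Weights

variable {n : ℕ} {ω : EuclideanSpace ℝ (Fin n) → ℝ}

/-- The mean as an integral with respect to a probability measure. -/
lemma meanOn_eq_lintegral (Q : Set (EuclideanSpace ℝ (Fin n)))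
    (u : EuclideanSpace ℝ (Fin n) → ℝ≥0∞) :
    meanOn Q u = ∫⁻ x, u x ∂((volume Q)⁻¹ • volume.restrict Q) := by
  rw [lintegral_smul_measure]; rfl

lemma meanOn_congr {Q : Set (EuclideanSpace ℝ (Fin n))}
    {u v : EuclideanSpace ℝ (Fin n) → ℝ≥0∞} (h : u =ᵐ[volume] v) : meanOn Q u = meanOn Q v := by
  unfold meanOn
  rw [lintegral_congr_ae (ae_restrict_of_ae h)]

lemma volume_mul_meanOn {a : EuclideanSpace ℝ (Fin n)} {ℓ : ℝ} (hℓ : 0 < ℓ)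
    (u : EuclideanSpace ℝ (Fin n) → ℝ≥0∞) :
    volume (axisCube a ℓ) * meanOn (axisCube a ℓ) u = ∫⁻ x in axisCube a ℓ, u x := by
  unfold meanOn
  rw [← mul_assoc, ENNReal.mul_inv_cancel (volume_axisCube_ne_zero a hℓ)
    (volume_axisCube_ne_top a hℓ), one_mul]

lemma meanOn_mul_le {p : ℝ} (hp : p ≠ 1) (ω : EuclideanSpace ℝ (Fin n) → ℝ)
    (a : EuclideanSpace ℝ (Fin n)) {ℓ : ℝ} (hℓ : 0 < ℓ) :
    meanOn (axisCube a ℓ) (fun x => ENNReal.ofReal (ω x)) *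
        meanOn (axisCube a ℓ) (fun x => ENNReal.ofReal (ω x) ^ (-(1 / (p - 1)))) ^ (p - 1) ≤
      muckenhouptConst p ω := by
  rw [muckenhouptConst, if_neg hp]
  exact le_iSup_of_le a (le_iSup_of_le ℓ (le_iSup_of_le hℓ le_rfl))

lemma meanOn_mul_essSup_le (ω : EuclideanSpace ℝ (Fin n) → ℝ)
    (a : EuclideanSpace ℝ (Fin n)) {ℓ : ℝ} (hℓ : 0 < ℓ) :
    meanOn (axisCube a ℓ) (fun x => ENNReal.ofReal (ω x)) *
        essSup (fun x => (ENNReal.ofReal (ω x))⁻¹) (volume.restrict (axisCube a ℓ)) ≤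
      muckenhouptConst 1 ω := by
  rw [muckenhouptConst, if_pos rfl]
  exact le_iSup_of_le a (le_iSup_of_le ℓ (le_iSup_of_le hℓ le_rfl))

lemma muckenhouptConst_le {p : ℝ} (hp : p ≠ 1) {K : ℝ≥0∞}
    (h : ∀ (a : EuclideanSpace ℝ (Fin n)) (ℓ : ℝ), 0 < ℓ →
      meanOn (axisCube a ℓ) (fun x => ENNReal.ofReal (ω x)) *
        meanOn (axisCube a ℓ) (fun x => ENNReal.ofReal (ω x) ^ (-(1 / (p - 1)))) ^ (p - 1) ≤ K) :
    muckenhouptConst p ω ≤ K := by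
  rw [muckenhouptConst, if_neg hp]
  exact iSup_le fun a => iSup_le fun ℓ => iSup_le fun hℓ => h a ℓ hℓ

lemma isProbabilityMeasure_cube (a : EuclideanSpace ℝ (Fin n)) {ℓ : ℝ} (hℓ : 0 < ℓ) :
    ((volume (axisCube a ℓ))⁻¹ • volume.restrict (axisCube a ℓ)) univ = 1 := by
  rw [Measure.smul_apply, Measure.restrict_apply_univ, smul_eq_mul,
    ENNReal.inv_mul_cancel (volume_axisCube_ne_zero a hℓ) (volume_axisCube_ne_top a hℓ)]

/-- The Muckenhoupt constants decrease in the exponent. -/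
lemma muckenhouptConst_anti (hω : AEMeasurable ω volume) {r p : ℝ} (hr : 1 ≤ r) (hrp : r < p) :
    muckenhouptConst p ω ≤ muckenhouptConst r ω := by
  have hp1 : 0 < p - 1 := by linarith
  refine muckenhouptConst_le (by linarith) fun a ℓ hℓ => ?_
  rcases hr.eq_or_lt with rfl | hr1
  · refine le_trans ?_ (meanOn_mul_essSup_le ω a hℓ)
    gcongr
    set S := essSup (fun x => (ENNReal.ofReal (ω x))⁻¹) (volume.restrict (axisCube a ℓ))
    have h1 : meanOn (axisCube a ℓ) (fun x => ENNReal.ofReal (ω x) ^ (-(1 / (p - 1)))) ≤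
        S ^ (1 / (p - 1)) := by
      unfold meanOn
      calc _ ≤ (volume (axisCube a ℓ))⁻¹ * ∫⁻ _x in axisCube a ℓ, S ^ (1 / (p - 1)) := by
            refine mul_le_mul_right (lintegral_mono_ae ?_) _
            filter_upwards [ENNReal.ae_le_essSup (μ := volume.restrict (axisCube a ℓ))
              (fun x => (ENNReal.ofReal (ω x))⁻¹)] with x hx
            rw [ENNReal.rpow_neg, ← ENNReal.inv_rpow]
            gcongr
        _ = S ^ (1 / (p - 1)) := by
            rw [setLIntegral_const, mul_left_comm, ENNReal.inv_mul_cancel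
              (volume_axisCube_ne_zero a hℓ) (volume_axisCube_ne_top a hℓ), mul_one]
    calc _ ≤ (S ^ (1 / (p - 1))) ^ (p - 1) := by gcongr
      _ = S := by rw [← ENNReal.rpow_mul, one_div_mul_cancel hp1.ne', ENNReal.rpow_one]
  · have hr0 : 0 < r - 1 := by linarith
    refine le_trans ?_ (meanOn_mul_le (by linarith) ω a hℓ)
    gcongr
    have hq : 1 ≤ (p - 1) / (r - 1) := by rw [one_le_div hr0]; linarith
    have hm : AEMeasurable (fun x => ENNReal.ofReal (ω x) ^ (-(1 / (p - 1))))
        ((volume (axisCube a ℓ))⁻¹ • volume.restrict (axisCube a ℓ)) :=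
      ((hω.ennreal_ofReal.pow_const _).restrict).smul_measure _
    have h := lintegral_rpow_le_mul_lintegral_rpow hm hq
    rw [isProbabilityMeasure_cube a hℓ, ENNReal.one_rpow, one_mul] at h
    simp only [← ENNReal.rpow_mul] at h
    rw [meanOn_eq_lintegral, meanOn_eq_lintegral]
    have e : -(1 / (p - 1)) * ((p - 1) / (r - 1)) = -(1 / (r - 1)) := by field_simp
    rw [e] at h
    calc _ = ((∫⁻ x, ENNReal.ofReal (ω x) ^ (-(1 / (p - 1)))
          ∂((volume (axisCube a ℓ))⁻¹ • volume.restrict (axisCube a ℓ))) ^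
            ((p - 1) / (r - 1))) ^ (r - 1) := by
          rw [← ENNReal.rpow_mul, div_mul_cancel₀ _ hr0.ne']
      _ ≤ _ := by gcongr

lemma IsMuckenhoupt.mono {r p : ℝ} (h : IsMuckenhoupt r ω) (hr : 1 ≤ r) (hrp : r < p) :
    IsMuckenhoupt p ω :=
  ⟨h.nonneg, h.locallyIntegrable, (muckenhouptConst_anti
    h.locallyIntegrable.aestronglyMeasurable.aemeasurable hr hrp).trans_lt h.const_lt_top⟩

/-- The zero weight lies in every class, by the convention `0 * ∞ = 0`. -/
lemma isMuckenhoupt_of_ae_eq_zero {p r : ℝ} (h : IsMuckenhoupt p ω)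
    (h0 : (fun x => ENNReal.ofReal (ω x)) =ᵐ[volume] 0) (hr : r ≠ 1) : IsMuckenhoupt r ω := by
  refine ⟨h.nonneg, h.locallyIntegrable, lt_of_le_of_lt ?_ ENNReal.zero_lt_top⟩
  refine muckenhouptConst_le hr fun a ℓ hℓ => ?_
  rw [meanOn_congr h0]
  simp [meanOn]

/-- A Muckenhoupt weight that vanishes on a set of positive measure vanishes almost everywhere;
otherwise it has a representative with values in `(0, ∞)`. -/
lemma IsMuckenhoupt.ae_eq_zero_or_exists {p : ℝ} (h : IsMuckenhoupt p ω) (hp : 1 ≤ p) :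
    (fun x => ENNReal.ofReal (ω x)) =ᵐ[volume] 0 ∨
    ∃ w : EuclideanSpace ℝ (Fin n) → ℝ≥0∞, Measurable w ∧ (∀ x, w x ≠ 0) ∧ (∀ x, w x ≠ ∞) ∧
      (fun x => ENNReal.ofReal (ω x)) =ᵐ[volume] w := by
  classical
  have hm : AEMeasurable (fun x => ENNReal.ofReal (ω x)) volume :=
    h.locallyIntegrable.aestronglyMeasurable.aemeasurable.ennreal_ofReal
  set w₀ := hm.mk _ with hw₀
  have hw₀m : Measurable w₀ := hm.measurable_mk
  have hwt : ∀ᵐ x, w₀ x ≠ ∞ := by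
    filter_upwards [hm.ae_eq_mk] with x hx
    rw [hw₀, ← hx]; exact ENNReal.ofReal_ne_top
  by_cases hz : ∀ᵐ x, w₀ x ≠ 0
  · right
    refine ⟨fun x => if w₀ x = 0 ∨ w₀ x = ∞ then 1 else w₀ x, ?_, ?_, ?_, ?_⟩
    · refine Measurable.ite ?_ measurable_const hw₀m
      exact (hw₀m (measurableSet_singleton 0)).union (hw₀m (measurableSet_singleton ∞))
    · intro x; dsimp only; split_ifs with hx
      · simp
      · exact fun h => hx (Or.inl h)
    · intro x; dsimp only; split_ifs with hx
      · simp
      · exact fun h => hx (Or.inr h)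
    · filter_upwards [hz, hwt, hm.ae_eq_mk] with x h1 h2 h3
      rw [if_neg (by tauto), h3]
  · left
    set Z := {x | w₀ x = 0} with hZ
    have hZm : MeasurableSet Z := hw₀m (measurableSet_singleton 0)
    have hZ0 : volume Z ≠ 0 := by
      intro h0
      refine hz ?_
      rw [ae_iff]
      simpa using h0
    set Q : ℕ → Set (EuclideanSpace ℝ (Fin n)) := fun N =>
      axisCube (cubeCorner 0 ((N : ℝ) + 1)) (2 * ((N : ℝ) + 1)) with hQ
    have hQU : ⋃ N, Q N = univ := by
      refine eq_univ_of_forall fun x => ?_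
      obtain ⟨N, hN⟩ := exists_nat_ge ‖x‖
      refine mem_iUnion.2 ⟨N, closedBall_subset_axisCube _ _ ?_⟩
      rw [mem_closedBall_zero_iff]
      linarith
    have hQmono : Monotone Q := by
      intro M N hMN x hx i
      have h1 := hx i
      have h2 : (M : ℝ) ≤ N := by exact_mod_cast hMN
      simp only [cubeCorner, PiLp.zero_apply, mem_Icc] at h1 ⊢
      constructor <;> linarith [h1.1, h1.2]
    obtain ⟨N₀, hN₀⟩ : ∃ N, volume (Z ∩ Q N) ≠ 0 := by
      by_contra! hcon
      refine hZ0 ?_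
      rw [← inter_univ Z, ← hQU, inter_iUnion]
      exact measure_iUnion_null hcon
    have hkey : ∀ N, N₀ ≤ N → ∀ᵐ x ∂(volume.restrict (Q N)), w₀ x = 0 := by
      intro N hN
      have hℓ : (0 : ℝ) < 2 * ((N : ℝ) + 1) := by positivity
      have hpos : volume (Z ∩ Q N) ≠ 0 := fun h0 =>
        hN₀ (measure_mono_null (inter_subset_inter_right _ (hQmono hN)) h0)
      have hmean : meanOn (Q N) (fun x => ENNReal.ofReal (ω x)) = 0 := by
        by_contra hne
        rcases hp.eq_or_lt with rfl | hp1
        · have h1 := meanOn_mul_essSup_le ω (cubeCorner 0 ((N : ℝ) + 1)) hℓ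
          have h2 : essSup (fun x => (ENNReal.ofReal (ω x))⁻¹) (volume.restrict (Q N)) = ∞ := by
            by_contra hS
            have h3 := ENNReal.ae_le_essSup (μ := volume.restrict (Q N))
              (fun x => (ENNReal.ofReal (ω x))⁻¹)
            have h4 : ∀ᵐ x ∂(volume.restrict (Q N)), x ∉ Z := by
              filter_upwards [h3, ae_restrict_of_ae hm.ae_eq_mk] with x hx hx2 hxZ
              have hx3 : w₀ x = 0 := hxZ
              rw [hx2, ← hw₀, hx3, ENNReal.inv_zero] at hx
              exact hS (top_le_iff.1 hx)
            rw [ae_iff] at h4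
            simp only [not_not] at h4
            refine hpos ?_
            rw [Measure.restrict_apply' (measurableSet_axisCube _ _)] at h4
            exact h4
          rw [h2, ENNReal.mul_top hne] at h1
          exact absurd h.const_lt_top (not_lt.2 h1)
        · have hp0 : 0 < p - 1 := by linarith
          have h1 := meanOn_mul_le hp1.ne' ω (cubeCorner 0 ((N : ℝ) + 1)) hℓ
          have h2 : meanOn (Q N) (fun x => ENNReal.ofReal (ω x) ^ (-(1 / (p - 1)))) = ∞ := by
            have h3 : ∫⁻ x in Q N, ENNReal.ofReal (ω x) ^ (-(1 / (p - 1))) = ∞ := by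
              rw [← top_le_iff]
              calc ∞ = ∫⁻ _x in Z ∩ Q N, ∞ := by
                    rw [setLIntegral_const, ENNReal.top_mul hpos]
                _ = ∫⁻ x in Z ∩ Q N, ENNReal.ofReal (ω x) ^ (-(1 / (p - 1))) := by
                    refine setLIntegral_congr_fun_ae
                      (hZm.inter (measurableSet_axisCube _ _)) ?_
                    filter_upwards [hm.ae_eq_mk] with x hx hxZ
                    have hx3 : w₀ x = 0 := hxZ.1
                    rw [hx, ← hw₀, hx3, ENNReal.zero_rpow_of_neg]
                    simpa using hp0
                _ ≤ _ := lintegral_mono_set inter_subset_right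
            unfold meanOn
            rw [h3, ENNReal.mul_top]
            exact ENNReal.inv_ne_zero.2 (volume_axisCube_ne_top _ hℓ)
          rw [h2, ENNReal.top_rpow_of_pos hp0, ENNReal.mul_top hne] at h1
          exact absurd h.const_lt_top (not_lt.2 h1)
      have h5 : ∫⁻ x in Q N, w₀ x = 0 := by
        rw [← lintegral_congr_ae (ae_restrict_of_ae hm.ae_eq_mk), ← volume_mul_meanOn hℓ, hmean,
          mul_zero]
      exact (lintegral_eq_zero_iff hw₀m).1 h5
    have hall : ∀ᵐ x, ∀ N, N₀ ≤ N → x ∈ Q N → w₀ x = 0 := by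
      rw [ae_all_iff]
      intro N
      by_cases hN : N₀ ≤ N
      · filter_upwards [(ae_restrict_iff' (measurableSet_axisCube _ _)).1 (hkey N hN)] with x hx _
        exact hx
      · exact Filter.Eventually.of_forall fun x h => absurd h hN
    filter_upwards [hall, hm.ae_eq_mk] with x hx hx2
    have hxU : x ∈ ⋃ N, Q N := by rw [hQU]; trivial
    obtain ⟨N, hN⟩ := mem_iUnion.1 hxU
    rw [hx2]
    exact hx (max N₀ N) (le_max_left _ _) (hQmono (le_max_right _ _) hN)

/-- The Muckenhoupt condition for `p > 1` in terms of integrals over cubes. -/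
lemma IsMuckenhoupt.lintegral_cube_mul_le {p : ℝ} (h : IsMuckenhoupt p ω) (hp : 1 < p)
    {w : EuclideanSpace ℝ (Fin n) → ℝ≥0∞} (hw0 : ∀ x, w x ≠ 0) (hw : Measurable w)
    (hww : (fun x => ENNReal.ofReal (ω x)) =ᵐ[volume] w)
    (a : EuclideanSpace ℝ (Fin n)) {ℓ : ℝ} (hℓ : 0 < ℓ) :
    ∫⁻ y in axisCube a ℓ, w y ≠ ∞ ∧
    ∫⁻ y in axisCube a ℓ, w y ^ (-(1 / (p - 1))) ≠ ∞ ∧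
      (∫⁻ y in axisCube a ℓ, w y) *
        (∫⁻ y in axisCube a ℓ, w y ^ (-(1 / (p - 1)))) ^ (p - 1) ≤
          muckenhouptConst p ω * volume (axisCube a ℓ) ^ p := by
  have hp0 : 0 < p - 1 := by linarith
  have h1 := meanOn_mul_le hp.ne' ω a hℓ
  have hσ : (fun x => ENNReal.ofReal (ω x) ^ (-(1 / (p - 1)))) =ᵐ[volume]
      fun x => w x ^ (-(1 / (p - 1))) := by
    filter_upwards [hww] with x hx
    rw [hx]
  rw [meanOn_congr hww, meanOn_congr hσ] at h1
  set V := volume (axisCube a ℓ) with hV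
  have hV0 : V ≠ 0 := volume_axisCube_ne_zero a hℓ
  have hVt : V ≠ ∞ := volume_axisCube_ne_top a hℓ
  have hVp : V ^ p = V ^ (p - 1) * V := by
    conv_lhs => rw [← sub_add_cancel p 1,
      ENNReal.rpow_add_of_nonneg _ _ hp0.le zero_le_one, ENNReal.rpow_one]
  have hmain : (∫⁻ y in axisCube a ℓ, w y) *
        (∫⁻ y in axisCube a ℓ, w y ^ (-(1 / (p - 1)))) ^ (p - 1) ≤
          muckenhouptConst p ω * V ^ p := by
    rw [← volume_mul_meanOn hℓ, ← volume_mul_meanOn hℓ, ENNReal.mul_rpow_of_nonneg _ _ hp0.le]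
    calc _ = (meanOn (axisCube a ℓ) w * meanOn (axisCube a ℓ) (fun x => w x ^ (-(1 / (p - 1)))) ^
          (p - 1)) * (V ^ (p - 1) * V) := by ring
      _ ≤ muckenhouptConst p ω * (V ^ (p - 1) * V) := by gcongr
      _ = _ := by rw [hVp]
  have hKt : muckenhouptConst p ω * V ^ p ≠ ∞ :=
    ENNReal.mul_ne_top h.const_lt_top.ne (ENNReal.rpow_ne_top_of_nonneg (by linarith) hVt)
  have hcompact : IsCompact (axisCube a ℓ) := by
    have : axisCube a ℓ = (EuclideanSpace.equiv (Fin n) ℝ).toHomeomorph ⁻¹'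
      (univ.pi fun i => Icc (a i) (a i + ℓ)) := axisCube_eq_preimage a ℓ
    rw [this, Homeomorph.isCompact_preimage]
    exact isCompact_univ_pi fun i => isCompact_Icc
  have hWt : ∫⁻ y in axisCube a ℓ, w y ≠ ∞ := by
    rw [← lintegral_congr_ae (ae_restrict_of_ae hww)]
    exact (h.locallyIntegrable.integrableOn_isCompact hcompact).lintegral_lt_top.ne
  have hW0 : ∫⁻ y in axisCube a ℓ, w y ≠ 0 := by
    refine ((setLIntegral_pos_iff hw).2 ?_).ne'
    have : Function.support w = univ := by ext y; simp [hw0 y]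
    rw [this, univ_inter]
    exact pos_iff_ne_zero.2 hV0
  refine ⟨hWt, fun hS => ?_, hmain⟩
  rw [hS, ENNReal.top_rpow_of_pos hp0, ENNReal.mul_top hW0, top_le_iff] at hmain
  exact hKt hmain

/-- The ratio of the volume of a cube to the volume of its inscribed ball. -/
noncomputable def cubeBallRatio (n : ℕ) : ℝ≥0∞ :=
  2 ^ n * (volume (Metric.ball (0 : EuclideanSpace ℝ (Fin n)) 1))⁻¹

lemma cubeBallRatio_ne_top (n : ℕ) : cubeBallRatio n ≠ ∞ :=
  ENNReal.mul_ne_top (by finiteness)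
    (ENNReal.inv_ne_top.2 (Metric.measure_ball_pos volume _ one_pos).ne')

/-- The volume of a cube does not depend on its corner, so `a` and `x` are unrelated. -/
lemma volume_axisCube_eq_ratio (a x : EuclideanSpace ℝ (Fin n)) {r : ℝ} (hr : 0 < r) :
    volume (axisCube a (2 * r)) = cubeBallRatio n * volume (Metric.closedBall x r) := by
  rw [volume_axisCube _ (by positivity), volume_closedBall_eq _ hr.le, cubeBallRatio, mul_assoc,
    mul_left_comm (_⁻¹), ENNReal.inv_mul_cancel (Metric.measure_ball_pos volume _ one_pos).ne'
      measure_ball_lt_top.ne, mul_one, mul_pow, ENNReal.ofReal_mul (by positivity),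
    ENNReal.ofReal_pow (by norm_num)]
  norm_num

/-- The Muckenhoupt condition on balls follows from the one on the circumscribed cubes. -/
lemma IsMuckenhoupt.lintegral_closedBall_mul_le {p : ℝ} (h : IsMuckenhoupt p ω) (hp : 1 < p)
    {w : EuclideanSpace ℝ (Fin n) → ℝ≥0∞} (hw0 : ∀ x, w x ≠ 0) (hw : Measurable w)
    (hww : (fun x => ENNReal.ofReal (ω x)) =ᵐ[volume] w)
    (x : EuclideanSpace ℝ (Fin n)) {r : ℝ} (hr : 0 < r) :
    ∫⁻ y in Metric.closedBall x r, w y ≠ ∞ ∧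
    ∫⁻ y in Metric.closedBall x r, w y ^ (-(1 / (p - 1))) ≠ ∞ ∧
      (∫⁻ y in Metric.closedBall x r, w y) *
        (∫⁻ y in Metric.closedBall x r, w y ^ (-(1 / (p - 1)))) ^ (p - 1) ≤
          cubeBallRatio n ^ p * muckenhouptConst p ω * volume (Metric.closedBall x r) ^ p := by
  have hp0 : 0 < p - 1 := by linarith
  obtain ⟨h1, h2, h3⟩ := h.lintegral_cube_mul_le hp hw0 hw hww (cubeCorner x r)
    (ℓ := 2 * r) (by positivity)
  have hsub := closedBall_subset_axisCube x r
  refine ⟨ne_top_of_le_ne_top h1 (lintegral_mono_set hsub),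
    ne_top_of_le_ne_top h2 (lintegral_mono_set hsub), ?_⟩
  rw [volume_axisCube_eq_ratio _ x hr, ENNReal.mul_rpow_of_nonneg _ _ (by linarith)] at h3
  calc _ ≤ _ := by
        refine mul_le_mul' (lintegral_mono_set hsub)
          (ENNReal.rpow_le_rpow (lintegral_mono_set hsub) hp0.le)
    _ ≤ _ := h3
    _ = _ := by ring

/-- The `A_1` condition: averages over a cube are bounded by the values in the cube. -/
lemma ae_lintegral_cube_le_muckenhouptConst_one
    {w : EuclideanSpace ℝ (Fin n) → ℝ≥0∞} (hw0 : ∀ x, w x ≠ 0) (hwt : ∀ x, w x ≠ ∞)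
    (hww : (fun x => ENNReal.ofReal (ω x)) =ᵐ[volume] w)
    (a : EuclideanSpace ℝ (Fin n)) {ℓ : ℝ} (hℓ : 0 < ℓ) :
    ∀ᵐ z ∂(volume.restrict (axisCube a ℓ)),
      ∫⁻ y in axisCube a ℓ, w y ≤ muckenhouptConst 1 ω * volume (axisCube a ℓ) * w z := by
  have h1 := meanOn_mul_essSup_le ω a hℓ
  filter_upwards [ENNReal.ae_le_essSup (μ := volume.restrict (axisCube a ℓ))
    (fun x => (ENNReal.ofReal (ω x))⁻¹), ae_restrict_of_ae hww] with z hz hz2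
  rw [hz2] at hz
  rw [lintegral_congr_ae (ae_restrict_of_ae hww.symm), ← volume_mul_meanOn hℓ]
  set A := meanOn (axisCube a ℓ) (fun x => ENNReal.ofReal (ω x))
  calc volume (axisCube a ℓ) * A = volume (axisCube a ℓ) * (A * (w z)⁻¹) * w z := by
        rw [mul_assoc, mul_assoc, ENNReal.inv_mul_cancel (hw0 z) (hwt z), mul_one]
    _ ≤ volume (axisCube a ℓ) * muckenhouptConst 1 ω * w z := by
        gcongr
        exact (mul_le_mul_right hz _).trans h1
    _ = _ := by ring

lemma ae_lintegral_closedBall_le_muckenhouptConst_one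
    {w : EuclideanSpace ℝ (Fin n) → ℝ≥0∞} (hw0 : ∀ x, w x ≠ 0) (hwt : ∀ x, w x ≠ ∞)
    (hww : (fun x => ENNReal.ofReal (ω x)) =ᵐ[volume] w)
    (x : EuclideanSpace ℝ (Fin n)) {r : ℝ} (hr : 0 < r) :
    ∀ᵐ z ∂(volume.restrict (Metric.closedBall x r)),
      ∫⁻ y in Metric.closedBall x r, w y ≤
        cubeBallRatio n * muckenhouptConst 1 ω * volume (Metric.closedBall x r) * w z := by
  have h1 := ae_lintegral_cube_le_muckenhouptConst_one hw0 hwt hww (cubeCorner x r)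
    (ℓ := 2 * r) (by positivity)
  have hsub := closedBall_subset_axisCube x r
  filter_upwards [ae_restrict_of_ae_restrict_of_subset hsub h1] with z hz
  refine (lintegral_mono_set hsub).trans (hz.trans_eq ?_)
  rw [volume_axisCube_eq_ratio _ x hr]
  ring

/-- For `A_1` weights the means at a fixed scale are bounded by the weight almost everywhere. -/
lemma ae_unitBallMean_le_muckenhouptConst_one
    {w : EuclideanSpace ℝ (Fin n) → ℝ≥0∞} (hw0 : ∀ x, w x ≠ 0) (hwt : ∀ x, w x ≠ ∞)
    (hww : (fun x => ENNReal.ofReal (ω x)) =ᵐ[volume] w) {τ : ℝ} (hτ : 0 < τ) :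
    ∀ᵐ z, unitBallMean w z τ ≤ 4 ^ n * muckenhouptConst 1 ω * w z := by
  set D := TopologicalSpace.denseSeq (EuclideanSpace ℝ (Fin n))
  have h1 : ∀ᵐ z, ∀ i : ℕ, z ∈ axisCube (cubeCorner (D i) (2 * τ)) (2 * (2 * τ)) →
      ∫⁻ y in axisCube (cubeCorner (D i) (2 * τ)) (2 * (2 * τ)), w y ≤ muckenhouptConst 1 ω *
        volume (axisCube (cubeCorner (D i) (2 * τ)) (2 * (2 * τ))) * w z := by
    rw [ae_all_iff]
    intro i
    exact (ae_restrict_iff' (measurableSet_axisCube _ _)).1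
      (ae_lintegral_cube_le_muckenhouptConst_one hw0 hwt hww _ (by positivity))
  filter_upwards [h1] with z hz
  obtain ⟨i, hi⟩ := (TopologicalSpace.denseRange_denseSeq (EuclideanSpace ℝ (Fin n))).exists_dist_lt
    z hτ
  have hsub : Metric.ball z τ ⊆ axisCube (cubeCorner (D i) (2 * τ)) (2 * (2 * τ)) := by
    refine subset_trans ?_ (closedBall_subset_axisCube (D i) (2 * τ))
    refine Metric.ball_subset_closedBall.trans (Metric.closedBall_subset_closedBall' ?_)
    linarith
  have h2 := hz i (hsub (Metric.mem_ball_self hτ))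
  rw [unitBallMean_eq _ _ hτ]
  calc _ ≤ ENNReal.ofReal ((τ ^ n)⁻¹) * (muckenhouptConst 1 ω *
        volume (axisCube (cubeCorner (D i) (2 * τ)) (2 * (2 * τ))) * w z) := by
        gcongr
        exact (lintegral_mono_set hsub).trans h2
    _ = (ENNReal.ofReal ((τ ^ n)⁻¹) * ENNReal.ofReal ((2 * (2 * τ)) ^ n)) *
        muckenhouptConst 1 ω * w z := by
        rw [volume_axisCube _ (by positivity)]
        ring
    _ = _ := by
        rw [← ENNReal.ofReal_mul (by positivity)]
        have : (τ ^ n)⁻¹ * (2 * (2 * τ)) ^ n = 4 ^ n := by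
          rw [← mul_assoc, mul_pow]
          field_simp
          norm_num
        rw [this, ENNReal.ofReal_pow (by norm_num)]
        norm_num

end Weights

/-! ### Self-improvement of integrability -/

section Gehring

variable {α : Type*} [MeasurableSpace α]

lemma measurable_indicator_rpow {h : α → ℝ≥0∞} (hh : Measurable h) (t : ℝ) :
    Measurable fun z : α × ℝ => {s : ℝ | ENNReal.ofReal s < h z.1}.indicator
      (fun s => ENNReal.ofReal (s ^ t)) z.2 := by
  have : MeasurableSet {z : α × ℝ | ENNReal.ofReal z.2 < h z.1} :=
    measurableSet_lt (by fun_prop) (by fun_prop)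
  exact Measurable.indicator (f := fun z : α × ℝ => ENNReal.ofReal (z.2 ^ t))
    (by fun_prop) this

/-- Layer cake formula for `∫ F h^t`. -/
lemma lintegral_mul_rpow_eq_layercake {μ : Measure α} [SFinite μ] {F h : α → ℝ≥0∞}
    (hF : Measurable F) (hh : Measurable h) {t : ℝ} (ht : 0 < t) :
    ∫⁻ x, F x * h x ^ t ∂μ = ENNReal.ofReal t * ∫⁻ s in Ioi (0 : ℝ),
      ENNReal.ofReal (s ^ (t - 1)) * ∫⁻ x, {x | ENNReal.ofReal s < h x}.indicator F x ∂μ := by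
  have hpow : ∀ a : ℝ≥0∞, a ^ t = ENNReal.ofReal t * ∫⁻ s in Ioi (0 : ℝ),
      {s : ℝ | ENNReal.ofReal s < a}.indicator (fun s => ENNReal.ofReal (s ^ (t - 1))) s := by
    intro a
    rw [lintegral_Ioi_indicator_rpow ht, ← mul_assoc, ← ENNReal.ofReal_mul ht.le,
      mul_inv_cancel₀ ht.ne', ENNReal.ofReal_one, one_mul]
  have hm := measurable_indicator_rpow hh (t - 1)
  have hm2 : Measurable fun z : α × ℝ => F z.1 * {s : ℝ | ENNReal.ofReal s < h z.1}.indicator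
      (fun s => ENNReal.ofReal (s ^ (t - 1))) z.2 := (by fun_prop : Measurable _).mul hm
  calc ∫⁻ x, F x * h x ^ t ∂μ = ENNReal.ofReal t * ∫⁻ x, (∫⁻ s in Ioi (0 : ℝ),
          F x * {s : ℝ | ENNReal.ofReal s < h x}.indicator
            (fun s => ENNReal.ofReal (s ^ (t - 1))) s) ∂μ := by
        rw [← lintegral_const_mul' _ _ (by finiteness)]
        refine lintegral_congr fun x => ?_
        have hmx : Measurable ({s : ℝ | ENNReal.ofReal s < h x}.indicator
            (fun s => ENNReal.ofReal (s ^ (t - 1)))) := hm.comp measurable_prodMk_left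
        rw [hpow, lintegral_const_mul _ hmx, mul_left_comm]
    _ = _ := by
        rw [lintegral_lintegral_swap hm2.aemeasurable]
        congr 1
        refine lintegral_congr fun s => ?_
        rw [← lintegral_const_mul' _ _ (by finiteness)]
        refine lintegral_congr fun x => ?_
        by_cases hx : ENNReal.ofReal s < h x <;> simp [indicator, hx, mul_comm]

/-- Gehring's self-improvement of integrability: if above the height `l` the integral of `σ` over
each superlevel set is controlled by the measure of a slightly larger superlevel set, then `σ` is
integrable to a power `1 + δ`. -/
lemma lintegral_rpow_one_add_le_of_superlevel {μ : Measure α} [IsFiniteMeasure μ]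
    {σ : α → ℝ≥0∞} (hσ : Measurable σ) {A d l : ℝ≥0∞} {δ : ℝ} (hd : 1 ≤ d)
    (hδ : 0 < δ) (hδ1 : δ ≤ 1) (hA : ENNReal.ofReal δ * A * d ^ (2 : ℝ) ≤ 2⁻¹)
    (hlev : ∀ s : ℝ, 0 < s → l ≤ ENNReal.ofReal s →
      ∫⁻ x, {x | ENNReal.ofReal s < σ x}.indicator σ x ∂μ ≤
        A * ENNReal.ofReal s * μ {x | ENNReal.ofReal s < d * σ x}) :
    ∫⁻ x, σ x ^ (1 + δ) ∂μ ≤ 2 * (l ^ δ * ∫⁻ x, σ x ∂μ) := by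
  -- `σ` is truncated at height `m`, so that the integral to be absorbed is finite
  have htr : ∀ m : ℕ, ∫⁻ x, (min (σ x) m) ^ (1 + δ) ∂μ ≤ 2 * (l ^ δ * ∫⁻ x, σ x ∂μ) := by
    intro m
    set τ : α → ℝ≥0∞ := fun x => min (σ x) m with hτ
    have hτm : Measurable τ := by fun_prop
    have hτσ : ∀ x, τ x ≤ σ x := fun x => min_le_left _ _
    set X := ∫⁻ x, τ x ^ (1 + δ) ∂μ with hX
    have hXt : X ≠ ∞ := by
      refine ne_top_of_le_ne_top ?_ (lintegral_mono (g := fun _ => (m : ℝ≥0∞) ^ (1 + δ))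
        fun x => ENNReal.rpow_le_rpow (min_le_right _ _) (by positivity))
      rw [lintegral_const]
      exact ENNReal.mul_ne_top (by finiteness) (measure_ne_top _ _)
    have hXY : X ≤ ∫⁻ x, σ x * τ x ^ δ ∂μ := by
      refine lintegral_mono fun x => ?_
      dsimp only
      rw [ENNReal.rpow_add_of_nonneg _ _ zero_le_one hδ.le, ENNReal.rpow_one]
      exact mul_le_mul_left (hτσ x) _
    have hs : ∀ s : ℝ, 0 < s → ∫⁻ x, {x | ENNReal.ofReal s < τ x}.indicator σ x ∂μ ≤
        {s : ℝ | ENNReal.ofReal s < l}.indicator (fun _ => ∫⁻ x, σ x ∂μ) s +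
          A * ENNReal.ofReal s * μ {x | ENNReal.ofReal s < d * τ x} := by
      intro s hs
      by_cases hl : ENNReal.ofReal s < l
      · rw [indicator_of_mem (by exact hl)]
        exact le_add_right (lintegral_mono fun x => indicator_le_self _ _ _)
      · rw [indicator_of_notMem (by exact hl), zero_add]
        by_cases hm : ENNReal.ofReal s < m
        · have e1 : {x | ENNReal.ofReal s < τ x} = {x | ENNReal.ofReal s < σ x} := by
            ext x; simp [hτ, hm]
          have e2 : {x | ENNReal.ofReal s < d * τ x} = {x | ENNReal.ofReal s < d * σ x} := by
            ext x
            simp only [hτ, mem_ofPred_eq]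
            refine ⟨fun h => h.trans_le (mul_le_mul_right (hτσ x) _), fun h => ?_⟩
            rcases min_choice (σ x) (m : ℝ≥0∞) with h1 | h1
            · rwa [h1]
            · rw [h1]
              exact hm.trans_le (le_mul_of_one_le_left zero_le hd)
          rw [e1, e2]
          exact hlev s hs (not_lt.1 hl)
        · have e1 : {x | ENNReal.ofReal s < τ x} = ∅ := by
            ext x; simp [hτ, hm]
          rw [e1]; simp
    have hone := lintegral_mul_rpow_eq_layercake (μ := μ) (measurable_const (a := (1 : ℝ≥0∞)))
      (hτm.const_mul d) (t := 1 + δ) (by positivity)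
    simp only [one_mul, add_sub_cancel_left] at hone
    have hmeasd : Measurable fun s : ℝ => μ {x | ENNReal.ofReal s < d * τ x} := by
      have : MeasurableSet {z : ℝ × α | ENNReal.ofReal z.1 < d * τ z.2} :=
        measurableSet_lt (by fun_prop) (by fun_prop)
      exact measurable_measure_prodMk_left this
    have hmain : ∫⁻ x, σ x * τ x ^ δ ∂μ ≤ l ^ δ * ∫⁻ x, σ x ∂μ + 2⁻¹ * X := by
      rw [lintegral_mul_rpow_eq_layercake hσ hτm hδ]
      calc _ ≤ ENNReal.ofReal δ * ∫⁻ s in Ioi (0 : ℝ), ({s : ℝ | ENNReal.ofReal s < l}.indicator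
              (fun s => ENNReal.ofReal (s ^ (δ - 1))) s * ∫⁻ x, σ x ∂μ +
            A * (ENNReal.ofReal (s ^ δ) * μ {x | ENNReal.ofReal s < d * τ x})) := by
            refine mul_le_mul_right (setLIntegral_mono' measurableSet_Ioi fun s hs0 => ?_) _
            have hs0' : 0 < s := hs0
            refine (mul_le_mul_right (hs s hs0) _).trans_eq ?_
            rw [mul_add]
            congr 1
            · by_cases hl : ENNReal.ofReal s < l <;> simp [indicator, hl]
            · have e : s ^ δ = s ^ (δ - 1) * s := by
                rw [Real.rpow_sub_one hs0'.ne', div_mul_cancel₀ _ hs0'.ne']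
              rw [e, ENNReal.ofReal_mul (by positivity)]
              ring
        _ = ENNReal.ofReal δ * (ENNReal.ofReal δ⁻¹ * l ^ δ * ∫⁻ x, σ x ∂μ +
            A * ∫⁻ s in Ioi (0 : ℝ),
              (ENNReal.ofReal (s ^ δ) * μ {x | ENNReal.ofReal s < d * τ x})) := by
            have hm1 : Measurable ({s : ℝ | ENNReal.ofReal s < l}.indicator
              (fun s => ENNReal.ofReal (s ^ (δ - 1)))) :=
              Measurable.indicator (by fun_prop) (measurableSet_lt (by fun_prop) measurable_const)
            have hm2 : Measurable fun s : ℝ =>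
                ENNReal.ofReal (s ^ δ) * μ {x | ENNReal.ofReal s < d * τ x} :=
              (by fun_prop : Measurable fun s : ℝ => ENNReal.ofReal (s ^ δ)).mul hmeasd
            rw [lintegral_add_left (hm1.mul_const _), lintegral_mul_const _ hm1,
              lintegral_Ioi_indicator_rpow hδ, lintegral_const_mul _ hm2]
        _ = l ^ δ * ∫⁻ x, σ x ∂μ + ENNReal.ofReal δ * A * ∫⁻ s in Ioi (0 : ℝ),
              (ENNReal.ofReal (s ^ δ) * μ {x | ENNReal.ofReal s < d * τ x}) := by
            rw [mul_add, ← mul_assoc, ← mul_assoc, ← mul_assoc, ← ENNReal.ofReal_mul hδ.le,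
              mul_inv_cancel₀ hδ.ne', ENNReal.ofReal_one, one_mul]
        _ ≤ l ^ δ * ∫⁻ x, σ x ∂μ + ENNReal.ofReal δ * A * (d ^ (2 : ℝ) * X) := by
            gcongr
            calc _ ≤ ENNReal.ofReal (1 + δ) * ∫⁻ s in Ioi (0 : ℝ),
                    (ENNReal.ofReal (s ^ δ) * μ {x | ENNReal.ofReal s < d * τ x}) := by
                  refine le_mul_of_one_le_left zero_le ?_
                  rw [← ENNReal.ofReal_one]
                  exact ENNReal.ofReal_le_ofReal (by linarith)
              _ = ∫⁻ x, (d * τ x) ^ (1 + δ) ∂μ := by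
                  rw [hone]
                  congr 1
                  refine lintegral_congr fun s => ?_
                  have hm : MeasurableSet {x | ENNReal.ofReal s < d * τ x} :=
                    measurableSet_lt measurable_const (by fun_prop)
                  rw [lintegral_indicator hm, setLIntegral_const, one_mul]
              _ = d ^ (1 + δ) * X := by
                  rw [hX, ← lintegral_const_mul _ (by fun_prop)]
                  exact lintegral_congr fun x => ENNReal.mul_rpow_of_nonneg _ _ (by positivity)
              _ ≤ d ^ (2 : ℝ) * X := by
                  gcongr
                  linarith
        _ ≤ _ := by
            rw [← mul_assoc]
            gcongr
    have hfin := hXY.trans hmain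
    -- absorb the truncated integral, which is finite
    have h2 : 2 * X ≤ 2 * (l ^ δ * ∫⁻ x, σ x ∂μ) + X := by
      calc 2 * X ≤ 2 * (l ^ δ * ∫⁻ x, σ x ∂μ + 2⁻¹ * X) := by gcongr
        _ = _ := by
          rw [mul_add, ← mul_assoc 2 2⁻¹, ENNReal.mul_inv_cancel two_ne_zero (by simp), one_mul]
    rw [two_mul X] at h2
    exact (ENNReal.add_le_add_iff_right hXt).1 h2
  have hsup : ∀ x, σ x ^ (1 + δ) = ⨆ m : ℕ, (min (σ x) m) ^ (1 + δ) := by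
    intro x
    have h1 : σ x = ⨆ m : ℕ, min (σ x) m := by
      refine le_antisymm (le_of_forall_lt fun c hc => ?_) (iSup_le fun m => min_le_left _ _)
      obtain ⟨m, hm⟩ := ENNReal.exists_nat_gt hc.ne_top
      exact (lt_min hc hm).trans_le (le_iSup (fun m : ℕ => min (σ x) (m : ℝ≥0∞)) m)
    conv_lhs => rw [h1]
    exact (ENNReal.orderIsoRpow (1 + δ) (by positivity)).map_iSup _
  calc _ = ∫⁻ x, ⨆ m : ℕ, (min (σ x) m) ^ (1 + δ) ∂μ := lintegral_congr hsup
    _ = ⨆ m : ℕ, ∫⁻ x, (min (σ x) m) ^ (1 + δ) ∂μ := by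
        refine lintegral_iSup (fun m => by fun_prop) fun a b hab x => ?_
        refine ENNReal.rpow_le_rpow (min_le_min_left _ ?_) (by positivity)
        exact_mod_cast hab
    _ ≤ _ := iSup_le htr

end Gehring

/-! ### Open-endedness of the Muckenhoupt classes -/

section ReverseHolder

variable {n : ℕ}

/-- A ball centred in a cube and of radius at most the edge length meets the cube in a set that
contains a cube of comparable size. -/
lemma exists_axisCube_subset_inter (hn : 1 ≤ n) {a x : EuclideanSpace ℝ (Fin n)} {ℓ r : ℝ}
    (hx : x ∈ axisCube a ℓ) (hr : 0 ≤ r) (hrℓ : r ≤ ℓ) :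
    ∃ b, axisCube b (r / n) ⊆ Metric.closedBall x r ∩ axisCube a ℓ := by
  have hn1 : (1 : ℝ) ≤ n := by exact_mod_cast hn
  have hrn : r / n ≤ r := div_le_self hr hn1
  have hrn0 : 0 ≤ r / n := by positivity
  set b : EuclideanSpace ℝ (Fin n) := WithLp.toLp 2 fun i => min (x i) (a i + ℓ - r / n) with hb
  have hbi : ∀ i, b i = min (x i) (a i + ℓ - r / n) := fun i => rfl
  have hab : ∀ i, a i ≤ b i := fun i => by
    rw [hbi]
    exact le_min (hx i).1 (by linarith)
  have hbl : ∀ i, b i + r / n ≤ a i + ℓ := fun i => by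
    have := min_le_right (x i) (a i + ℓ - r / n)
    rw [hbi]; linarith
  have hxb : x ∈ axisCube b (r / n) := fun i => by
    refine ⟨by rw [hbi]; exact min_le_left _ _, ?_⟩
    rw [hbi]
    rcases min_choice (x i) (a i + ℓ - r / n) with h | h <;> rw [h]
    · linarith
    · linarith [(hx i).2]
  refine ⟨b, subset_inter ?_ fun y hy i => ⟨(hab i).trans (hy i).1, (hy i).2.trans (hbl i)⟩⟩
  have := axisCube_subset_closedBall hn hxb
  rwa [mul_div_cancel₀ r (by positivity)] at this

/-- Superlevel sets of the dual weight `σ = w ^ (-1/(p-1))` of an `A_p` weight `w`. For almost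
every `x ∈ Q` with `σ x > s` the last dyadic ball about `x` on which `σ 1_Q` has mean larger than
`s` has mean comparable to `s`; by the `A_p` condition `σ` exceeds a fixed multiple of `s` on a
fixed portion of this ball, and Besicovitch's theorem sums up these portions. -/
lemma exists_superlevel_bound (hn : 1 ≤ n) {p : ℝ} (hp : 1 < p) {K : ℝ≥0∞} (hK : K ≠ ∞) :
    ∃ A d : ℝ≥0∞, A ≠ ∞ ∧ d ≠ ∞ ∧ 1 ≤ d ∧ ∀ w : EuclideanSpace ℝ (Fin n) → ℝ≥0∞,
      Measurable w → (∀ x, w x ≠ 0) → (∀ x, w x ≠ ∞) →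
      (∀ (a : EuclideanSpace ℝ (Fin n)) (ℓ : ℝ), 0 < ℓ →
        ∫⁻ y in axisCube a ℓ, w y ^ (-(1 / (p - 1))) ≠ ∞ ∧
        (∫⁻ y in axisCube a ℓ, w y) *
          (∫⁻ y in axisCube a ℓ, w y ^ (-(1 / (p - 1)))) ^ (p - 1) ≤
            K * volume (axisCube a ℓ) ^ p) →
      ∀ (a : EuclideanSpace ℝ (Fin n)) (ℓ : ℝ), 0 < ℓ → ∀ s : ℝ, 0 < s →
        ∫⁻ y in axisCube a ℓ, w y ^ (-(1 / (p - 1))) ≤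
          ENNReal.ofReal s * volume (Metric.closedBall a ℓ) →
        ∫⁻ x in axisCube a ℓ, {x | ENNReal.ofReal s < w x ^ (-(1 / (p - 1)))}.indicator
            (fun x => w x ^ (-(1 / (p - 1)))) x ≤
          A * ENNReal.ofReal s * volume.restrict (axisCube a ℓ)
            {x | ENNReal.ofReal s < d * w x ^ (-(1 / (p - 1)))} := by
  obtain ⟨N, hN⟩ := exists_measure_le_mul_of_closedBall (EuclideanSpace ℝ (Fin n))
  have hp0 : 0 < p - 1 := by linarith
  have hn0 : (0 : ℝ) < n := by exact_mod_cast hn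
  set κ := volume (Metric.ball (0 : EuclideanSpace ℝ (Fin n)) 1) with hκ
  have hκ0 : κ ≠ 0 := (Metric.measure_ball_pos volume _ one_pos).ne'
  have hκt : κ ≠ ∞ := measure_ball_lt_top.ne
  -- a ball of radius `r ≤ ℓ` centred in `Q` meets `Q` in at least the portion `θ` of its volume
  set θ := ENNReal.ofReal (((n : ℝ) ^ n)⁻¹) * κ⁻¹ with hθ
  have hθ0 : θ ≠ 0 := mul_ne_zero (by simp; positivity) (ENNReal.inv_ne_zero.2 hκt)
  have hθt : θ ≠ ∞ := ENNReal.mul_ne_top (by simp) (ENNReal.inv_ne_top.2 hκ0)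
  set η := θ / 2 with hη
  have hη0 : η ≠ 0 := (ENNReal.half_pos hθ0).ne'
  have hηt : η ≠ ∞ := ne_top_of_le_ne_top hθt ENNReal.half_le_self
  have hηη : η + η = θ := ENNReal.add_halves θ
  set L := K * cubeBallRatio n ^ p with hL
  have hLt : L ≠ ∞ := ENNReal.mul_ne_top hK
    (ENNReal.rpow_ne_top_of_nonneg (by linarith) (cubeBallRatio_ne_top n))
  -- `d` is so large that the `A_p` condition leaves at most the portion `η` of a ball to the set
  -- where `d σ ≤ s`
  set d := max 1 (((L + 1) * η⁻¹) ^ (1 / (p - 1))) with hd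
  have hd1 : 1 ≤ d := le_max_left _ _
  have hMt : (L + 1) * η⁻¹ ≠ ∞ :=
    ENNReal.mul_ne_top (by finiteness) (ENNReal.inv_ne_top.2 hη0)
  have hdt : d ≠ ∞ := by
    rw [hd]
    exact (max_lt ENNReal.one_lt_top
      (ENNReal.rpow_ne_top_of_nonneg (by positivity) hMt).lt_top).ne
  have hdM : (L + 1) * η⁻¹ ≤ d ^ (p - 1) := by
    calc (L + 1) * η⁻¹ = (((L + 1) * η⁻¹) ^ (1 / (p - 1))) ^ (p - 1) := by
          rw [← ENNReal.rpow_mul, one_div_mul_cancel hp0.ne', ENNReal.rpow_one]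
      _ ≤ d ^ (p - 1) := by
          gcongr
          exact le_max_right _ _
  refine ⟨N * (2 ^ n * η⁻¹), d, ENNReal.mul_ne_top (by simp)
    (ENNReal.mul_ne_top (by finiteness) (ENNReal.inv_ne_top.2 hη0)), hdt, hd1, ?_⟩
  intro w hw hw0 hwt hA a ℓ hℓ s hs hlow
  set σ : EuclideanSpace ℝ (Fin n) → ℝ≥0∞ := fun x => w x ^ (-(1 / (p - 1))) with hσ
  have hσm : Measurable σ := by fun_prop
  have hwσ : ∀ x, w x = σ x ^ (-(p - 1)) := fun x => by
    rw [hσ]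
    dsimp only
    rw [← ENNReal.rpow_mul, neg_mul_neg, one_div_mul_cancel hp0.ne', ENNReal.rpow_one]
  set Q := axisCube a ℓ with hQ
  have hQm : MeasurableSet Q := measurableSet_axisCube a ℓ
  set lam := ENNReal.ofReal s with hlam
  have hlam0 : lam ≠ 0 := by simpa [hlam] using hs
  have hlamt : lam ≠ ∞ := ENNReal.ofReal_ne_top
  set ρ := (volume.restrict Q).withDensity σ with hρ
  have hρfin : ρ univ = ∫⁻ y in Q, σ y := by
    rw [hρ, withDensity_apply _ MeasurableSet.univ, Measure.restrict_univ]
  have : IsFiniteMeasure ρ := ⟨by rw [hρfin]; exact (hA a ℓ hℓ).1.lt_top⟩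
  have hρB : ∀ x r, ρ (Metric.closedBall x r) = ∫⁻ y in Metric.closedBall x r ∩ Q, σ y := by
    intro x r
    rw [hρ, withDensity_apply _ Metric.isClosed_closedBall.measurableSet,
      Measure.restrict_restrict Metric.isClosed_closedBall.measurableSet]
  -- large balls have mean at most `s`
  have hbig : ∀ x (r : ℝ), ℓ ≤ r →
      ρ (Metric.closedBall x r) ≤ lam * volume (Metric.closedBall x r) := by
    intro x r hr
    calc _ ≤ ρ univ := measure_mono (subset_univ _)
      _ ≤ lam * volume (Metric.closedBall a ℓ) := by rw [hρfin]; exact hlow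
      _ ≤ _ := by
          rw [volume_closedBall_eq _ hℓ.le, volume_closedBall_eq _ (hℓ.le.trans hr)]
          gcongr
  -- Lebesgue differentiation: small balls about almost every point of `{σ > s}` have mean over `s`
  have hgood : ∀ᵐ x ∂(volume.restrict Q), lam < σ x → ∃ j : ℤ,
      lam * volume (Metric.closedBall x ((2 : ℝ) ^ j)) < ρ (Metric.closedBall x ((2 : ℝ) ^ j)) := by
    have hρ2 : ρ = volume.withDensity (Q.indicator σ) := by rw [withDensity_indicator hQm]
    have h1 := Besicovitch.ae_tendsto_rnDeriv ρ (volume : Measure (EuclideanSpace ℝ (Fin n)))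
    have h2 := Measure.rnDeriv_withDensity (volume : Measure (EuclideanSpace ℝ (Fin n)))
      (hσm.indicator hQm)
    rw [← hρ2] at h2
    filter_upwards [ae_restrict_of_ae h1, ae_restrict_of_ae h2, ae_restrict_mem hQm]
      with x hx1 hx2 hxQ hxs
    rw [hx2, indicator_of_mem hxQ] at hx1
    have h3 := hx1.eventually_const_lt hxs
    rw [eventually_nhdsWithin_iff, Metric.eventually_nhds_iff] at h3
    obtain ⟨ε, hε, h3⟩ := h3
    obtain ⟨m, hm⟩ := exists_pow_lt_of_lt_one hε (by norm_num : (1 / 2 : ℝ) < 1)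
    have e : ((2 : ℝ) ^ (-(m : ℤ))) = (1 / 2) ^ m := by simp
    refine ⟨-m, ?_⟩
    rw [e]
    have h4 := h3 (y := (1 / 2 : ℝ) ^ m)
      (by rw [Real.dist_eq, sub_zero, abs_of_pos (by positivity)]; exact hm)
      (by simp)
    exact ((ENNReal.lt_div_iff_mul_lt (Or.inr hlamt)
      (Or.inl (isCompact_closedBall _ _).measure_lt_top.ne)).1 h4)
  set T := {x | lam < σ x} with hT
  have hTm : MeasurableSet T := measurableSet_lt measurable_const hσm
  set F := {x | lam < d * σ x} with hF
  have hFm : MeasurableSet F := measurableSet_lt measurable_const (by fun_prop)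
  set ν : Measure (EuclideanSpace ℝ (Fin n)) :=
    (2 ^ n * lam * η⁻¹) • (volume.restrict Q).restrict F with hν
  -- the largest dyadic ball about `x` with mean over `s` is the one to select
  have hradius : ∀ x ∈ Q, (∃ j : ℤ,
      lam * volume (Metric.closedBall x ((2 : ℝ) ^ j)) < ρ (Metric.closedBall x ((2 : ℝ) ^ j))) →
      ∃ r : ℝ, 0 < r ∧ r ≤ ℓ ∧ ρ (Metric.closedBall x r) ≤ ν (Metric.closedBall x r) := by
    intro x hxQ hex
    obtain ⟨J, hJ⟩ := pow_unbounded_of_one_lt ℓ (by norm_num : (1 : ℝ) < 2)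
    have hbdd : ∀ j : ℤ, lam * volume (Metric.closedBall x ((2 : ℝ) ^ j)) <
        ρ (Metric.closedBall x ((2 : ℝ) ^ j)) → (2 : ℝ) ^ j < ℓ := by
      intro j hj
      by_contra! hcon
      exact absurd hj (not_lt.2 (hbig x _ hcon))
    obtain ⟨j, hj, hjmax⟩ := Int.exists_greatest_of_bdd ⟨(J : ℤ), fun j hj => by
      by_contra! hcon
      have h1 : (2 : ℝ) ^ (J : ℤ) ≤ 2 ^ j := zpow_le_zpow_right₀ (by norm_num) hcon.le
      rw [zpow_natCast] at h1
      linarith [hbdd j hj]⟩ hex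
    set r : ℝ := 2 ^ j with hr
    have hr0 : 0 < r := by positivity
    have hrℓ : r ≤ ℓ := (hbdd j hj).le
    refine ⟨r, hr0, hrℓ, ?_⟩
    set B := Metric.closedBall x r with hB
    have hBm : MeasurableSet B := Metric.isClosed_closedBall.measurableSet
    set V := volume B with hV
    have hVeq : V = ENNReal.ofReal (r ^ n) * κ := volume_closedBall_eq x hr0.le
    have hV0 : V ≠ 0 := (Metric.measure_closedBall_pos volume _ hr0).ne'
    have hVt : V ≠ ∞ := (isCompact_closedBall _ _).measure_lt_top.ne
    -- the double of the selected ball has mean at most `s`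
    have hup : ρ B ≤ 2 ^ n * lam * V := by
      have h1 : ρ (Metric.closedBall x (2 * r)) ≤ lam * volume (Metric.closedBall x (2 * r)) := by
        by_contra! hcon
        have e : (2 : ℝ) * r = 2 ^ (j + 1) := by
          rw [zpow_add_one₀ two_ne_zero, mul_comm]
        rw [e] at hcon
        have := hjmax _ hcon
        omega
      refine (measure_mono (Metric.closedBall_subset_closedBall (by linarith))).trans
        (h1.trans_eq ?_)
      rw [volume_closedBall_eq _ (by positivity), hVeq, mul_pow,
        ENNReal.ofReal_mul (by positivity), ENNReal.ofReal_pow (by norm_num), hκ]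
      norm_num
      ring
    -- the part of `B ∩ Q` on which `σ` is small compared with `s`
    have hE : volume ((B ∩ Q) \ F) ≤ η * V := by
      obtain ⟨-, h2⟩ := hA (cubeCorner x r) (2 * r) (by positivity)
      have hsub := closedBall_subset_axisCube x r
      rw [volume_axisCube_eq_ratio _ x hr0, ENNReal.mul_rpow_of_nonneg _ _ (by linarith)] at h2
      have hBQm : MeasurableSet ((B ∩ Q) \ F) := (hBm.inter hQm).diff hFm
      have h3 : d ^ (p - 1) * lam ^ (-(p - 1)) * volume ((B ∩ Q) \ F) ≤
          ∫⁻ y in axisCube (cubeCorner x r) (2 * r), w y := by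
        rw [← setLIntegral_const]
        refine (setLIntegral_mono' hBQm fun y hy => ?_).trans
          (lintegral_mono_set ((sdiff_subset.trans inter_subset_left).trans hsub))
        have hy2 : d * σ y ≤ lam := not_lt.1 hy.2
        rw [hwσ]
        have hσ0 : σ y ≠ 0 := by
          rw [hσ]; exact (ENNReal.rpow_pos (pos_iff_ne_zero.2 (hw0 y)) (hwt y)).ne'
        calc d ^ (p - 1) * lam ^ (-(p - 1)) ≤ d ^ (p - 1) * (d * σ y) ^ (-(p - 1)) := by
              refine mul_le_mul_right ?_ _
              rw [ENNReal.rpow_neg, ENNReal.rpow_neg]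
              exact ENNReal.inv_le_inv.2 (ENNReal.rpow_le_rpow hy2 hp0.le)
          _ = σ y ^ (-(p - 1)) := by
              have hd0 : d ≠ 0 := (zero_lt_one.trans_le hd1).ne'
              rw [ENNReal.mul_rpow_of_ne_zero hd0 hσ0, ← mul_assoc,
                ← ENNReal.rpow_add _ _ hd0 hdt, add_neg_cancel, ENNReal.rpow_zero, one_mul]
      have h4 : lam * V ≤ ∫⁻ y in axisCube (cubeCorner x r) (2 * r), σ y := by
        refine hj.le.trans ?_
        rw [hρB]
        exact lintegral_mono_set (inter_subset_left.trans hsub)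
      have h5 : d ^ (p - 1) * volume ((B ∩ Q) \ F) * V ^ (p - 1) ≤ L * V * V ^ (p - 1) := by
        have hVp : V ^ p = V ^ (p - 1) * V := by
          conv_lhs => rw [← sub_add_cancel p 1,
            ENNReal.rpow_add_of_nonneg _ _ hp0.le zero_le_one, ENNReal.rpow_one]
        calc _ = (d ^ (p - 1) * lam ^ (-(p - 1)) * volume ((B ∩ Q) \ F)) * (lam * V) ^ (p - 1) := by
              rw [ENNReal.mul_rpow_of_nonneg _ _ hp0.le]
              have : lam ^ (-(p - 1)) * lam ^ (p - 1) = 1 := by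
                rw [← ENNReal.rpow_add _ _ hlam0 hlamt, neg_add_cancel, ENNReal.rpow_zero]
              calc _ = d ^ (p - 1) * volume ((B ∩ Q) \ F) * V ^ (p - 1) *
                    (lam ^ (-(p - 1)) * lam ^ (p - 1)) := by rw [this, mul_one]
                _ = _ := by ring
          _ ≤ _ := mul_le_mul' h3 (ENNReal.rpow_le_rpow h4 hp0.le)
          _ ≤ _ := h2
          _ = _ := by rw [hL, ← hV, hVp]; ring
      have h6 : d ^ (p - 1) * volume ((B ∩ Q) \ F) ≤ L * V :=
        (ENNReal.mul_le_mul_iff_left (ENNReal.rpow_pos (pos_iff_ne_zero.2 hV0) hVt).ne'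
          (ENNReal.rpow_ne_top_of_nonneg hp0.le hVt)).1 h5
      have h7 : (L + 1) * (η⁻¹ * volume ((B ∩ Q) \ F)) ≤ (L + 1) * V := by
        calc _ = (L + 1) * η⁻¹ * volume ((B ∩ Q) \ F) := by ring
          _ ≤ d ^ (p - 1) * volume ((B ∩ Q) \ F) := by gcongr
          _ ≤ L * V := h6
          _ ≤ _ := by gcongr; exact le_self_add
      have h8 := (ENNReal.mul_le_mul_iff_right (by simp) (by finiteness)).1 h7
      calc _ = η * (η⁻¹ * volume ((B ∩ Q) \ F)) := by
            rw [← mul_assoc, ENNReal.mul_inv_cancel hη0 hηt, one_mul]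
        _ ≤ _ := by gcongr
    have hP : θ * V ≤ volume (B ∩ Q) := by
      obtain ⟨b, hb⟩ := exists_axisCube_subset_inter hn hxQ hr0.le hrℓ
      refine le_trans (le_of_eq ?_) (measure_mono hb)
      rw [volume_axisCube _ (by positivity), hVeq, hθ, div_pow, div_eq_mul_inv,
        ENNReal.ofReal_mul (by positivity)]
      calc _ = ENNReal.ofReal (r ^ n) * ENNReal.ofReal ((n : ℝ) ^ n)⁻¹ * (κ⁻¹ * κ) := by ring
        _ = _ := by rw [ENNReal.inv_mul_cancel hκ0 hκt, mul_one]
    have hPF : η * V ≤ volume (B ∩ Q ∩ F) := by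
      have h1 : η * V + η * V ≤ volume (B ∩ Q ∩ F) + η * V := by
        calc _ = θ * V := by rw [← add_mul, hηη]
          _ ≤ volume (B ∩ Q) := hP
          _ = volume (B ∩ Q ∩ F) + volume ((B ∩ Q) \ F) := (measure_inter_add_sdiff _ hFm).symm
          _ ≤ _ := by gcongr
      exact (ENNReal.add_le_add_iff_right (ENNReal.mul_ne_top hηt hVt)).1 h1
    calc ρ B ≤ 2 ^ n * lam * V := hup
      _ = 2 ^ n * lam * η⁻¹ * (η * V) := by
          rw [mul_assoc _ η⁻¹, ← mul_assoc η⁻¹, ENNReal.inv_mul_cancel hη0 hηt, one_mul]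
      _ ≤ 2 ^ n * lam * η⁻¹ * volume (B ∩ Q ∩ F) := by gcongr
      _ = ν B := by
          rw [hν, Measure.smul_apply, smul_eq_mul, Measure.restrict_apply hBm,
            Measure.restrict_apply (hBm.inter hFm)]
          congr 2
          ext; simp only [mem_inter_iff]; tauto
  choose! r hr using hradius
  have hfinal := hN ρ ν {x | x ∈ Q ∧ ∃ j : ℤ,
      lam * volume (Metric.closedBall x ((2 : ℝ) ^ j)) < ρ (Metric.closedBall x ((2 : ℝ) ^ j))}
    r ℓ fun x hx => hr x hx.1 hx.2
  calc _ = ρ T := by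
        rw [lintegral_indicator hTm, hρ, withDensity_apply _ hTm]
    _ ≤ ρ {x | x ∈ Q ∧ ∃ j : ℤ,
      lam * volume (Metric.closedBall x ((2 : ℝ) ^ j)) < ρ (Metric.closedBall x ((2 : ℝ) ^ j))} :=
          by
        refine measure_mono_ae ((withDensity_absolutelyContinuous _ σ).ae_le ?_)
        filter_upwards [hgood, ae_restrict_mem hQm] with x hx1 hx2 hxT
        exact ⟨hx2, hx1 hxT⟩
    _ ≤ N * ν univ := hfinal
    _ = _ := by
        rw [hν, Measure.smul_apply, smul_eq_mul, Measure.restrict_apply_univ]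
        ring

/-- The `A_p` classes are open-ended: a weight in `A_p` with `p > 1` lies in `A_r` for some
`r < p`. This follows from the reverse Hölder inequality for the dual weight. -/
lemma IsMuckenhoupt.exists_lt (hn : 1 ≤ n) {ω : EuclideanSpace ℝ (Fin n) → ℝ} {p : ℝ}
    (h : IsMuckenhoupt p ω) (hp : 1 < p) : ∃ r, 1 ≤ r ∧ r < p ∧ IsMuckenhoupt r ω := by
  have hp0 : 0 < p - 1 := by linarith
  rcases h.ae_eq_zero_or_exists hp.le with h0 | ⟨w, hw, hw0, hwt, hww⟩
  · exact ⟨(1 + p) / 2, by linarith, by linarith, isMuckenhoupt_of_ae_eq_zero h h0 (by linarith)⟩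
  obtain ⟨A, d, hAt, hdt, hd1, hAd⟩ := exists_superlevel_bound hn hp h.const_lt_top.ne
  have hcube := fun (a : EuclideanSpace ℝ (Fin n)) (ℓ : ℝ) (hℓ : 0 < ℓ) =>
    h.lintegral_cube_mul_le hp hw0 hw hww a hℓ
  have hAd := hAd w hw hw0 hwt fun a ℓ hℓ => (hcube a ℓ hℓ).2
  set σ : EuclideanSpace ℝ (Fin n) → ℝ≥0∞ := fun x => w x ^ (-(1 / (p - 1))) with hσ
  have hσm : Measurable σ := by fun_prop
  have hAdt : A * d ^ (2 : ℝ) ≠ ∞ :=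
    ENNReal.mul_ne_top hAt (ENNReal.rpow_ne_top_of_nonneg (by norm_num) hdt)
  set δ : ℝ := (2 * (1 + (A * d ^ (2 : ℝ)).toReal))⁻¹ with hδ
  have hδ0 : 0 < δ := by positivity
  have hδ1 : δ ≤ 1 := by
    refine inv_le_one_of_one_le₀ ?_
    have : 0 ≤ (A * d ^ (2 : ℝ)).toReal := ENNReal.toReal_nonneg
    linarith
  have hδA : ENNReal.ofReal δ * A * d ^ (2 : ℝ) ≤ 2⁻¹ := by
    rw [mul_assoc, ← ENNReal.ofReal_toReal hAdt, ← ENNReal.ofReal_mul hδ0.le]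
    have e : (2⁻¹ : ℝ≥0∞) = ENNReal.ofReal 2⁻¹ := by
      rw [ENNReal.ofReal_inv_of_pos two_pos]; simp
    rw [e]
    refine ENNReal.ofReal_le_ofReal ?_
    have : 0 ≤ (A * d ^ (2 : ℝ)).toReal := ENNReal.toReal_nonneg
    rw [hδ, inv_mul_le_iff₀ (by positivity)]
    linarith
  set κ := volume (Metric.ball (0 : EuclideanSpace ℝ (Fin n)) 1) with hκ
  have hκ0 : κ ≠ 0 := (Metric.measure_ball_pos volume _ one_pos).ne'
  have hκt : κ ≠ ∞ := measure_ball_lt_top.ne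
  have h1δ : 0 < 1 + δ := by linarith
  have hr1 : 1 < 1 + (p - 1) / (1 + δ) := by
    have := div_pos hp0 h1δ
    linarith
  -- with this exponent `r`, the dual weight of order `r` is `σ ^ (1 + δ)`
  refine ⟨1 + (p - 1) / (1 + δ), hr1.le, ?_, h.nonneg, h.locallyIntegrable, ?_⟩
  · have : (p - 1) / (1 + δ) < p - 1 := div_lt_self hp0 (by linarith)
    linarith
  have hKt : (2 * κ⁻¹ ^ δ) ^ ((p - 1) / (1 + δ)) * muckenhouptConst p ω < ∞ := by
    refine ENNReal.mul_lt_top (ENNReal.rpow_lt_top_of_nonneg (by positivity) ?_) h.const_lt_top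
    exact ENNReal.mul_ne_top (by simp) (ENNReal.rpow_ne_top_of_nonneg hδ0.le
      (ENNReal.inv_ne_top.2 hκ0))
  refine lt_of_le_of_lt (muckenhouptConst_le hr1.ne' fun a ℓ hℓ => ?_) hKt
  have hmean := meanOn_mul_le hp.ne' ω a hℓ
  have hσae : (fun x => ENNReal.ofReal (ω x) ^ (-(1 / (p - 1)))) =ᵐ[volume] σ := by
    filter_upwards [hww] with x hx
    rw [hx]
  have hσae2 : (fun x => ENNReal.ofReal (ω x) ^ (-(1 / (1 + (p - 1) / (1 + δ) - 1))))
      =ᵐ[volume] fun x => σ x ^ (1 + δ) := by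
    filter_upwards [hww] with x hx
    rw [hx, hσ]
    dsimp only
    rw [← ENNReal.rpow_mul]
    congr 1
    rw [add_sub_cancel_left, one_div_div]
    field_simp
  rw [meanOn_congr hww, meanOn_congr hσae] at hmean
  rw [meanOn_congr hww, meanOn_congr hσae2, add_sub_cancel_left]
  set Q := axisCube a ℓ with hQ
  have hVB0 : volume (Metric.closedBall a ℓ) ≠ 0 :=
    (Metric.measure_closedBall_pos volume _ hℓ).ne'
  have hVBt : volume (Metric.closedBall a ℓ) ≠ ∞ := (isCompact_closedBall _ _).measure_lt_top.ne
  have : IsFiniteMeasure (volume.restrict Q) :=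
    ⟨by rw [Measure.restrict_apply_univ]; exact (volume_axisCube_ne_top a hℓ).lt_top⟩
  have hreverse : ∫⁻ x in Q, σ x ^ (1 + δ) ≤
      2 * ((κ⁻¹ * meanOn Q σ) ^ δ * ∫⁻ x in Q, σ x) := by
    refine lintegral_rpow_one_add_le_of_superlevel hσm hd1 hδ0 hδ1 hδA fun s hs hl => ?_
    refine hAd a ℓ hℓ s hs ?_
    rw [← volume_mul_meanOn hℓ, volume_closedBall_eq _ hℓ.le, volume_axisCube _ hℓ.le]
    calc ENNReal.ofReal (ℓ ^ n) * meanOn Q σ = ENNReal.ofReal (ℓ ^ n) * (κ⁻¹ * κ) * meanOn Q σ := by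
          rw [ENNReal.inv_mul_cancel hκ0 hκt, mul_one]
      _ = (κ⁻¹ * meanOn Q σ) * (ENNReal.ofReal (ℓ ^ n) * κ) := by ring
      _ ≤ _ := by gcongr
  have hrev2 : meanOn Q (fun x => σ x ^ (1 + δ)) ≤ 2 * κ⁻¹ ^ δ * meanOn Q σ ^ (1 + δ) := by
    calc _ ≤ (volume Q)⁻¹ * (2 * ((κ⁻¹ * meanOn Q σ) ^ δ * ∫⁻ x in Q, σ x)) := by
          unfold meanOn
          exact mul_le_mul_right hreverse _
      _ = 2 * (κ⁻¹ * meanOn Q σ) ^ δ * meanOn Q σ := by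
          conv_rhs => enter [2]; unfold meanOn
          ring
      _ = _ := by
          rw [ENNReal.mul_rpow_of_nonneg _ _ hδ0.le, add_comm 1 δ,
            ENNReal.rpow_add_of_nonneg _ _ hδ0.le zero_le_one, ENNReal.rpow_one]
          ring
  calc _ ≤ meanOn Q w * (2 * κ⁻¹ ^ δ * meanOn Q σ ^ (1 + δ)) ^ ((p - 1) / (1 + δ)) := by
        gcongr
    _ = (2 * κ⁻¹ ^ δ) ^ ((p - 1) / (1 + δ)) * (meanOn Q w * meanOn Q σ ^ (p - 1)) := by
        rw [ENNReal.mul_rpow_of_nonneg _ _ (by positivity), ← ENNReal.rpow_mul,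
          mul_div_cancel₀ _ h1δ.ne']
        ring
    _ ≤ _ := by gcongr

end ReverseHolder

/-! ### Summation over dyadic scales -/

section Scales

variable {n : ℕ}

/-- A singular integral over a ball is controlled by the means over the balls of radii `r 2⁻ʲ`. -/
lemma setLIntegral_ball_div_le_tsum {F : EuclideanSpace ℝ (Fin n) → ℝ≥0∞} (hF : Measurable F)
    (hF0 : F 0 = 0) {a A : ℝ} (ha : 0 ≤ a) (haA : a ≤ A) {r : ℝ} (hr : 0 < r) :
    ∫⁻ h in Metric.ball (0 : EuclideanSpace ℝ (Fin n)) r,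
        F h / ENNReal.ofReal (‖h‖ ^ ((n : ℝ) + a)) ≤
      ENNReal.ofReal (2 ^ ((n : ℝ) + A)) * ∑' j : ℕ, ENNReal.ofReal ((r * (1 / 2) ^ j) ^ (-a)) *
        unitBallMean F 0 (r * (1 / 2) ^ j) := by
  have hna : 0 ≤ (n : ℝ) + a := by positivity
  set τ : ℕ → ℝ := fun j => r * (1 / 2) ^ j with hτ
  have hτ0 : ∀ j, 0 < τ j := fun j => by positivity
  have hτs : ∀ j, τ (j + 1) = τ j / 2 := fun j => by simp only [hτ]; ring
  have hpt : ∀ h ∈ Metric.ball (0 : EuclideanSpace ℝ (Fin n)) r,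
      F h / ENNReal.ofReal (‖h‖ ^ ((n : ℝ) + a)) ≤ ∑' j : ℕ,
        ENNReal.ofReal ((τ j / 2) ^ (-((n : ℝ) + a))) *
          (Metric.ball (0 : EuclideanSpace ℝ (Fin n)) (τ j)).indicator F h := by
    intro h hh
    rw [mem_ball_zero_iff] at hh
    rcases eq_or_ne h 0 with rfl | h0
    · rw [hF0, ENNReal.zero_div]; exact zero_le
    have hnorm : 0 < ‖h‖ := norm_pos_iff.2 h0
    have hex : ∃ j, τ (j + 1) ≤ ‖h‖ := by
      obtain ⟨m, hm⟩ := exists_pow_lt_of_lt_one (div_pos hnorm hr) (by norm_num : (1 / 2 : ℝ) < 1)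
      rw [lt_div_iff₀ hr] at hm
      refine ⟨m, ?_⟩
      rw [hτs]
      have : τ m ≤ ‖h‖ := by simp only [hτ]; linarith
      linarith [hτ0 m]
    classical
    set j := Nat.find hex with hj
    have hj1 : τ j / 2 ≤ ‖h‖ := by rw [← hτs]; exact Nat.find_spec hex
    have hj2 : ‖h‖ < τ j := by
      rcases Nat.eq_zero_or_pos j with h1 | h1
      · rw [h1]; simpa [hτ] using hh
      · have := Nat.find_min hex (m := j - 1) (by omega)
        rw [Nat.sub_add_cancel h1, not_le] at this
        exact this
    refine le_trans ?_ (ENNReal.le_tsum j)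
    rw [indicator_of_mem (by rwa [mem_ball_zero_iff]), mul_comm, ENNReal.div_eq_inv_mul, mul_comm]
    refine mul_le_mul_right ?_ _
    rw [← ENNReal.ofReal_inv_of_pos (by positivity), ← Real.rpow_neg hnorm.le]
    exact ENNReal.ofReal_le_ofReal (Real.rpow_le_rpow_of_nonpos (by have := hτ0 j; positivity) hj1
      (by linarith))
  calc _ ≤ ∫⁻ h in Metric.ball (0 : EuclideanSpace ℝ (Fin n)) r, ∑' j : ℕ,
        ENNReal.ofReal ((τ j / 2) ^ (-((n : ℝ) + a))) *
          (Metric.ball (0 : EuclideanSpace ℝ (Fin n)) (τ j)).indicator F h :=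
        setLIntegral_mono' measurableSet_ball hpt
    _ ≤ ∫⁻ h : EuclideanSpace ℝ (Fin n), ∑' j : ℕ,
        ENNReal.ofReal ((τ j / 2) ^ (-((n : ℝ) + a))) *
          (Metric.ball (0 : EuclideanSpace ℝ (Fin n)) (τ j)).indicator F h :=
        setLIntegral_le_lintegral _ _
    _ = ∑' j : ℕ, ENNReal.ofReal ((τ j / 2) ^ (-((n : ℝ) + a))) *
          (ENNReal.ofReal (τ j ^ n) * unitBallMean F 0 (τ j)) := by
        rw [lintegral_tsum fun j =>
          ((hF.indicator measurableSet_ball).const_mul _).aemeasurable]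
        congr 1
        funext j
        rw [lintegral_const_mul _ (hF.indicator measurableSet_ball),
          lintegral_indicator measurableSet_ball, setLIntegral_ball_eq_unitBallMean _ _ (hτ0 j)]
    _ ≤ ∑' j : ℕ, ENNReal.ofReal (2 ^ ((n : ℝ) + A)) * (ENNReal.ofReal (τ j ^ (-a)) *
        unitBallMean F 0 (τ j)) := by
        refine ENNReal.tsum_le_tsum fun j => ?_
        rw [← mul_assoc, ← mul_assoc]
        refine mul_le_mul_left ?_ _
        have hj := hτ0 j
        rw [← ENNReal.ofReal_mul (by positivity), ← ENNReal.ofReal_mul (by positivity)]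
        refine ENNReal.ofReal_le_ofReal ?_
        have e : (τ j / 2) ^ (-((n : ℝ) + a)) * τ j ^ n = 2 ^ ((n : ℝ) + a) * τ j ^ (-a) := by
          rw [Real.div_rpow hj.le (by norm_num), Real.rpow_neg (by norm_num : (0 : ℝ) ≤ 2),
            div_inv_eq_mul, ← Real.rpow_natCast (τ j) n, mul_right_comm, ← Real.rpow_add hj,
                mul_comm]
          congr 2
          ring
        rw [e]
        gcongr
        norm_num
    _ = _ := ENNReal.tsum_mul_left

/-- The geometric series over the dyadic scales; it is the source of the factor `1 - s` in the
theorem. -/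
lemma tsum_half_rpow_le {b s : ℝ} (hs0 : 0 < s) (hs1 : s < 1) (hb : 1 - s ≤ b) :
    ∑' j : ℕ, ENNReal.ofReal ((1 / 2) ^ b) ^ j ≤ ENNReal.ofReal (2 / (1 - s)) := by
  rw [ENNReal.tsum_geometric, ← ENNReal.ofReal_one, ← ENNReal.ofReal_sub _ (by positivity)]
  have h1 : ((1 / 2 : ℝ)) ^ b ≤ 1 - (1 - s) / 2 := by
    calc ((1 / 2 : ℝ)) ^ b ≤ (1 / 2) ^ (1 - s) :=
          Real.rpow_le_rpow_of_exponent_ge (by norm_num) (by norm_num) hb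
      _ = (1 + -(1 / 2)) ^ (1 - s) := by norm_num
      _ ≤ 1 + (1 - s) * (-(1 / 2)) :=
          rpow_one_add_le_one_add_mul_self (by norm_num) (by linarith) (by linarith)
      _ = _ := by ring
  have h2 : 0 < 1 - (1 / 2 : ℝ) ^ b := by linarith
  rw [← ENNReal.ofReal_inv_of_pos h2]
  refine ENNReal.ofReal_le_ofReal ?_
  rw [inv_eq_one_div, div_le_div_iff₀ h2 (by linarith)]
  linarith

lemma sum_range_rpow_le {b : ℝ} (hb0 : 0 < b) (hb1 : b ≤ 1) (a : ℕ → ℝ≥0∞) (N : ℕ) :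
    (∑ j ∈ Finset.range N, a j) ^ b ≤ ∑ j ∈ Finset.range N, a j ^ b := by
  induction N with
  | zero => simp [hb0]
  | succ N ih =>
    rw [Finset.sum_range_succ, Finset.sum_range_succ]
    exact (ENNReal.rpow_add_le_add_rpow _ _ hb0.le hb1).trans (by gcongr)

/-- Subadditivity of powers with exponent at most one. -/
lemma tsum_rpow_le {b : ℝ} (hb0 : 0 < b) (hb1 : b ≤ 1) (a : ℕ → ℝ≥0∞) :
    (∑' j, a j) ^ b ≤ ∑' j, a j ^ b := by
  have h1 : (∑' j, a j) ^ b = ⨆ N, (∑ j ∈ Finset.range N, a j) ^ b := by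
    rw [ENNReal.tsum_eq_iSup_nat]
    exact (ENNReal.orderIsoRpow b hb0).map_iSup _
  rw [h1]
  exact iSup_le fun N => (sum_range_rpow_le hb0 hb1 a N).trans (ENNReal.sum_le_tsum _)

variable {𝕜 : Type*} [RCLike 𝕜]

/-- The inner integral of the Gagliardo quantity, as a sum over dyadic scales of means of the
gradient. -/
lemma exists_setLIntegral_orderDiff_le_tsum (n m : ℕ) {u q : ℝ} (hu : 1 ≤ u) (hq : 1 ≤ q)
    (hlt : (n : ℝ) * (1 / u - 1 / q) < (m + 1 : ℕ)) {C₀ : ℝ≥0∞} (hC₀ : C₀ ≠ ∞) :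
    ∃ C : ℝ≥0∞, C ≠ ∞ ∧ ∀ {f : EuclideanSpace ℝ (Fin n) → 𝕜}
      {g : EuclideanSpace ℝ (Fin n) → ℝ≥0∞}, Measurable f → Measurable g →
      (∀ᵐ y, ∀ᵐ v, ‖orderDiff (m + 1) v f y‖ₑ ≤ C₀ * (‖v‖ₑ ^ (m + 1) *
          ∫⁻ t in Ioc (0 : ℝ) (m + 1 : ℕ), ENNReal.ofReal (t ^ m) * g (y + t • v))) →
      ∀ᵐ x, ∀ s r : ℝ, 0 < s → s < 1 → 0 < r →
        ∫⁻ h in Metric.ball (0 : EuclideanSpace ℝ (Fin n)) r, ‖orderDiff (m + 1) h f x‖ₑ ^ q /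
          ENNReal.ofReal (‖h‖ ^ ((n : ℝ) + s * (m + 1 : ℕ) * q)) ≤
        C * ENNReal.ofReal (r ^ ((1 - s) * (m + 1 : ℕ) * q)) *
          ∑' j : ℕ, ENNReal.ofReal ((1 / 2) ^ ((1 - s) * (m + 1 : ℕ) * q)) ^ j *
            (radialMean m g x (((m + 1 : ℕ) + 1) * (r * (1 / 2) ^ j)) ^ q +
              ∑ l ∈ Finset.range (m + 1), unitBallMean (fun z => g z ^ u) x
                ((((m + 1 : ℕ) : ℝ) + 1) * (((l + 1 : ℕ) : ℝ) * (r * (1 / 2) ^ j))) ^ (q / u)) := by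
  obtain ⟨C, hC, h⟩ := exists_unitBallMean_orderDiff_rpow_le (𝕜 := 𝕜) n m hu hq hlt hC₀
  have hq0 : 0 < q := by linarith
  refine ⟨ENNReal.ofReal (2 ^ ((n : ℝ) + (m + 1 : ℕ) * q)) * C, by finiteness, ?_⟩
  intro f g hf hg hfg
  filter_upwards [h hf hg hfg] with x hx s r hs0 hs1 hr
  set k : ℕ := m + 1 with hk
  have hk0 : (0 : ℝ) ≤ (k : ℝ) * q := by positivity
  have hF : Measurable fun h : EuclideanSpace ℝ (Fin n) => ‖orderDiff k h f x‖ₑ ^ q := by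
    have := (measurable_orderDiff_uncurry (k := k) hf).comp
      (measurable_prodMk_right (y := x))
    exact this.enorm.pow_const q
  have hF0 : ‖orderDiff k 0 f x‖ₑ ^ q = 0 := by
    rw [orderDiff_zero_step (by omega), enorm_zero, ENNReal.zero_rpow_of_pos hq0]
  refine (setLIntegral_ball_div_le_tsum hF hF0 (a := s * k * q) (A := k * q) (by positivity)
    (by nlinarith) hr).trans ?_
  rw [mul_assoc (_ * C), mul_assoc _ C]
  refine mul_le_mul_right ?_ _
  rw [← ENNReal.tsum_mul_left, ← ENNReal.tsum_mul_left]
  refine ENNReal.tsum_le_tsum fun j => ?_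
  set τ : ℝ := r * (1 / 2) ^ j with hτ
  have hτ0 : 0 < τ := by positivity
  refine (mul_le_mul_right (hx τ hτ0) _).trans_eq ?_
  have e : τ ^ (-(s * k * q)) * (τ ^ k) ^ q =
      r ^ ((1 - s) * k * q) * ((1 / 2) ^ ((1 - s) * k * q)) ^ j := by
    rw [← Real.rpow_natCast τ k, ← Real.rpow_mul hτ0.le, ← Real.rpow_add hτ0, hτ,
      Real.mul_rpow hr.le (by positivity), ← Real.rpow_natCast (1 / 2 : ℝ) j,
          ← Real.rpow_mul (by norm_num),
      ← Real.rpow_natCast _ j, ← Real.rpow_mul (by norm_num)]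
    congr 2 <;> ring
  have e2 : ENNReal.ofReal (τ ^ (-(s * k * q))) * ENNReal.ofReal (τ ^ k) ^ q =
      ENNReal.ofReal (r ^ ((1 - s) * k * q)) * ENNReal.ofReal ((1 / 2) ^ ((1 - s) * k * q)) ^ j :=
          by
    rw [ENNReal.ofReal_rpow_of_nonneg (by positivity) hq0.le, ← ENNReal.ofReal_pow (by positivity),
      ← ENNReal.ofReal_mul (by positivity), ← ENNReal.ofReal_mul (by positivity), e]
  calc _ = C * (ENNReal.ofReal (τ ^ (-(s * k * q))) * ENNReal.ofReal (τ ^ k) ^ q) * _ := by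
        rw [← mul_assoc, mul_left_comm, ← mul_assoc]
    _ = _ := by
        rw [e2]
        ring

end Scales

/-! ### Means and the maximal function -/

section MaximalBounds

variable {n : ℕ}

/-- The factor `2 ^ n` comes from enlarging the radius to a power of two. -/
lemma unitBallMean_le_centredMaximal (F : EuclideanSpace ℝ (Fin n) → ℝ≥0∞)
    (x : EuclideanSpace ℝ (Fin n)) {τ : ℝ} (hτ : 0 < τ) :
    unitBallMean F x τ ≤ 2 ^ n * volume (Metric.ball (0 : EuclideanSpace ℝ (Fin n)) 1) *
      centredMaximal volume F x := by
  obtain ⟨j, hj1, hj2⟩ := exists_mem_Ico_zpow hτ (by norm_num : (1 : ℝ) < 2)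
  have h2 : (2 : ℝ) ^ (j + 1) ≤ 2 * τ := by
    rw [zpow_add_one₀ two_ne_zero]; linarith
  have hpos : (0 : ℝ) < 2 ^ (j + 1) := by positivity
  set B := Metric.closedBall x ((2 : ℝ) ^ (j + 1)) with hB
  have hV0 : volume B ≠ 0 := (Metric.measure_closedBall_pos volume _ hpos).ne'
  have hVt : volume B ≠ ∞ := (isCompact_closedBall _ _).measure_lt_top.ne
  set κ := volume (Metric.ball (0 : EuclideanSpace ℝ (Fin n)) 1)
  rw [unitBallMean_eq _ _ hτ]
  calc _ ≤ ENNReal.ofReal ((τ ^ n)⁻¹) * ∫⁻ z in B, F z := by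
        refine mul_le_mul_right (lintegral_mono_set ?_) _
        exact Metric.ball_subset_closedBall.trans (Metric.closedBall_subset_closedBall hj2.le)
    _ = ENNReal.ofReal ((τ ^ n)⁻¹) * (volume B * ((volume B)⁻¹ * ∫⁻ z in B, F z)) := by
        rw [← mul_assoc (volume B), ENNReal.mul_inv_cancel hV0 hVt, one_mul]
    _ ≤ ENNReal.ofReal ((τ ^ n)⁻¹) * (ENNReal.ofReal ((2 * τ) ^ n) * κ *
          centredMaximal volume F x) := by
        refine mul_le_mul_right (mul_le_mul' ?_ (le_centredMaximal _ _ _ _)) _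
        rw [hB, volume_closedBall_eq _ hpos.le]
        gcongr
    _ = (ENNReal.ofReal ((τ ^ n)⁻¹) * ENNReal.ofReal ((2 * τ) ^ n)) * κ *
          centredMaximal volume F x := by ring
    _ = _ := by
        rw [← ENNReal.ofReal_mul (by positivity), mul_pow, mul_left_comm,
          inv_mul_cancel₀ (by positivity), mul_one, ENNReal.ofReal_pow (by norm_num)]
        norm_num

lemma lintegral_Ioc_pow_le (m : ℕ) :
    ∫⁻ t in Ioc (0 : ℝ) (m + 1 : ℕ), ENNReal.ofReal (t ^ m) ≤ ((m + 1 : ℕ) : ℝ≥0∞) ^ (m + 1) := by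
  calc _ ≤ ∫⁻ _t in Ioc (0 : ℝ) (m + 1 : ℕ), ((m + 1 : ℕ) : ℝ≥0∞) ^ m := by
        refine setLIntegral_mono' measurableSet_Ioc fun t ht => ?_
        rw [ENNReal.ofReal_pow ht.1.le]
        gcongr
        rw [← ENNReal.ofReal_natCast]
        exact ENNReal.ofReal_le_ofReal ht.2
    _ = _ := by
        rw [setLIntegral_const, Real.volume_Ioc, sub_zero, ENNReal.ofReal_natCast, pow_succ]

/-- All the means of `g` at one scale are bounded by the maximal function of `g ^ u`. -/
lemma exists_scale_mean_le_centredMaximal (n m : ℕ) {u q : ℝ} (hu : 1 ≤ u) (hq : 1 ≤ q) :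
    ∃ C : ℝ≥0∞, C ≠ ∞ ∧ ∀ {g : EuclideanSpace ℝ (Fin n) → ℝ≥0∞}, Measurable g →
      ∀ (x : EuclideanSpace ℝ (Fin n)) (R : ℝ), 0 < R →
        radialMean m g x (((m + 1 : ℕ) + 1) * R) ^ q +
          ∑ l ∈ Finset.range (m + 1), unitBallMean (fun z => g z ^ u) x
            ((((m + 1 : ℕ) : ℝ) + 1) * (((l + 1 : ℕ) : ℝ) * R)) ^ (q / u) ≤
        C * centredMaximal volume (fun z => g z ^ u) x ^ (q / u) := by
  have hu0 : 0 < u := by linarith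
  have hq0 : 0 < q := by linarith
  set κ := volume (Metric.ball (0 : EuclideanSpace ℝ (Fin n)) 1) with hκ
  have hκt : κ ≠ ∞ := measure_ball_lt_top.ne
  set c : ℝ≥0∞ := 2 ^ n * κ with hc
  set c' : ℝ≥0∞ := (κ ^ (u - 1) * c) ^ (1 / u) with hc'
  have hct : c ≠ ∞ := by finiteness
  have hct' : c' ≠ ∞ := by
    have : 0 ≤ u - 1 := by linarith
    have : 0 ≤ 1 / u := by positivity
    finiteness
  refine ⟨(((m + 1 : ℕ) : ℝ≥0∞) ^ (m + 1) * c') ^ q + (m + 1 : ℕ) * c ^ (q / u), ?_, ?_⟩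
  · have : 0 ≤ q / u := by positivity
    have h1 : ((m + 1 : ℕ) : ℝ≥0∞) ≠ ∞ := ENNReal.natCast_ne_top _
    finiteness
  intro g hg x R hR
  set M := centredMaximal volume (fun z => g z ^ u) x with hM
  have hmean : ∀ τ : ℝ, 0 < τ → unitBallMean g x τ ≤ c' * M ^ (1 / u) := by
    intro τ hτ
    have h1 := unitBallMean_rpow_le hg x τ hu
    have h2 := unitBallMean_le_centredMaximal (fun z => g z ^ u) x hτ
    calc unitBallMean g x τ = (unitBallMean g x τ ^ u) ^ (1 / u) := by
          rw [← ENNReal.rpow_mul, mul_one_div_cancel hu0.ne', ENNReal.rpow_one]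
      _ ≤ (κ ^ (u - 1) * (c * M)) ^ (1 / u) := by
          refine ENNReal.rpow_le_rpow (h1.trans ?_) (by positivity)
          exact mul_le_mul_right h2 _
      _ = _ := by rw [← mul_assoc, ENNReal.mul_rpow_of_nonneg _ _ (by positivity)]
  have hrad : radialMean m g x (((m + 1 : ℕ) + 1) * R) ≤
      ((m + 1 : ℕ) : ℝ≥0∞) ^ (m + 1) * c' * M ^ (1 / u) := by
    unfold radialMean
    calc _ ≤ ∫⁻ t in Ioc (0 : ℝ) (m + 1 : ℕ), ENNReal.ofReal (t ^ m) * (c' * M ^ (1 / u)) := by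
          refine setLIntegral_mono' measurableSet_Ioc fun t ht => ?_
          have := ht.1
          exact mul_le_mul_right (hmean _ (by positivity)) _
      _ ≤ _ := by
          rw [lintegral_mul_const _ (by fun_prop), mul_assoc]
          exact mul_le_mul_left (lintegral_Ioc_pow_le m) _
  conv_rhs => rw [add_mul]
  refine add_le_add ?_ ?_
  · calc _ ≤ (((m + 1 : ℕ) : ℝ≥0∞) ^ (m + 1) * c' * M ^ (1 / u)) ^ q :=
          ENNReal.rpow_le_rpow hrad hq0.le
      _ = _ := by
          rw [ENNReal.mul_rpow_of_nonneg _ _ hq0.le, ← ENNReal.rpow_mul, one_div_mul_eq_div]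
  · calc _ ≤ ∑ _l ∈ Finset.range (m + 1), (c * M) ^ (q / u) := by
          refine Finset.sum_le_sum fun l _ => ENNReal.rpow_le_rpow ?_ (by positivity)
          exact unitBallMean_le_centredMaximal _ _ (by positivity)
      _ = _ := by
          rw [Finset.sum_const, Finset.card_range, nsmul_eq_mul,
            ENNReal.mul_rpow_of_nonneg _ _ (by positivity), mul_assoc]

end MaximalBounds

/-! ### The Gagliardo quantity and the maximal function -/

section GagliardoBounds

variable {n : ℕ} {𝕜 : Type*} [RCLike 𝕜]

/-- Bound of the Gagliardo quantity through a weighted maximal inequality at exponent `p / u`. -/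
lemma exists_lintegral_orderDiff_le_of_maximal (n m : ℕ) {p u q : ℝ} (hp : 1 ≤ p) (hu : 1 ≤ u)
    (hq : 1 ≤ q) (hlt : (n : ℝ) * (1 / u - 1 / q) < (m + 1 : ℕ)) {C₀ : ℝ≥0∞} (hC₀ : C₀ ≠ ∞) :
    ∃ C : ℝ≥0∞, C ≠ ∞ ∧ ∀ {f : EuclideanSpace ℝ (Fin n) → 𝕜}
      {g w : EuclideanSpace ℝ (Fin n) → ℝ≥0∞} {D : ℝ≥0∞}, Measurable f → Measurable g →
      Measurable w →
      (∀ᵐ y, ∀ᵐ v, ‖orderDiff (m + 1) v f y‖ₑ ≤ C₀ * (‖v‖ₑ ^ (m + 1) *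
          ∫⁻ t in Ioc (0 : ℝ) (m + 1 : ℕ), ENNReal.ofReal (t ^ m) * g (y + t • v))) →
      (∀ G : EuclideanSpace ℝ (Fin n) → ℝ≥0∞, Measurable G →
        ∫⁻ x, centredMaximal volume G x ^ (p / u) * w x ≤ D * ∫⁻ x, G x ^ (p / u) * w x) →
      ∀ s r : ℝ, 0 < s → s < 1 → 0 < r →
        ENNReal.ofReal ((1 - s) ^ (1 / q)) * (∫⁻ x,
          (∫⁻ h in Metric.ball (0 : EuclideanSpace ℝ (Fin n)) r, ‖orderDiff (m + 1) h f x‖ₑ ^ q /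
            ENNReal.ofReal (‖h‖ ^ ((n : ℝ) + s * (m + 1 : ℕ) * q))) ^ (p / q) * w x) ^ (1 / p) ≤
        C * D ^ (1 / p) * ENNReal.ofReal (r ^ ((1 - s) * (m + 1 : ℕ))) *
          (∫⁻ x, g x ^ p * w x) ^ (1 / p) := by
  obtain ⟨C₁, hC₁, h₁⟩ := exists_setLIntegral_orderDiff_le_tsum (𝕜 := 𝕜) n m hu hq hlt hC₀
  obtain ⟨C₂, hC₂, h₂⟩ := exists_scale_mean_le_centredMaximal n m hu hq
  have hp0 : 0 < p := by linarith
  have hu0 : 0 < u := by linarith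
  have hq0 : 0 < q := by linarith
  have hpq : 0 < p / q := by positivity
  refine ⟨(2 * C₁ * C₂) ^ (1 / q), ?_, ?_⟩
  · have : 0 ≤ 1 / q := by positivity
    finiteness
  intro f g w D hf hg hw hfg hD s r hs0 hs1 hr
  set k : ℕ := m + 1 with hk
  have hk1 : (1 : ℝ) ≤ k := by exact_mod_cast Nat.succ_pos m
  have h1s : 0 < 1 - s := by linarith
  set b : ℝ := (1 - s) * k * q with hb
  have hbs : 1 - s ≤ b := by
    rw [hb, mul_assoc]
    exact le_mul_of_one_le_right h1s.le (one_le_mul_of_one_le_of_one_le hk1 hq)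
  set M := centredMaximal volume (fun z => g z ^ u) with hM
  have hMm : Measurable M := measurable_centredMaximal (hg.pow_const u)
  set H : ℝ≥0∞ := 2 * C₁ * C₂ * ENNReal.ofReal (r ^ b) * ENNReal.ofReal (1 - s)⁻¹ with hH
  have hHt : H ≠ ∞ := by finiteness
  have hpt : ∀ᵐ x, ∫⁻ h in Metric.ball (0 : EuclideanSpace ℝ (Fin n)) r,
      ‖orderDiff k h f x‖ₑ ^ q / ENNReal.ofReal (‖h‖ ^ ((n : ℝ) + s * k * q)) ≤
        H * M x ^ (q / u) := by
    filter_upwards [h₁ hf hg hfg] with x hx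
    refine (hx s r hs0 hs1 hr).trans ?_
    calc _ ≤ C₁ * ENNReal.ofReal (r ^ b) * ∑' j : ℕ, ENNReal.ofReal ((1 / 2) ^ b) ^ j *
          (C₂ * M x ^ (q / u)) := by
          refine mul_le_mul_right (ENNReal.tsum_le_tsum fun j => mul_le_mul_right ?_ _) _
          exact h₂ hg x _ (by positivity)
      _ ≤ C₁ * ENNReal.ofReal (r ^ b) * (ENNReal.ofReal (2 / (1 - s)) * (C₂ * M x ^ (q / u))) := by
          rw [ENNReal.tsum_mul_right]
          exact mul_le_mul_right (mul_le_mul_left (tsum_half_rpow_le hs0 hs1 hbs) _) _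
      _ = _ := by
          rw [div_eq_mul_inv, ENNReal.ofReal_mul (by norm_num), ENNReal.ofReal_ofNat, hH]
          ring
  have hint : ∫⁻ x, (∫⁻ h in Metric.ball (0 : EuclideanSpace ℝ (Fin n)) r,
      ‖orderDiff k h f x‖ₑ ^ q / ENNReal.ofReal (‖h‖ ^ ((n : ℝ) + s * k * q))) ^ (p / q) * w x ≤
        H ^ (p / q) * (D * ∫⁻ x, g x ^ p * w x) := by
    calc _ ≤ ∫⁻ x, H ^ (p / q) * (M x ^ (p / u) * w x) := by
          refine lintegral_mono_ae ?_
          filter_upwards [hpt] with x hx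
          calc _ ≤ (H * M x ^ (q / u)) ^ (p / q) * w x :=
                mul_le_mul_left (ENNReal.rpow_le_rpow hx hpq.le) _
            _ = _ := by
                rw [ENNReal.mul_rpow_of_nonneg _ _ hpq.le, ← ENNReal.rpow_mul, mul_assoc]
                congr 3
                field_simp
      _ = H ^ (p / q) * ∫⁻ x, M x ^ (p / u) * w x :=
          lintegral_const_mul _ (by fun_prop)
      _ ≤ H ^ (p / q) * (D * ∫⁻ x, (g x ^ u) ^ (p / u) * w x) :=
          mul_le_mul_right (hD _ (hg.pow_const u)) _
      _ = _ := by
          congr 2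
          refine lintegral_congr fun x => ?_
          rw [← ENNReal.rpow_mul, mul_div_cancel₀ _ hu0.ne']
  calc _ ≤ ENNReal.ofReal ((1 - s) ^ (1 / q)) *
        (H ^ (p / q) * (D * ∫⁻ x, g x ^ p * w x)) ^ (1 / p) :=
        mul_le_mul_right (ENNReal.rpow_le_rpow hint (by positivity)) _
    _ = (ENNReal.ofReal ((1 - s) ^ (1 / q)) * H ^ (1 / q)) * (D ^ (1 / p) *
        (∫⁻ x, g x ^ p * w x) ^ (1 / p)) := by
        have e : (H ^ (p / q)) ^ (1 / p) = H ^ (1 / q) := by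
          rw [← ENNReal.rpow_mul]
          congr 1
          field_simp
        rw [ENNReal.mul_rpow_of_nonneg (H ^ (p / q)) _ (by positivity), e,
          ENNReal.mul_rpow_of_nonneg D _ (by positivity), mul_assoc]
    _ = ((2 * C₁ * C₂) ^ (1 / q) * ENNReal.ofReal (r ^ ((1 - s) * k))) * (D ^ (1 / p) *
        (∫⁻ x, g x ^ p * w x) ^ (1 / p)) := by
        congr 1
        have e1 : ENNReal.ofReal (r ^ b) ^ (1 / q) = ENNReal.ofReal (r ^ ((1 - s) * k)) := by
          rw [ENNReal.ofReal_rpow_of_nonneg (by positivity) (by positivity), ← Real.rpow_mul hr.le,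
            hb, mul_one_div, mul_div_cancel_right₀ _ hq0.ne']
        have e2 : ENNReal.ofReal ((1 - s) ^ (1 / q)) * ENNReal.ofReal (1 - s)⁻¹ ^ (1 / q) = 1 := by
          rw [ENNReal.ofReal_rpow_of_nonneg (by positivity) (by positivity),
            ← ENNReal.ofReal_mul (by positivity), ← Real.mul_rpow (by positivity) (by positivity),
            mul_inv_cancel₀ h1s.ne', Real.one_rpow, ENNReal.ofReal_one]
        rw [hH, ENNReal.mul_rpow_of_nonneg _ (ENNReal.ofReal (1 - s)⁻¹) (by positivity),
          ENNReal.mul_rpow_of_nonneg _ (ENNReal.ofReal (r ^ b)) (by positivity), e1, mul_left_comm,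
          e2, mul_one]
    _ = _ := by ring

end GagliardoBounds

/-! ### The endpoint exponent one -/

section EndpointOne

variable {n : ℕ} {𝕜 : Type*} [RCLike 𝕜]

/-- Ball means are symmetric operators. -/
lemma lintegral_unitBallMean_mul {g w : EuclideanSpace ℝ (Fin n) → ℝ≥0∞} (hg : Measurable g)
    (hw : Measurable w) (τ : ℝ) :
    ∫⁻ x, unitBallMean g x τ * w x = ∫⁻ x, g x * unitBallMean w x τ := by
  have h1 : ∀ x, unitBallMean w x τ =
      ∫⁻ v in Metric.ball (0 : EuclideanSpace ℝ (Fin n)) 1, w (x - τ • v) := by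
    intro x
    unfold unitBallMean
    rw [← lintegral_indicator measurableSet_ball, ← lintegral_indicator measurableSet_ball,
      ← lintegral_neg_eq_self]
    refine lintegral_congr fun v => ?_
    have : -v ∈ Metric.ball (0 : EuclideanSpace ℝ (Fin n)) 1 ↔
        v ∈ Metric.ball (0 : EuclideanSpace ℝ (Fin n)) 1 := by simp
    by_cases hv : v ∈ Metric.ball (0 : EuclideanSpace ℝ (Fin n)) 1
    · rw [indicator_of_mem (this.2 hv), indicator_of_mem hv, smul_neg, sub_eq_add_neg]
    · rw [indicator_of_notMem (mt this.1 hv), indicator_of_notMem hv]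
  calc _ = ∫⁻ x, ∫⁻ v in Metric.ball (0 : EuclideanSpace ℝ (Fin n)) 1, g (x + τ • v) * w x := by
        refine lintegral_congr fun x => ?_
        unfold unitBallMean
        rw [lintegral_mul_const _ (by fun_prop)]
    _ = ∫⁻ v in Metric.ball (0 : EuclideanSpace ℝ (Fin n)) 1, ∫⁻ x, g (x + τ • v) * w x :=
        lintegral_lintegral_swap (by fun_prop)
    _ = ∫⁻ v in Metric.ball (0 : EuclideanSpace ℝ (Fin n)) 1, ∫⁻ x, g x * w (x - τ • v) := by
        refine lintegral_congr fun v => ?_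
        rw [← lintegral_add_right_eq_self (fun x => g x * w (x - τ • v)) (τ • v)]
        simp
    _ = ∫⁻ x, ∫⁻ v in Metric.ball (0 : EuclideanSpace ℝ (Fin n)) 1, g x * w (x - τ • v) :=
        lintegral_lintegral_swap (by fun_prop)
    _ = _ := by
        refine lintegral_congr fun x => ?_
        rw [h1, lintegral_const_mul _ (by fun_prop)]

/-- A weight that dominates its means over balls makes these means bounded operators on `L^1(w)`. -/
lemma lintegral_unitBallMean_mul_le {g w : EuclideanSpace ℝ (Fin n) → ℝ≥0∞} (hg : Measurable g)
    (hw : Measurable w) {K : ℝ≥0∞} {τ : ℝ} (h : ∀ᵐ z, unitBallMean w z τ ≤ K * w z) :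
    ∫⁻ x, unitBallMean g x τ * w x ≤ K * ∫⁻ x, g x * w x := by
  rw [lintegral_unitBallMean_mul hg hw, ← lintegral_const_mul _ (by fun_prop)]
  refine lintegral_mono_ae ?_
  filter_upwards [h] with x hx
  calc _ ≤ g x * (K * w x) := mul_le_mul_right hx _
    _ = _ := by ring

lemma lintegral_radialMean_mul_le (m : ℕ) {g w : EuclideanSpace ℝ (Fin n) → ℝ≥0∞}
    (hg : Measurable g) (hw : Measurable w) {K : ℝ≥0∞}
    (h : ∀ τ : ℝ, 0 < τ → ∀ᵐ z, unitBallMean w z τ ≤ K * w z) {R : ℝ} (hR : 0 < R) :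
    ∫⁻ x, radialMean m g x R * w x ≤
      ((m + 1 : ℕ) : ℝ≥0∞) ^ (m + 1) * (K * ∫⁻ x, g x * w x) := by
  have hm : Measurable fun z : EuclideanSpace ℝ (Fin n) × ℝ =>
      ENNReal.ofReal (z.2 ^ m) * unitBallMean g z.1 (z.2 * R) := by
    refine Measurable.mul (by fun_prop) ?_
    exact hg.unitBallMean.comp (f := fun z : EuclideanSpace ℝ (Fin n) × ℝ => (z.1, z.2 * R))
      (by fun_prop)
  calc _ = ∫⁻ x, ∫⁻ t in Ioc (0 : ℝ) (m + 1 : ℕ),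
          ENNReal.ofReal (t ^ m) * unitBallMean g x (t * R) * w x := by
        refine lintegral_congr fun x => ?_
        unfold radialMean
        have hmx : Measurable fun t : ℝ => ENNReal.ofReal (t ^ m) * unitBallMean g x (t * R) :=
          hm.comp measurable_prodMk_left
        rw [lintegral_mul_const _ hmx]
    _ = ∫⁻ t in Ioc (0 : ℝ) (m + 1 : ℕ), ∫⁻ x,
          ENNReal.ofReal (t ^ m) * unitBallMean g x (t * R) * w x :=
        lintegral_lintegral_swap (hm.mul (by fun_prop)).aemeasurable
    _ ≤ ∫⁻ t in Ioc (0 : ℝ) (m + 1 : ℕ), ENNReal.ofReal (t ^ m) * (K * ∫⁻ x, g x * w x) := by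
        refine setLIntegral_mono' measurableSet_Ioc fun t ht => ?_
        simp only [mul_assoc]
        rw [lintegral_const_mul' _ _ ENNReal.ofReal_ne_top]
        exact mul_le_mul_right
          (lintegral_unitBallMean_mul_le hg hw (h _ (mul_pos ht.1 hR))) _
    _ ≤ _ := by
        rw [lintegral_mul_const _ (by fun_prop)]
        exact mul_le_mul_left (lintegral_Ioc_pow_le m) _

/-- Bound of the Gagliardo quantity in the endpoint case `p = 1`, where the maximal function is not
available and the dyadic scales are integrated one by one. -/
lemma exists_lintegral_orderDiff_le_of_unitBallMean_le (n m : ℕ) {q : ℝ}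
    (hq : 1 ≤ q) (hlt : (n : ℝ) * (1 - 1 / q) < (m + 1 : ℕ)) {C₀ : ℝ≥0∞} (hC₀ : C₀ ≠ ∞) :
    ∃ C : ℝ≥0∞, C ≠ ∞ ∧ ∀ {f : EuclideanSpace ℝ (Fin n) → 𝕜}
      {g w : EuclideanSpace ℝ (Fin n) → ℝ≥0∞} {K : ℝ≥0∞}, Measurable f → Measurable g →
      Measurable w →
      (∀ᵐ y, ∀ᵐ v, ‖orderDiff (m + 1) v f y‖ₑ ≤ C₀ * (‖v‖ₑ ^ (m + 1) *
          ∫⁻ t in Ioc (0 : ℝ) (m + 1 : ℕ), ENNReal.ofReal (t ^ m) * g (y + t • v))) →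
      (∀ τ : ℝ, 0 < τ → ∀ᵐ z, unitBallMean w z τ ≤ K * w z) →
      ∀ s r : ℝ, 0 < s → s < 1 → 0 < r →
        ENNReal.ofReal (1 - s) * ∫⁻ x,
          (∫⁻ h in Metric.ball (0 : EuclideanSpace ℝ (Fin n)) r, ‖orderDiff (m + 1) h f x‖ₑ ^ q /
            ENNReal.ofReal (‖h‖ ^ ((n : ℝ) + s * (m + 1 : ℕ) * q))) ^ (1 / q) * w x ≤
        C * K * ENNReal.ofReal (r ^ ((1 - s) * (m + 1 : ℕ))) * ∫⁻ x, g x * w x := by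
  obtain ⟨C₁, hC₁, h₁⟩ := exists_setLIntegral_orderDiff_le_tsum (𝕜 := 𝕜) n m le_rfl hq
    (by rwa [div_one]) hC₀
  have hq0 : 0 < q := by linarith
  have hq1 : 0 < 1 / q := by positivity
  have hq1' : 1 / q ≤ 1 := by rw [div_le_one hq0]; exact hq
  refine ⟨2 * C₁ ^ (1 / q) * (((m + 1 : ℕ) : ℝ≥0∞) ^ (m + 1) + (m + 1 : ℕ)), ?_, ?_⟩
  · have h1 : ((m + 1 : ℕ) : ℝ≥0∞) ≠ ∞ := ENNReal.natCast_ne_top _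
    have := hq1.le
    finiteness
  intro f g w K hf hg hw hfg hA s r hs0 hs1 hr
  set k : ℕ := m + 1 with hk
  have hk1 : (1 : ℝ) ≤ k := by exact_mod_cast Nat.succ_pos m
  have h1s : 0 < 1 - s := by linarith
  set b : ℝ := (1 - s) * k with hb
  have hbs : 1 - s ≤ b := le_mul_of_one_le_right h1s.le hk1
  set I := ∫⁻ x, g x * w x with hI
  set U : ℕ → ℕ → EuclideanSpace ℝ (Fin n) → ℝ≥0∞ := fun j l x =>
    unitBallMean g x (((k : ℝ) + 1) * (((l + 1 : ℕ) : ℝ) * (r * (1 / 2) ^ j))) with hU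
  have hUm : ∀ j l, Measurable (U j l) := fun j l =>
    hg.unitBallMean.comp (f := fun x : EuclideanSpace ℝ (Fin n) =>
      (x, ((k : ℝ) + 1) * (((l + 1 : ℕ) : ℝ) * (r * (1 / 2) ^ j)))) (by fun_prop)
  set Rd : ℕ → EuclideanSpace ℝ (Fin n) → ℝ≥0∞ := fun j x =>
    radialMean m g x ((k + 1) * (r * (1 / 2) ^ j)) with hRd
  have hRm : ∀ j, Measurable (Rd j) := fun j => measurable_radialMean m hg _
  set θ := ENNReal.ofReal ((1 / 2) ^ b) with hθ
  have hpt : ∀ᵐ x, (∫⁻ h in Metric.ball (0 : EuclideanSpace ℝ (Fin n)) r,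
      ‖orderDiff k h f x‖ₑ ^ q / ENNReal.ofReal (‖h‖ ^ ((n : ℝ) + s * k * q))) ^ (1 / q) ≤
        C₁ ^ (1 / q) * ENNReal.ofReal (r ^ b) *
          ∑' j : ℕ, θ ^ j * (Rd j x + ∑ l ∈ Finset.range k, U j l x) := by
    filter_upwards [h₁ hf hg hfg] with x hx
    have e1 : ENNReal.ofReal (r ^ (b * q)) ^ (1 / q) = ENNReal.ofReal (r ^ b) := by
      rw [ENNReal.ofReal_rpow_of_nonneg (by positivity) hq1.le, ← Real.rpow_mul hr.le,
        mul_one_div, mul_div_cancel_right₀ _ hq0.ne']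
    have e2 : ∀ j : ℕ, (ENNReal.ofReal ((1 / 2) ^ (b * q)) ^ j) ^ (1 / q) = θ ^ j := by
      intro j
      have e3 : (((1 / 2 : ℝ) ^ (b * q)) ^ j) ^ (1 / q) = ((1 / 2) ^ b) ^ j := by
        rw [← Real.rpow_mul_natCast (by norm_num), ← Real.rpow_mul (by norm_num),
          ← Real.rpow_mul_natCast (by norm_num)]
        congr 1
        field_simp
      rw [← ENNReal.ofReal_pow (by positivity),
          ENNReal.ofReal_rpow_of_nonneg (by positivity) hq1.le,
        hθ, ← ENNReal.ofReal_pow (by positivity), e3]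
    refine (ENNReal.rpow_le_rpow (hx s r hs0 hs1 hr) hq1.le).trans ?_
    rw [ENNReal.mul_rpow_of_nonneg _ _ hq1.le, ENNReal.mul_rpow_of_nonneg _ _ hq1.le, e1]
    refine mul_le_mul_right ((tsum_rpow_le hq1 hq1' _).trans (ENNReal.tsum_le_tsum fun j => ?_)) _
    rw [ENNReal.mul_rpow_of_nonneg _ _ hq1.le, e2]
    refine mul_le_mul_right ((ENNReal.rpow_add_le_add_rpow _ _ hq1.le hq1').trans
      (add_le_add ?_ ((sum_range_rpow_le hq1 hq1' _ _).trans
        (Finset.sum_le_sum fun l _ => ?_)))) _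
    · rw [← ENNReal.rpow_mul, mul_one_div_cancel hq0.ne', ENNReal.rpow_one]
    · simp only [ENNReal.rpow_one, div_one]
      rw [← ENNReal.rpow_mul, mul_one_div_cancel hq0.ne', ENNReal.rpow_one]
  have hsum : ∫⁻ x, (∑' j : ℕ, θ ^ j * (Rd j x + ∑ l ∈ Finset.range k, U j l x)) * w x ≤
      ENNReal.ofReal (2 / (1 - s)) * (((k : ℝ≥0∞) ^ (m + 1) + k) * (K * I)) := by
    have hYm : ∀ j, Measurable fun x => (Rd j x + ∑ l ∈ Finset.range k, U j l x) := fun j =>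
      (hRm j).add (Finset.measurable_fun_sum _ fun l _ => hUm j l)
    calc _ = ∑' j : ℕ, θ ^ j * ∫⁻ x, (Rd j x + ∑ l ∈ Finset.range k, U j l x) * w x := by
          simp only [← ENNReal.tsum_mul_right]
          have hYw : ∀ j, Measurable fun x =>
              θ ^ j * (Rd j x + ∑ l ∈ Finset.range k, U j l x) * w x := fun j =>
            ((hYm j).const_mul _).mul hw
          rw [lintegral_tsum fun j => (hYw j).aemeasurable]
          congr 1
          funext j
          simp only [mul_assoc]
          exact lintegral_const_mul' _ _ (by finiteness)
      _ ≤ ∑' j : ℕ, θ ^ j * (((k : ℝ≥0∞) ^ (m + 1) + k) * (K * I)) := by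
          refine ENNReal.tsum_le_tsum fun j => mul_le_mul_right ?_ _
          simp only [add_mul, Finset.sum_mul]
          have hRw : Measurable fun x => Rd j x * w x := (hRm j).mul hw
          have hUw : ∀ l, Measurable fun x => U j l x * w x := fun l => (hUm j l).mul hw
          rw [lintegral_add_left hRw, lintegral_finsetSum _ fun l _ => hUw l]
          refine add_le_add (lintegral_radialMean_mul_le m hg hw hA (by positivity)) ?_
          calc _ ≤ ∑ _l ∈ Finset.range k, K * I := Finset.sum_le_sum fun l _ =>
                lintegral_unitBallMean_mul_le hg hw (hA _ (by positivity))
            _ = _ := by rw [Finset.sum_const, Finset.card_range, nsmul_eq_mul]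
      _ ≤ _ := by
          rw [ENNReal.tsum_mul_right]
          exact mul_le_mul_left (tsum_half_rpow_le hs0 hs1 hbs) _
  calc _ ≤ ENNReal.ofReal (1 - s) * (C₁ ^ (1 / q) * ENNReal.ofReal (r ^ b) *
        (ENNReal.ofReal (2 / (1 - s)) * (((k : ℝ≥0∞) ^ (m + 1) + k) * (K * I)))) := by
        refine mul_le_mul_right (le_trans (lintegral_mono_ae ?_)
          ((lintegral_const_mul' _ _ ?_).trans_le (mul_le_mul_right hsum _))) _
        · filter_upwards [hpt] with x hx
          rw [← mul_assoc]
          exact mul_le_mul_left hx _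
        · have := hq1.le
          finiteness
    _ = (ENNReal.ofReal (1 - s) * ENNReal.ofReal (2 / (1 - s))) * (C₁ ^ (1 / q) *
          ENNReal.ofReal (r ^ b) * (((k : ℝ≥0∞) ^ (m + 1) + k) * (K * I))) := by ring
    _ = _ := by
        rw [← ENNReal.ofReal_mul h1s.le, mul_div_cancel₀ _ h1s.ne', ENNReal.ofReal_ofNat]
        ring

end EndpointOne

/-! ### The estimates for Muckenhoupt weights -/

section Reduction

variable {n : ℕ} {𝕜 : Type*} [RCLike 𝕜]

/-- Changing a function on a null set does not affect its differences at almost every base point,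
for almost every step. -/
lemma ae_ae_orderDiff_eq {f f' : EuclideanSpace ℝ (Fin n) → 𝕜} (h : f =ᵐ[volume] f') (k : ℕ) :
    ∀ᵐ x, ∀ᵐ v, orderDiff k v f x = orderDiff k v f' x := by
  filter_upwards [h] with x hx
  have h1 : ∀ᵐ v : EuclideanSpace ℝ (Fin n), ∀ j : ℕ,
      f (x + (j : ℝ) • v) = f' (x + (j : ℝ) • v) := by
    rw [ae_all_iff]
    intro j
    rcases Nat.eq_zero_or_pos j with rfl | hj
    · simp [hx]
    · have h2 : ∀ᵐ z : EuclideanSpace ℝ (Fin n), f (x + z) = f' (x + z) :=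
        (quasiMeasurePreserving_add_left volume x).ae h
      exact (quasiMeasurePreserving_smul (by positivity : (j : ℝ) ≠ 0)).ae h2
  filter_upwards [h1] with v hv
  unfold orderDiff
  exact Finset.sum_congr rfl fun j _ => by rw [hv j]

/-- The function and the weight may be replaced by measurable representatives. -/
lemma localGagliardo_congr {k : ℕ} {p q s r : ℝ} {ω : EuclideanSpace ℝ (Fin n) → ℝ}
    {w : EuclideanSpace ℝ (Fin n) → ℝ≥0∞} {f f' : EuclideanSpace ℝ (Fin n) → 𝕜}
    (hf : f =ᵐ[volume] f') (hw : (fun x => ENNReal.ofReal (ω x)) =ᵐ[volume] w) :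
    localGagliardo k p q s r ω f = (∫⁻ x,
      (∫⁻ h in Metric.ball (0 : EuclideanSpace ℝ (Fin n)) r, ‖orderDiff k h f' x‖ₑ ^ q /
        ENNReal.ofReal (‖h‖ ^ ((n : ℝ) + s * k * q))) ^ (p / q) * w x) ^ (1 / p) := by
  unfold localGagliardo
  congr 1
  refine lintegral_congr_ae ?_
  filter_upwards [ae_ae_orderDiff_eq hf k, hw] with x hx hx2
  rw [hx2]
  congr 2
  refine lintegral_congr_ae (ae_restrict_of_ae ?_)
  filter_upwards [hx] with v hv
  rw [hv]

lemma localGagliardo_eq_zero {k : ℕ} {p q s r : ℝ} (hp : 0 < p)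
    {ω : EuclideanSpace ℝ (Fin n) → ℝ} {f : EuclideanSpace ℝ (Fin n) → 𝕜}
    (hw : (fun x => ENNReal.ofReal (ω x)) =ᵐ[volume] 0) : localGagliardo k p q s r ω f = 0 := by
  rw [localGagliardo_congr (Filter.EventuallyEq.refl _ f) hw]
  simp [hp]

lemma weightedLpNorm_congr {p : ℝ} {ω : EuclideanSpace ℝ (Fin n) → ℝ}
    {w g : EuclideanSpace ℝ (Fin n) → ℝ≥0∞} {F : EuclideanSpace ℝ (Fin n) → ℝ}
    (hF : (fun x => ‖F x‖ₑ) =ᵐ[volume] g)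
    (hw : (fun x => ENNReal.ofReal (ω x)) =ᵐ[volume] w) :
    weightedLpNorm p ω F = (∫⁻ x, g x ^ p * w x) ^ (1 / p) := by
  unfold weightedLpNorm
  congr 1
  refine lintegral_congr_ae ?_
  filter_upwards [hF, hw] with x h1 h2
  rw [h1, h2]

lemma exists_pos_real_of_ne_top {C : ℝ≥0∞} (hC : C ≠ ∞) : ∃ c : ℝ, 0 < c ∧ C ≤ ENNReal.ofReal c :=
  ⟨C.toReal + 1, by positivity, ENNReal.le_ofReal_iff_toReal_le hC (by positivity) |>.2
    (by linarith)⟩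

/-- The estimate for `A_1` weights. -/
lemma exists_localGagliardo_le_of_A1 (𝕜 : Type*) [RCLike 𝕜] (n m : ℕ) {p q : ℝ} (hp : 1 ≤ p)
    (hq : 1 ≤ q) (hlt : (n : ℝ) * (1 / p - 1 / q) < (m + 1 : ℕ)) :
    ∃ C : ℝ, 0 < C ∧ ∀ ω : EuclideanSpace ℝ (Fin n) → ℝ, IsMuckenhoupt 1 ω →
      ∀ s : ℝ, 0 < s → s < 1 → ∀ r : ℝ, 0 < r →
      ∀ f : EuclideanSpace ℝ (Fin n) → 𝕜, MemHomSobolev (m + 1) p ω f →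
        ENNReal.ofReal ((1 - s) ^ gammaExponent p q) * localGagliardo (m + 1) p q s r ω f ≤
          ENNReal.ofReal C * muckenhouptConst 1 ω ^ (1 / p) *
            ENNReal.ofReal (r ^ ((1 - s) * (m + 1 : ℕ))) *
              weightedLpNorm p ω (weakGradLength (m + 1) f) := by
  have hC₀ : ((n : ℝ≥0∞) ^ (m + 1) * 2 ^ (m + 1)) ≠ ∞ := by finiteness
  rcases hp.eq_or_lt with rfl | hp1
  · obtain ⟨C, hC, h⟩ := exists_lintegral_orderDiff_le_of_unitBallMean_le (𝕜 := 𝕜) n m hq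
      (by rwa [div_one] at hlt) hC₀
    obtain ⟨c, hc, hCc⟩ := exists_pos_real_of_ne_top (C := C * 4 ^ n) (by finiteness)
    refine ⟨c, hc, fun ω hω s hs0 hs1 r hr f hf => ?_⟩
    rcases hω.ae_eq_zero_or_exists le_rfl with h0 | ⟨w, hw, hw0, hwt, hww⟩
    · rw [localGagliardo_eq_zero one_pos h0, mul_zero]; exact zero_le
    obtain ⟨f', hf'm, hff', g, hgm, hg, hb⟩ := exists_pointwise_bound hf.1 fun α hα => (hf.2 α hα).1
    rw [localGagliardo_congr hff' hww, weightedLpNorm_congr hg hww, gammaExponent, if_pos rfl]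
    have := h hf'm hgm hw hb (fun τ hτ => ae_unitBallMean_le_muckenhouptConst_one hw0 hwt hww hτ)
      s r hs0 hs1 hr
    simp only [div_one, ENNReal.rpow_one, Real.rpow_one]
    refine this.trans ?_
    rw [← mul_assoc C]
    gcongr
  -- the condition on `n`, `p`, `q`, `k` is open, so it survives for some `u < p`
  · obtain ⟨u, hu1, hup, hult⟩ : ∃ u : ℝ, 1 ≤ u ∧ u < p ∧
        (n : ℝ) * (1 / u - 1 / q) < (m + 1 : ℕ) := by
      have hcont : Filter.Tendsto (fun u : ℝ => (n : ℝ) * (1 / u - 1 / q)) (nhdsWithin p (Iio p))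
          (nhds ((n : ℝ) * (1 / p - 1 / q))) := by
        refine Filter.Tendsto.mono_left ?_ nhdsWithin_le_nhds
        have : ContinuousAt (fun u : ℝ => (n : ℝ) * (1 / u - 1 / q)) p := by
          have : p ≠ 0 := by positivity
          fun_prop (disch := assumption)
        exact this
      obtain ⟨u, hu1, hu2⟩ := ((hcont.eventually_lt_const hlt).and (Ioo_mem_nhdsLT hp1)).exists
      exact ⟨u, hu2.1.le, hu2.2, hu1⟩
    have hu0 : 0 < u := by linarith
    have ht : 1 < p / u := by rwa [one_lt_div hu0]
    obtain ⟨C, hC, h⟩ := exists_lintegral_orderDiff_le_of_maximal (𝕜 := 𝕜) n m hp hu1 hq hult hC₀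
    obtain ⟨C', hC', h'⟩ := exists_lintegral_centredMaximal_rpow_mul_le_of_A1 n ht
    have hp0 : 0 ≤ 1 / p := by positivity
    obtain ⟨c, hc, hCc⟩ := exists_pos_real_of_ne_top (C := C * (C' * cubeBallRatio n) ^ (1 / p))
      (by have := cubeBallRatio_ne_top n; finiteness)
    refine ⟨c, hc, fun ω hω s hs0 hs1 r hr f hf => ?_⟩
    rcases hω.ae_eq_zero_or_exists le_rfl with h0 | ⟨w, hw, hw0, hwt, hww⟩
    · rw [localGagliardo_eq_zero (by linarith) h0, mul_zero]; exact zero_le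
    obtain ⟨f', hf'm, hff', g, hgm, hg, hb⟩ := exists_pointwise_bound hf.1 fun α hα => (hf.2 α hα).1
    rw [localGagliardo_congr hff' hww, weightedLpNorm_congr hg hww, gammaExponent,
      if_neg hp1.ne']
    have := h hf'm hgm hw hb (h' w _ hw fun x r hr =>
      ae_lintegral_closedBall_le_muckenhouptConst_one hw0 hwt hww x hr) s r hs0 hs1 hr
    refine this.trans ?_
    rw [← mul_assoc C', ENNReal.mul_rpow_of_nonneg _ _ hp0, ← mul_assoc C]
    gcongr

/-- The estimate for weights in `A_β` with `1 < β < p`. -/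
lemma exists_localGagliardo_le_of_lt (𝕜 : Type*) [RCLike 𝕜] (n m : ℕ) {p q β : ℝ} (hβ : 1 < β)
    (hβp : β < p) (hq : 1 ≤ q) (hlt : (n : ℝ) * (β / p - 1 / q) < (m + 1 : ℕ)) :
    ∃ C : ℝ, 0 < C ∧ ∀ ω : EuclideanSpace ℝ (Fin n) → ℝ, IsMuckenhoupt β ω →
      ∀ s : ℝ, 0 < s → s < 1 → ∀ r : ℝ, 0 < r →
      ∀ f : EuclideanSpace ℝ (Fin n) → 𝕜, MemHomSobolev (m + 1) p ω f →
        ENNReal.ofReal ((1 - s) ^ (1 / q)) * localGagliardo (m + 1) p q s r ω f ≤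
          ENNReal.ofReal C * muckenhouptConst β ω ^ (β / (p * (β - 1))) *
            ENNReal.ofReal (r ^ ((1 - s) * (m + 1 : ℕ))) *
              weightedLpNorm p ω (weakGradLength (m + 1) f) := by
  have hC₀ : ((n : ℝ≥0∞) ^ (m + 1) * 2 ^ (m + 1)) ≠ ∞ := by finiteness
  have hβ0 : 0 < β := by linarith
  have hp0 : 0 < p := by linarith
  have hu1 : 1 ≤ p / β := by rw [one_le_div hβ0]; exact hβp.le
  obtain ⟨C, hC, h⟩ := exists_lintegral_orderDiff_le_of_maximal (𝕜 := 𝕜) n m (p := p) (u := p / β)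
    (by linarith) hu1 hq (by rwa [one_div_div]) hC₀
  obtain ⟨C', hC', h'⟩ := exists_lintegral_centredMaximal_rpow_mul_le n hβ
  have hp0' : 0 ≤ 1 / p := by positivity
  have hβ1 : 0 ≤ β / (β - 1) := div_nonneg hβ0.le (by linarith)
  obtain ⟨c, hc, hCc⟩ := exists_pos_real_of_ne_top
    (C := C * (C' * (cubeBallRatio n ^ β) ^ (β / (β - 1))) ^ (1 / p))
    (by have := cubeBallRatio_ne_top n; have := hβ0.le; finiteness)
  refine ⟨c, hc, fun ω hω s hs0 hs1 r hr f hf => ?_⟩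
  rcases hω.ae_eq_zero_or_exists hβ.le with h0 | ⟨w, hw, hw0, hwt, hww⟩
  · rw [localGagliardo_eq_zero hp0 h0, mul_zero]; exact zero_le
  obtain ⟨f', hf'm, hff', g, hgm, hg, hb⟩ := exists_pointwise_bound hf.1 fun α hα => (hf.2 α hα).1
  rw [localGagliardo_congr hff' hww, weightedLpNorm_congr hg hww]
  have hpβ : p / (p / β) = β := by field_simp
  have := h hf'm hgm hw hb (D := C' * (cubeBallRatio n ^ β * muckenhouptConst β ω) ^ (β / (β - 1)))
    (by
      rw [hpβ]
      exact h' w _ hw hw0 hwt fun x r hr => hω.lintegral_closedBall_mul_le hβ hw0 hw hww x hr)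
    s r hs0 hs1 hr
  refine this.trans ?_
  have e : (muckenhouptConst β ω ^ (β / (β - 1))) ^ (1 / p) =
      muckenhouptConst β ω ^ (β / (p * (β - 1))) := by
    rw [← ENNReal.rpow_mul]
    congr 1
    rw [div_mul_div_comm, mul_one, mul_comm p]
  rw [ENNReal.mul_rpow_of_nonneg _ (muckenhouptConst β ω) hβ1, ← mul_assoc C',
    ENNReal.mul_rpow_of_nonneg _ _ hp0', e, ← mul_assoc C]
  gcongr

/-- The critical index of a weight in `A_p` is smaller than `p`, and `A_β` contains the weight for
each larger `β`. -/
lemma IsMuckenhoupt.muckenhouptIndex_lt (hn : 1 ≤ n) {ω : EuclideanSpace ℝ (Fin n) → ℝ} {p : ℝ}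
    (h : IsMuckenhoupt p ω) (hp : 1 < p) : 1 ≤ muckenhouptIndex ω ∧ muckenhouptIndex ω < p ∧
      ∀ β, muckenhouptIndex ω < β → IsMuckenhoupt β ω := by
  obtain ⟨r, hr1, hrp, hr⟩ := h.exists_lt hn hp
  have hne : {r : ℝ | 1 ≤ r ∧ IsMuckenhoupt r ω}.Nonempty := ⟨r, hr1, hr⟩
  have hbdd : BddBelow {r : ℝ | 1 ≤ r ∧ IsMuckenhoupt r ω} := ⟨1, fun x hx => hx.1⟩
  refine ⟨le_csInf hne fun x hx => hx.1, lt_of_le_of_lt (csInf_le hbdd ⟨hr1, hr⟩) hrp,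
    fun β hβ => ?_⟩
  obtain ⟨x, hx, hxβ⟩ := exists_lt_of_csInf_lt hne hβ
  exact hx.2.mono hx.1 hxβ

end Reduction

/-! ### Test functions in the Sobolev space -/

section SmoothFunctions

variable {n : ℕ} {𝕜 : Type*} [RCLike 𝕜]

lemma IsWeakPartial.ae_eq {α : Fin n → ℕ} {f g g' : EuclideanSpace ℝ (Fin n) → 𝕜}
    (h : IsWeakPartial α f g) (h' : IsWeakPartial α f g') : g =ᵐ[volume] g' := by
  refine ae_eq_of_integral_contDiff_smul_eq h.1 h'.1 fun φ hφ hφc => ?_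
  have h1 := (h.2 φ hφ hφc).symm.trans (h'.2 φ hφ hφc)
  exact smul_right_injective 𝕜 (pow_ne_zero _ (by norm_num)) h1

/-- Iterated integration by parts; the derivative falling on `φ` is some smooth function supported
in the support of `φ`. -/
lemma exists_integral_classicalMultiPartial_mul (N : ℕ) (α : Fin n → ℕ) (hα : ∑ i, α i = N)
    {φ : EuclideanSpace ℝ (Fin n) → ℝ} (hφ : ContDiff ℝ ((⊤ : ℕ∞) : WithTop ℕ∞) φ)
    (hφc : HasCompactSupport φ) :
    ∃ g : EuclideanSpace ℝ (Fin n) → ℝ, Continuous g ∧ tsupport g ⊆ tsupport φ ∧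
      ∀ ψ : EuclideanSpace ℝ (Fin n) → ℝ, ContDiff ℝ ((⊤ : ℕ∞) : WithTop ℕ∞) ψ →
        HasCompactSupport ψ →
        ∫ x, classicalMultiPartial α ψ x * φ x = (-1 : ℝ) ^ N * ∫ x, ψ x * g x := by
  induction N generalizing α φ with
  | zero =>
    have hα0 : α = 0 := by
      ext i
      exact (Finset.sum_eq_zero_iff.1 hα) i (Finset.mem_univ i)
    refine ⟨φ, hφ.continuous, subset_rfl, fun ψ _ _ => ?_⟩
    rw [hα0, classicalMultiPartial_zero, pow_zero, one_mul]
  | succ N ih =>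
    obtain ⟨i, hi⟩ : ∃ i, α i ≠ 0 := by
      by_contra! hcon
      simp [hcon] at hα
    set β : Fin n → ℕ := α - Pi.single i 1 with hβ
    have hαβ : β + Pi.single i 1 = α := by
      ext j
      rcases eq_or_ne j i with rfl | hj
      · simp [hβ]; omega
      · simp [hβ, hj]
    have hβN : ∑ j, β j = N := by
      have : ∑ j, (β + Pi.single i 1 : Fin n → ℕ) j = N + 1 := by rw [hαβ]; exact hα
      simp only [Pi.add_apply, Finset.sum_add_distrib, Finset.sum_pi_single', Finset.mem_univ,
        if_true] at this
      simpa using this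
    have hsupp := tsupport_classicalPartial_subset i φ
    have hc : HasCompactSupport (classicalPartial i φ) :=
        hφc.of_isClosed_subset isClosed_closure hsupp
    obtain ⟨g, hg, hgs, h⟩ := ih β hβN (hφ.classicalPartial i) hc
    refine ⟨g, hg, hgs.trans hsupp, fun ψ hψ hψc => ?_⟩
    have hψβ := hψ.classicalMultiPartial β
    have e : classicalMultiPartial α ψ = classicalPartial i (classicalMultiPartial β ψ) := by
      rw [classicalPartial_classicalMultiPartial _ hψ, hαβ]
    have hparts := integral_mul_fderiv_eq_neg_fderiv_mul_of_integrable (𝕜 := ℝ)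
      (μ := (volume : Measure (EuclideanSpace ℝ (Fin n)))) (f := φ)
      (g := classicalMultiPartial β ψ) (v := EuclideanSpace.single i 1)
      (((hφ.classicalPartial i).continuous.mul hψβ.continuous).integrable_of_hasCompactSupport
        hc.mul_right)
      ((hφ.continuous.mul (hψβ.classicalPartial i).continuous).integrable_of_hasCompactSupport
        hφc.mul_right)
      ((hφ.continuous.mul hψβ.continuous).integrable_of_hasCompactSupport hφc.mul_right)
      (fun x _ => hφ.differentiable (by simp) x) (fun x _ => hψβ.differentiable (by simp) x)
    have h2 := h ψ hψ hψc
    rw [e]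
    calc _ = ∫ x, φ x * fderiv ℝ (classicalMultiPartial β ψ) x (EuclideanSpace.single i 1) := by
          congr 1
          ext x
          exact mul_comm _ _
      _ = -∫ x, classicalMultiPartial β ψ x * classicalPartial i φ x := by
          rw [hparts]
          congr 2
          ext x
          exact mul_comm _ _
      _ = _ := by rw [h2, pow_succ]; ring

/-- The weak derivatives of a test function. -/
lemma exists_isWeakPartial_of_contDiff (𝕜 : Type*) [RCLike 𝕜]
    {φ : EuclideanSpace ℝ (Fin n) → ℝ} (hφ : ContDiff ℝ ((⊤ : ℕ∞) : WithTop ℕ∞) φ)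
    (hφc : HasCompactSupport φ) (α : Fin n → ℕ) :
    ∃ g : EuclideanSpace ℝ (Fin n) → ℝ, Continuous g ∧ tsupport g ⊆ tsupport φ ∧
      IsWeakPartial α (fun x => (φ x : 𝕜)) (fun x => (g x : 𝕜)) := by
  obtain ⟨g, hg, hgs, h⟩ := exists_integral_classicalMultiPartial_mul _ α rfl hφ hφc
  refine ⟨g, hg, hgs, (RCLike.continuous_ofReal.comp hg).locallyIntegrable, fun ψ hψ hψc => ?_⟩
  have e : ∀ a b : EuclideanSpace ℝ (Fin n) → ℝ, ∫ x, a x • (b x : 𝕜) =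
      ((∫ x, a x * b x : ℝ) : 𝕜) := by
    intro a b
    rw [← integral_ofReal]
    congr 1
    ext x
    rw [RCLike.real_smul_eq_coe_mul, RCLike.ofReal_mul]
  rw [e, e, h ψ hψ hψc, RCLike.real_smul_eq_coe_mul, RCLike.ofReal_mul]

/-- A test function and the length of its gradient of order `k`. -/
lemma exists_weakGradLength_ae_eq_of_contDiff (𝕜 : Type*) [RCLike 𝕜] (k : ℕ)
    {φ : EuclideanSpace ℝ (Fin n) → ℝ} (hφ : ContDiff ℝ ((⊤ : ℕ∞) : WithTop ℕ∞) φ)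
    (hφc : HasCompactSupport φ) :
    ∃ H : EuclideanSpace ℝ (Fin n) → ℝ, Continuous H ∧ HasCompactSupport H ∧
      (∀ x ∉ tsupport φ, H x = 0) ∧ weakGradLength k (fun x => (φ x : 𝕜)) =ᵐ[volume] H := by
  choose g hg hgs hgw using exists_isWeakPartial_of_contDiff 𝕜 hφ hφc
  have hzero : ∀ x ∉ tsupport φ, ∀ α, g α x = 0 := fun x hx α =>
    image_eq_zero_of_notMem_tsupport fun h => hx (hgs α h)
  have hH0 : ∀ x ∉ tsupport φ, √(∑ α ∈ multiIndices n k, g α x ^ 2) = 0 := fun x hx => by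
    simp [hzero x hx]
  refine ⟨fun x => √(∑ α ∈ multiIndices n k, g α x ^ 2), ?_, HasCompactSupport.intro hφc hH0,
    hH0, ?_⟩
  · have := hg
    fun_prop
  · have h1 : ∀ᵐ x, ∀ α ∈ multiIndices n k, weakPartial α (fun x => (φ x : 𝕜)) x = (g α x : 𝕜) := by
      rw [Filter.eventually_all_finset]
      exact fun α _ => (isWeakPartial_weakPartial ⟨_, hgw α⟩).ae_eq (hgw α)
    filter_upwards [h1] with x hx
    unfold weakGradLength
    congr 1
    refine Finset.sum_congr rfl fun α hα => ?_
    rw [hx α hα, RCLike.norm_ofReal, sq_abs]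

lemma weightedLpNorm_lt_top_of_continuous {p : ℝ} (hp : 1 ≤ p)
    {ω : EuclideanSpace ℝ (Fin n) → ℝ} {N : ℝ} (hω : ∀ x, ω x ≤ N)
    {H : EuclideanSpace ℝ (Fin n) → ℝ} (hH : Continuous H) (hHc : HasCompactSupport H) :
    weightedLpNorm p ω H < ∞ := by
  have hp0 : 0 < p := by linarith
  have h1 : ∫⁻ x, ‖H x‖ₑ ^ p < ∞ := by
    have h2 : MemLp H (ENNReal.ofReal p) volume := hH.memLp_of_hasCompactSupport hHc
    have h3 := lintegral_rpow_enorm_lt_top_of_eLpNorm_lt_top (by simpa using hp0)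
      ENNReal.ofReal_ne_top h2.2
    rwa [ENNReal.toReal_ofReal hp0.le] at h3
  refine ENNReal.rpow_lt_top_of_nonneg (by positivity) (ne_of_lt ?_)
  calc _ ≤ ∫⁻ x, ‖H x‖ₑ ^ p * ENNReal.ofReal N := by
        refine lintegral_mono fun x => ?_
        exact mul_le_mul_right (ENNReal.ofReal_le_ofReal (hω x)) _
    _ = (∫⁻ x, ‖H x‖ₑ ^ p) * ENNReal.ofReal N := lintegral_mul_const' _ _ ENNReal.ofReal_ne_top
    _ < ∞ := ENNReal.mul_lt_top h1 ENNReal.ofReal_lt_top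

lemma memHomSobolev_of_contDiff (𝕜 : Type*) [RCLike 𝕜] (k : ℕ) {p : ℝ} (hp : 1 ≤ p)
    {ω : EuclideanSpace ℝ (Fin n) → ℝ} {N : ℝ} (hω : ∀ x, ω x ≤ N)
    {φ : EuclideanSpace ℝ (Fin n) → ℝ} (hφ : ContDiff ℝ ((⊤ : ℕ∞) : WithTop ℕ∞) φ)
    (hφc : HasCompactSupport φ) : MemHomSobolev k p ω (fun x => (φ x : 𝕜)) := by
  refine ⟨(RCLike.continuous_ofReal.comp hφ.continuous).locallyIntegrable, fun α _ => ?_⟩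
  obtain ⟨g, hg, hgs, hgw⟩ := exists_isWeakPartial_of_contDiff 𝕜 hφ hφc α
  refine ⟨⟨_, hgw⟩, ?_⟩
  have h := weightedLpNorm_lt_top_of_continuous hp hω hg
    (hφc.of_isClosed_subset isClosed_closure hgs)
  refine lt_of_eq_of_lt ?_ h
  unfold weightedLpNorm
  congr 1
  refine lintegral_congr_ae ?_
  filter_upwards [(isWeakPartial_weakPartial ⟨_, hgw⟩).ae_eq hgw] with x hx
  rw [hx, ← ofReal_norm, ← ofReal_norm, RCLike.norm_ofReal, Real.norm_eq_abs]

end SmoothFunctions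

/-! ### A weight with a peak -/

section PeakWeight

variable {n : ℕ}

/-- The weight equal to `N` in the ball of radius `1/4` about the origin and `1` elsewhere. -/
noncomputable def peakWeight (n : ℕ) (N : ℝ) : EuclideanSpace ℝ (Fin n) → ℝ :=
  fun x => 1 + (Metric.ball 0 (1 / 4)).indicator (fun _ => N - 1) x

lemma peakWeight_of_mem {N : ℝ} {x : EuclideanSpace ℝ (Fin n)}
    (hx : x ∈ Metric.ball (0 : EuclideanSpace ℝ (Fin n)) (1 / 4)) : peakWeight n N x = N := by
  rw [peakWeight, indicator_of_mem hx, add_sub_cancel]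

lemma peakWeight_of_notMem {N : ℝ} {x : EuclideanSpace ℝ (Fin n)}
    (hx : x ∉ Metric.ball (0 : EuclideanSpace ℝ (Fin n)) (1 / 4)) : peakWeight n N x = 1 := by
  rw [peakWeight, indicator_of_notMem hx, add_zero]

lemma one_le_peakWeight {N : ℝ} (hN : 1 ≤ N) (x : EuclideanSpace ℝ (Fin n)) :
    1 ≤ peakWeight n N x := by
  by_cases hx : x ∈ Metric.ball (0 : EuclideanSpace ℝ (Fin n)) (1 / 4)
  · rwa [peakWeight_of_mem hx]
  · rw [peakWeight_of_notMem hx]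

lemma peakWeight_le {N : ℝ} (hN : 1 ≤ N) (x : EuclideanSpace ℝ (Fin n)) :
    peakWeight n N x ≤ N := by
  by_cases hx : x ∈ Metric.ball (0 : EuclideanSpace ℝ (Fin n)) (1 / 4)
  · rw [peakWeight_of_mem hx]
  · rwa [peakWeight_of_notMem hx]

/-- Every mean of the weight is at most `N`, and the weight is at least one. -/
lemma muckenhouptConst_peakWeight_le {N : ℝ} (hN : 1 ≤ N) :
    muckenhouptConst 1 (peakWeight n N) ≤ ENNReal.ofReal N := by
  rw [muckenhouptConst, if_pos rfl]
  refine iSup_le fun a => iSup_le fun ℓ => iSup_le fun hℓ => ?_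
  have h1 : meanOn (axisCube a ℓ) (fun x => ENNReal.ofReal (peakWeight n N x)) ≤
      ENNReal.ofReal N := by
    unfold meanOn
    calc _ ≤ (volume (axisCube a ℓ))⁻¹ * ∫⁻ _x in axisCube a ℓ, ENNReal.ofReal N :=
          mul_le_mul_right (lintegral_mono fun x =>
            ENNReal.ofReal_le_ofReal (peakWeight_le hN x)) _
      _ = ENNReal.ofReal N := by
          rw [setLIntegral_const, mul_left_comm, ENNReal.inv_mul_cancel
            (volume_axisCube_ne_zero a hℓ) (volume_axisCube_ne_top a hℓ), mul_one]
  have h2 : essSup (fun x => (ENNReal.ofReal (peakWeight n N x))⁻¹)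
      (volume.restrict (axisCube a ℓ)) ≤ 1 := by
    refine essSup_le_of_ae_le _ (Filter.Eventually.of_forall fun x => ?_)
    refine ENNReal.inv_le_one.2 ?_
    rw [← ENNReal.ofReal_one]
    exact ENNReal.ofReal_le_ofReal (one_le_peakWeight hN x)
  calc _ ≤ ENNReal.ofReal N * 1 := mul_le_mul' h1 h2
    _ = _ := mul_one _

lemma one_le_muckenhouptConst_peakWeight (hn : 1 ≤ n) (N : ℝ) :
    1 ≤ muckenhouptConst 1 (peakWeight n N) := by
  -- a cube that does not meet the ball where the weight is `N`
  set a : EuclideanSpace ℝ (Fin n) := WithLp.toLp 2 fun _ => 1 with ha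
  have hone : ∀ x ∈ axisCube a 1, peakWeight n N x = 1 := by
    intro x hx
    refine peakWeight_of_notMem fun hb => ?_
    rw [mem_ball_zero_iff] at hb
    have h1 := PiLp.norm_apply_le x ⟨0, hn⟩
    have h2 : (1 : ℝ) ≤ x ⟨0, hn⟩ := (hx ⟨0, hn⟩).1
    have h3 := Real.le_norm_self (x ⟨0, hn⟩)
    linarith
  have hae : ∀ᵐ x ∂(volume.restrict (axisCube a 1)), peakWeight n N x = 1 := by
    filter_upwards [ae_restrict_mem (measurableSet_axisCube a 1)] with x hx
    exact hone x hx
  refine le_trans (le_of_eq ?_) (meanOn_mul_essSup_le (peakWeight n N) a one_pos)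
  have h1 : meanOn (axisCube a 1) (fun x => ENNReal.ofReal (peakWeight n N x)) = 1 := by
    unfold meanOn
    have : ∫⁻ x in axisCube a 1, ENNReal.ofReal (peakWeight n N x) =
        ∫⁻ _x in axisCube a 1, 1 := by
      refine lintegral_congr_ae ?_
      filter_upwards [hae] with x hx
      rw [hx, ENNReal.ofReal_one]
    rw [this, setLIntegral_const, one_mul, ENNReal.inv_mul_cancel
      (volume_axisCube_ne_zero a one_pos) (volume_axisCube_ne_top a one_pos)]
  have h2 : essSup (fun x => (ENNReal.ofReal (peakWeight n N x))⁻¹)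
      (volume.restrict (axisCube a 1)) = 1 := by
    have : (fun x => (ENNReal.ofReal (peakWeight n N x))⁻¹) =ᵐ[volume.restrict (axisCube a 1)]
        fun _ => 1 := by
      filter_upwards [hae] with x hx
      rw [hx, ENNReal.ofReal_one, inv_one]
    rw [essSup_congr_ae this, essSup_const]
    intro h0
    have := volume_axisCube_ne_zero a one_pos
    rw [Measure.restrict_eq_zero] at h0
    exact this h0
  rw [h1, h2, one_mul]

lemma isMuckenhoupt_peakWeight {N : ℝ} (hN : 1 ≤ N) : IsMuckenhoupt 1 (peakWeight n N) := by
  refine ⟨fun x => zero_le_one.trans (one_le_peakWeight hN x), ?_,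
    (muckenhouptConst_peakWeight_le hN).trans_lt ENNReal.ofReal_lt_top⟩
  have hm : Measurable (peakWeight n N) :=
    (measurable_const.indicator measurableSet_ball).const_add 1
  refine (locallyIntegrable_const N).mono hm.aestronglyMeasurable
    (Filter.Eventually.of_forall fun x => ?_)
  have h1 := one_le_peakWeight hN x
  rw [Real.norm_of_nonneg (by linarith), Real.norm_of_nonneg (by linarith)]
  exact peakWeight_le hN x

end PeakWeight

/-! ### Sharpness of the exponent -/

section Sharpness

variable {n : ℕ}

/-- A bump of width `1/(4k)` about a unit vector `e` has `k`-th difference `1` at base points near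
the origin, for steps near `e/k`: of the points `x + j v` only the last one meets the bump. -/
lemma orderDiff_bump_eq_one (𝕜 : Type*) [RCLike 𝕜] {k : ℕ} (hk : 1 ≤ k)
    {e : EuclideanSpace ℝ (Fin n)} (he : ‖e‖ = 1) (φ : ContDiffBump e)
    (hin : φ.rIn = 1 / (8 * k)) (hout : φ.rOut = 1 / (4 * k)) {x v : EuclideanSpace ℝ (Fin n)}
    (hx : ‖x‖ < 1 / (16 * k)) (hv : ‖v - (k : ℝ)⁻¹ • e‖ < 1 / (16 * k ^ 2)) :
    orderDiff k v (fun x => (φ x : 𝕜)) x = 1 := by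
  have hk1 : (1 : ℝ) ≤ k := by exact_mod_cast hk
  have hk0 : (0 : ℝ) < k := by linarith
  set d := v - (k : ℝ)⁻¹ • e with hd
  have hvd : v = d + (k : ℝ)⁻¹ • e := by rw [hd]; abel
  have hjd : ∀ j : ℕ, j ≤ k → ‖(j : ℝ) • d‖ ≤ 1 / (16 * k) := by
    intro j hj
    have hjk : (j : ℝ) ≤ k := by exact_mod_cast hj
    rw [norm_smul, Real.norm_natCast]
    calc (j : ℝ) * ‖d‖ ≤ k * (1 / (16 * k ^ 2)) := by gcongr
      _ = 1 / (16 * k) := by field_simp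
  have h816 : 1 / (16 * (k : ℝ)) + 1 / (16 * k) = 1 / (8 * k) := by field_simp; norm_num
  have h48 : 1 / (8 * (k : ℝ)) + 1 / (4 * k) ≤ 1 / k := by
    have : 1 / (8 * (k : ℝ)) + 1 / (4 * k) = (3 / 8) * (1 / k) := by field_simp; norm_num
    have : 0 < 1 / (k : ℝ) := by positivity
    linarith
  unfold orderDiff
  rw [Finset.sum_eq_single k]
  · have h1 : φ (x + (k : ℝ) • v) = 1 := by
      refine φ.one_of_mem_closedBall ?_
      rw [mem_closedBall_iff_norm, hin]
      have : x + (k : ℝ) • v - e = x + (k : ℝ) • d := by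
        rw [hvd, smul_add, smul_smul, mul_inv_cancel₀ hk0.ne', one_smul]
        abel
      rw [this]
      linarith [norm_add_le x ((k : ℝ) • d), hjd k le_rfl]
    simp [h1]
  · intro j hj hjk
    have hjlt : j + 1 ≤ k := by
      have := Finset.mem_range.1 hj
      omega
    have hj' : (j : ℝ) + 1 ≤ k := by exact_mod_cast hjlt
    have h0 : φ (x + (j : ℝ) • v) = 0 := by
      refine φ.zero_of_le_dist ?_
      rw [hout, dist_eq_norm]
      have h1 : (1 - j * (k : ℝ)⁻¹) • e = x + (j : ℝ) • d - (x + (j : ℝ) • v - e) := by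
        rw [hvd, smul_add, smul_smul, sub_smul, one_smul]
        abel
      have h2 : 1 / (k : ℝ) ≤ ‖(1 - j * (k : ℝ)⁻¹) • e‖ := by
        rw [norm_smul, he, mul_one]
        refine le_trans ?_ (Real.le_norm_self _)
        rw [← div_eq_mul_inv, le_sub_iff_add_le, ← add_div, div_le_one hk0]
        linarith
      rw [h1] at h2
      have h3 := norm_sub_le (x + (j : ℝ) • d) (x + (j : ℝ) • v - e)
      have h4 := norm_add_le x ((j : ℝ) • d)
      have h5 := hjd j (by omega)
      linarith
    simp [h0]
  · intro hk'
    simp at hk'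

/-- The radius `2` is large enough to contain the steps near `e / k` for which the differences based
near the origin reach the bump at `e`. The constant does not depend on the height `N`. -/
lemma le_localGagliardo_peakWeight (𝕜 : Type*) [RCLike 𝕜] {k : ℕ} (hk : 1 ≤ k) {p q s : ℝ}
    (hp : 1 ≤ p) (hq : 1 ≤ q) (hs0 : 0 < s)
    {e : EuclideanSpace ℝ (Fin n)} (he : ‖e‖ = 1) (φ : ContDiffBump e)
    (hin : φ.rIn = 1 / (8 * k)) (hout : φ.rOut = 1 / (4 * k)) :
    ∃ c : ℝ≥0∞, c ≠ 0 ∧ ∀ N : ℝ, c * ENNReal.ofReal N ^ (1 / p) ≤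
      localGagliardo k p q s 2 (peakWeight n N) (fun x => (φ x : 𝕜)) := by
  have hk1 : (1 : ℝ) ≤ k := by exact_mod_cast hk
  have hk0 : (0 : ℝ) < k := by linarith
  have hp0 : 0 < p := by linarith
  have hq0 : 0 < q := by linarith
  set E : ℝ := (n : ℝ) + s * k * q with hE
  have hE0 : 0 ≤ E := by positivity
  set B₁ := Metric.ball (0 : EuclideanSpace ℝ (Fin n)) (1 / (16 * k)) with hB₁
  set B₂ := Metric.ball ((k : ℝ)⁻¹ • e) (1 / (16 * (k : ℝ) ^ 2)) with hB₂
  have hV₁ : volume B₁ ≠ 0 := (Metric.measure_ball_pos volume _ (by positivity)).ne'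
  have hV₂ : volume B₂ ≠ 0 := (Metric.measure_ball_pos volume _ (by positivity)).ne'
  have hV₁t : volume B₁ ≠ ∞ := measure_ball_lt_top.ne
  have hV₂t : volume B₂ ≠ ∞ := measure_ball_lt_top.ne
  set c₁ : ℝ≥0∞ := (ENNReal.ofReal (2 ^ E))⁻¹ * volume B₂ with hc₁
  have hc₁0 : c₁ ≠ 0 := mul_ne_zero (ENNReal.inv_ne_zero.2 ENNReal.ofReal_ne_top) hV₂
  have hc₁t : c₁ ≠ ∞ := by
    refine ENNReal.mul_ne_top (ENNReal.inv_ne_top.2 ?_) hV₂t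
    simp only [ne_eq, ENNReal.ofReal_eq_zero, not_le]
    positivity
  have hsmall : 1 / (16 * (k : ℝ) ^ 2) ≤ 1 / 16 :=
    one_div_le_one_div_of_le (by norm_num) (by nlinarith)
  have hsub : B₂ ⊆ Metric.ball (0 : EuclideanSpace ℝ (Fin n)) 2 := by
    refine Metric.ball_subset_ball' ?_
    rw [dist_zero_right, norm_smul, he, mul_one, norm_inv, Real.norm_natCast]
    have := inv_le_one_of_one_le₀ hk1
    linarith
  have hinner : ∀ x ∈ B₁, c₁ ≤ ∫⁻ h in Metric.ball (0 : EuclideanSpace ℝ (Fin n)) 2,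
      ‖orderDiff k h (fun x => (φ x : 𝕜)) x‖ₑ ^ q / ENNReal.ofReal (‖h‖ ^ E) := by
    intro x hx
    rw [hc₁, ← setLIntegral_const]
    refine (setLIntegral_mono' measurableSet_ball fun v hv => ?_).trans (lintegral_mono_set hsub)
    have hv2 := hsub hv
    rw [mem_ball_zero_iff] at hv2
    rw [orderDiff_bump_eq_one 𝕜 hk he φ hin hout (mem_ball_zero_iff.1 hx)
      (mem_ball_iff_norm.1 hv), enorm_one, ENNReal.one_rpow, one_div]
    refine ENNReal.inv_le_inv.2 (ENNReal.ofReal_le_ofReal ?_)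
    gcongr
  refine ⟨(c₁ ^ (p / q) * volume B₁) ^ (1 / p), ?_, fun N => ?_⟩
  · refine (ENNReal.rpow_pos (pos_iff_ne_zero.2 (mul_ne_zero (ENNReal.rpow_pos
      (pos_iff_ne_zero.2 hc₁0) hc₁t).ne' hV₁)) ?_).ne'
    exact ENNReal.mul_ne_top (ENNReal.rpow_ne_top_of_nonneg (by positivity) hc₁t) hV₁t
  · rw [← ENNReal.mul_rpow_of_nonneg _ _ (by positivity)]
    unfold localGagliardo
    refine ENNReal.rpow_le_rpow ?_ (by positivity)
    have hB₁sub : B₁ ⊆ Metric.ball (0 : EuclideanSpace ℝ (Fin n)) (1 / 4) :=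
      Metric.ball_subset_ball (one_div_le_one_div_of_le (by norm_num) (by linarith))
    calc _ = ∫⁻ _x in B₁, c₁ ^ (p / q) * ENNReal.ofReal N := by
          rw [setLIntegral_const]; ring
      _ ≤ ∫⁻ x in B₁, (∫⁻ h in Metric.ball (0 : EuclideanSpace ℝ (Fin n)) 2,
            ‖orderDiff k h (fun x => (φ x : 𝕜)) x‖ₑ ^ q / ENNReal.ofReal (‖h‖ ^ E)) ^ (p / q) *
              ENNReal.ofReal (peakWeight n N x) := by
          refine setLIntegral_mono' measurableSet_ball fun x hx => ?_
          rw [peakWeight_of_mem (hB₁sub hx)]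
          exact mul_le_mul_left (ENNReal.rpow_le_rpow (hinner x hx) (by positivity)) _
      _ ≤ _ := setLIntegral_le_lintegral _ _

/-- A function that vanishes on the peak does not see its height. -/
lemma weightedLpNorm_peakWeight_le {p : ℝ} (hp : 1 ≤ p) (N : ℝ) {F : EuclideanSpace ℝ (Fin n) → ℝ}
    {H : EuclideanSpace ℝ (Fin n) → ℝ} (hFH : F =ᵐ[volume] H)
    (hH : ∀ x ∈ Metric.ball (0 : EuclideanSpace ℝ (Fin n)) (1 / 4), H x = 0) :
    weightedLpNorm p (peakWeight n N) F ≤ weightedLpNorm p (fun _ => 1) H := by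
  refine ENNReal.rpow_le_rpow (lintegral_mono_ae ?_) (by positivity)
  filter_upwards [hFH] with x hx
  rw [hx]
  by_cases hb : x ∈ Metric.ball (0 : EuclideanSpace ℝ (Fin n)) (1 / 4)
  · rw [hH x hb, enorm_zero, ENNReal.zero_rpow_of_pos (by linarith), zero_mul]
    exact zero_le
  · rw [peakWeight_of_notMem hb]

/-- The exponent of the `A_1` constant is sharp. The test function is a bump whose gradient lives
away from the peak of the weight, while its differences based at the peak do not vanish. -/
lemma one_div_le_of_localGagliardo_le (𝕜 : Type*) [RCLike 𝕜] {k : ℕ} (hn : 1 ≤ n) (hk : 1 ≤ k)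
    {p q s : ℝ} (hp : 1 ≤ p) (hq : 1 ≤ q) (hs0 : 0 < s) {b : ℝ} {c A B : ℝ≥0∞}
    (hc : c ≠ 0) (hA : A ≠ ∞) (hB : B ≠ ∞)
    (h : ∀ ω : EuclideanSpace ℝ (Fin n) → ℝ, IsMuckenhoupt 1 ω →
      ∀ f : EuclideanSpace ℝ (Fin n) → 𝕜, MemHomSobolev k p ω f →
        c * localGagliardo k p q s 2 ω f ≤
          A * muckenhouptConst 1 ω ^ b * B * weightedLpNorm p ω (weakGradLength k f)) :
    1 / p ≤ b := by
  by_contra! hb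
  have hk1 : (1 : ℝ) ≤ k := by exact_mod_cast hk
  have hk0 : (0 : ℝ) < k := by linarith
  have hp0 : 0 < p := by linarith
  set e : EuclideanSpace ℝ (Fin n) := EuclideanSpace.single ⟨0, hn⟩ 1 with he
  have hen : ‖e‖ = 1 := by simp [he]
  let φ : ContDiffBump e := ⟨1 / (8 * k), 1 / (4 * k), by positivity,
    one_div_lt_one_div_of_lt (by positivity) (by linarith)⟩
  obtain ⟨c₂, hc₂, hlow⟩ := le_localGagliardo_peakWeight 𝕜 hk hp hq hs0 hen φ rfl rfl
  obtain ⟨H, hH, hHc, hH0, hHae⟩ := exists_weakGradLength_ae_eq_of_contDiff 𝕜 k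
    φ.contDiff φ.hasCompactSupport
  set R := weightedLpNorm p (fun _ => 1) H with hR
  have hRt : R ≠ ∞ :=
    (weightedLpNorm_lt_top_of_continuous hp (fun _ => le_rfl) hH hHc).ne
  have hHball : ∀ x ∈ Metric.ball (0 : EuclideanSpace ℝ (Fin n)) (1 / 4), H x = 0 := by
    intro x hx
    refine hH0 x fun hx2 => ?_
    rw [φ.tsupport_eq, mem_closedBall_iff_norm] at hx2
    have h1 : φ.rOut ≤ 1 / 4 := one_div_le_one_div_of_le (by norm_num) (by linarith)
    have h2 := norm_sub_norm_le e x
    rw [norm_sub_rev] at h2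
    rw [mem_ball_zero_iff] at hx
    rw [hen] at h2
    linarith
  -- with a negative exponent the power would decrease in the constant of the weight
  set b' := max b 0 with hb'
  have hb'p : b' < 1 / p := max_lt hb (by positivity)
  have hb'0 : 0 ≤ b' := le_max_right _ _
  set δ := 1 / p - b' with hδ
  have hδ0 : 0 < δ := by linarith
  have hmain : ∀ N : ℝ, 1 ≤ N → c * c₂ * ENNReal.ofReal N ^ δ ≤ A * B * R := by
    intro N hN
    have hN0 : 0 < N := by linarith
    have h1 := h _ (isMuckenhoupt_peakWeight hN) _
      (memHomSobolev_of_contDiff 𝕜 k hp (peakWeight_le hN) φ.contDiff φ.hasCompactSupport)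
    have hone := one_le_muckenhouptConst_peakWeight hn N
    have hconst : muckenhouptConst 1 (peakWeight n N) ^ b ≤ ENNReal.ofReal N ^ b' :=
      (ENNReal.rpow_le_rpow_of_exponent_le hone (le_max_left _ _)).trans
        (ENNReal.rpow_le_rpow (muckenhouptConst_peakWeight_le hN) hb'0)
    have hNb0 : ENNReal.ofReal N ^ b' ≠ 0 :=
      (ENNReal.rpow_pos (ENNReal.ofReal_pos.2 hN0) ENNReal.ofReal_ne_top).ne'
    have hNbt : ENNReal.ofReal N ^ b' ≠ ∞ :=
      ENNReal.rpow_ne_top_of_nonneg hb'0 ENNReal.ofReal_ne_top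
    refine (ENNReal.mul_le_mul_iff_left hNb0 hNbt).1 ?_
    calc c * c₂ * ENNReal.ofReal N ^ δ * ENNReal.ofReal N ^ b'
        = c * (c₂ * ENNReal.ofReal N ^ (1 / p)) := by
          rw [mul_assoc (c * c₂), ← ENNReal.rpow_add_of_nonneg _ _ hδ0.le hb'0, hδ, sub_add_cancel]
          ring
      _ ≤ c * localGagliardo k p q s 2 (peakWeight n N) (fun x => (φ x : 𝕜)) :=
          mul_le_mul_right (hlow N) _
      _ ≤ _ := h1
      _ ≤ A * ENNReal.ofReal N ^ b' * B * R := by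
          refine mul_le_mul' (mul_le_mul_left (mul_le_mul_right hconst _) _) ?_
          exact weightedLpNorm_peakWeight_le hp N hHae hHball
      _ = _ := by ring
  have hm0 : c * c₂ ≠ 0 := mul_ne_zero hc hc₂
  have hTt : A * B * R / (c * c₂) ≠ ∞ := ENNReal.div_ne_top (by finiteness) hm0
  set X : ℝ := (A * B * R / (c * c₂)).toReal + 1 with hX
  have hX1 : 1 ≤ X := by
    have := ENNReal.toReal_nonneg (a := A * B * R / (c * c₂))
    linarith
  have h2 := hmain (X ^ (1 / δ)) (Real.one_le_rpow hX1 (by positivity))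
  rw [ENNReal.ofReal_rpow_of_nonneg (by positivity) hδ0.le, ← Real.rpow_mul (by positivity),
    one_div_mul_cancel hδ0.ne', Real.rpow_one, mul_comm] at h2
  have hmt : c * c₂ ≠ ∞ := by
    intro htop
    rw [htop, ENNReal.mul_top (by simp; linarith), top_le_iff] at h2
    exact absurd h2 (by finiteness)
  have h3 := (ENNReal.le_div_iff_mul_le (Or.inl hm0) (Or.inl hmt)).2 h2
  have h4 := (ENNReal.ofReal_le_iff_le_toReal hTt).1 h3
  linarith

end Sharpness

/-! ### The theorem -/

theorem theorem1p1 {𝕜 : Type*} [RCLike 𝕜] (n k : ℕ) (hn : 1 ≤ n) (hk : 1 ≤ k)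
    (p : ℝ) (hp : 1 ≤ p) :
    -- part (i): the estimate for `A_1` weights, and sharpness of the exponent `1 / p`
    (∀ q : ℝ, 1 ≤ q → (n : ℝ) * (1 / p - 1 / q) < k →
      (∃ C : ℝ, 0 < C ∧
        ∀ ω : EuclideanSpace ℝ (Fin n) → ℝ, IsMuckenhoupt 1 ω →
        ∀ s : ℝ, 0 < s → s < 1 → ∀ r : ℝ, 0 < r →
        ∀ f : EuclideanSpace ℝ (Fin n) → 𝕜, MemHomSobolev k p ω f →
          ENNReal.ofReal ((1 - s) ^ gammaExponent p q) * localGagliardo k p q s r ω f ≤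
            ENNReal.ofReal C * muckenhouptConst 1 ω ^ (1 / p) *
              ENNReal.ofReal (r ^ ((1 - s) * k)) * weightedLpNorm p ω (weakGradLength k f)) ∧
      (∀ s : ℝ, 0 < s → s < 1 → ∀ b : ℝ,
        (∃ C : ℝ, 0 < C ∧
          ∀ ω : EuclideanSpace ℝ (Fin n) → ℝ, IsMuckenhoupt 1 ω →
          ∀ r : ℝ, 0 < r →
          ∀ f : EuclideanSpace ℝ (Fin n) → 𝕜, MemHomSobolev k p ω f →
            ENNReal.ofReal ((1 - s) ^ gammaExponent p q) * localGagliardo k p q s r ω f ≤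
              ENNReal.ofReal C * muckenhouptConst 1 ω ^ b *
                ENNReal.ofReal (r ^ ((1 - s) * k)) * weightedLpNorm p ω (weakGradLength k f)) →
        1 / p ≤ b)) ∧
    -- part (ii): the estimate for `A_p` weights with `p > 1`
    (1 < p → ∀ q : ℝ, 1 ≤ q →
      ∃ C : ℝ → ℝ, (∀ β, 0 < C β) ∧
        ∀ ω : EuclideanSpace ℝ (Fin n) → ℝ, IsMuckenhoupt p ω →
        (n : ℝ) * (muckenhouptIndex ω / p - 1 / q) < k →
        ∃ β : ℝ, muckenhouptIndex ω < β ∧ β < p ∧ IsMuckenhoupt β ω ∧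
        ∀ s : ℝ, 0 < s → s < 1 → ∀ r : ℝ, 0 < r →
        ∀ f : EuclideanSpace ℝ (Fin n) → 𝕜, MemHomSobolev k p ω f →
          ENNReal.ofReal ((1 - s) ^ (1 / q)) * localGagliardo k p q s r ω f ≤
            ENNReal.ofReal (C β) * muckenhouptConst β ω ^ (β / (p * (β - 1))) *
              ENNReal.ofReal (r ^ ((1 - s) * k)) * weightedLpNorm p ω (weakGradLength k f)) := by
  obtain ⟨m, rfl⟩ : ∃ m, k = m + 1 := ⟨k - 1, by omega⟩
  refine ⟨fun q hq hlt => ⟨exists_localGagliardo_le_of_A1 𝕜 n m hp hq hlt, ?_⟩, fun hp1 q hq => ?_⟩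
  · rintro s hs0 hs1 b ⟨C, hC, h⟩
    have hpos : 0 < (1 - s) ^ gammaExponent p q := Real.rpow_pos_of_pos (by linarith) _
    exact one_div_le_of_localGagliardo_le 𝕜 hn hk hp hq hs0 (ENNReal.ofReal_pos.2 hpos).ne'
      ENNReal.ofReal_ne_top ENNReal.ofReal_ne_top fun ω hω f hf => h ω hω 2 two_pos f hf
  -- the constant depends on `β` alone; its value at inadmissible `β` is irrelevant
  · have hex : ∀ β : ℝ, ∃ C : ℝ, 0 < C ∧ (1 < β → β < p →
        (n : ℝ) * (β / p - 1 / q) < (m + 1 : ℕ) →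
        ∀ ω : EuclideanSpace ℝ (Fin n) → ℝ, IsMuckenhoupt β ω →
        ∀ s : ℝ, 0 < s → s < 1 → ∀ r : ℝ, 0 < r →
        ∀ f : EuclideanSpace ℝ (Fin n) → 𝕜, MemHomSobolev (m + 1) p ω f →
          ENNReal.ofReal ((1 - s) ^ (1 / q)) * localGagliardo (m + 1) p q s r ω f ≤
            ENNReal.ofReal C * muckenhouptConst β ω ^ (β / (p * (β - 1))) *
              ENNReal.ofReal (r ^ ((1 - s) * (m + 1 : ℕ))) *
                weightedLpNorm p ω (weakGradLength (m + 1) f)) := by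
      intro β
      by_cases hβ : 1 < β ∧ β < p ∧ (n : ℝ) * (β / p - 1 / q) < (m + 1 : ℕ)
      · obtain ⟨C, hC, h⟩ := exists_localGagliardo_le_of_lt 𝕜 n m hβ.1 hβ.2.1 hq hβ.2.2
        exact ⟨C, hC, fun _ _ _ => h⟩
      · exact ⟨1, one_pos, fun h1 h2 h3 => absurd ⟨h1, h2, h3⟩ hβ⟩
    choose C hC h using hex
    refine ⟨C, hC, fun ω hω hlt => ?_⟩
    obtain ⟨hι1, hιp, hι⟩ := hω.muckenhouptIndex_lt hn hp1
    have hcont : Filter.Tendsto (fun β : ℝ => (n : ℝ) * (β / p - 1 / q))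
        (nhdsWithin (muckenhouptIndex ω) (Ioi (muckenhouptIndex ω)))
        (nhds ((n : ℝ) * (muckenhouptIndex ω / p - 1 / q))) := by
      refine Filter.Tendsto.mono_left ?_ nhdsWithin_le_nhds
      exact Continuous.tendsto (by fun_prop) _
    -- any `β` slightly larger than the critical index satisfies the condition on the parameters
    obtain ⟨β, hβ1, hβ2⟩ := ((hcont.eventually_lt_const hlt).and (Ioo_mem_nhdsGT hιp)).exists
    exact ⟨β, hβ2.1, hβ2.2, hι β hβ2.1, h β (hι1.trans_lt hβ2.1) hβ2.2 hβ1 ω (hι β hβ2.1)⟩
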